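/- Let $\mathbb K$ be a field, $\mathcal V$ a finite non-empty set, and $R=\bigoplus_{\lambda\in\mathcal V}\mathbb K\lambda$ the algebra with $\lambda\mu=\delta_{\lambda\mu}\lambda$. Let $E=\mathring R\otimes R$ ($\mathring R$ a copy of $R$), with $\Delta(\mathring\lambda\mu)=\sum_\nu \mathring\lambda\nu\otimes\mathring\nu\mu$ and $\varepsilon(\mathring\lambda\mu)=\delta_{\lambda\mu}$. A $\mathcal V$-face algebra is an algebra and coalgebra $H$ with an algebra-coalgebra map $E\to H$ such that $\Delta(ab)=\Delta(a)\Delta(b)$ and $\varepsilon(ab)=\sum_\nu\varepsilon(a\nu)\varepsilon(\mathring\nu b)$. Its finite-dimensional right comodules form a monoidal category $\mathbf{com}(H)$: a comodule is an $R$-bimodule by $\lambda m\mu=\sum m_{(0)}\varepsilon(\lambda m_{(1)}\mu)$, the product is $M\otimes_R N$ with coaction $m\otimes n\mapsto\sum (m_{(0)}\otimes n_{(0)})\otimes m_{(1)}n_{(1)}$, and the unit is $R$ with coaction $\mu\mapsto\sum_\lambda\lambda\otimes\mathring\lambda\mu$. Let $\mathbf C$ be a split finite semisimple tensor category over $\mathbb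 K$: a $\mathbb K$-linear abelian monoidal category with $\mathbb K$-bilinear $\otimes$, unit $I$, associativity constraint $a$ and right unit constraint $r$, together with objects $L_\lambda$ ($\lambda\in\mathcal V$) such that $\mathbf C(L_\lambda,L_\mu)=0$ for $\lambda\ne\mu$, $\mathbf C(L_\lambda,L_\lambda)=\mathbb K\,\mathrm{id}\cong\mathbb K$, and every object is isomorphic to a finite direct sum of $L_\lambda$'s. **Theorem.** (i) Setting $\lambda\,\Omega_0(X)\,\mu=\mathbf C(L_\mu,L_\lambda\otimes X)$ and $\Omega_0(f)(k)=(\mathrm{id}_{L_\lambda}\otimes f)\circ k$ gives a faithful $\mathbb K$-linear exact functor $\Omega_0$ from $\mathbf C$ to the category $\mathbf{bmd}(R)$ of finite-dimensional $R$-bimodules, and it is a (strong) monoidal functor for $\otimes_R$ with $\varphi_2(f\otimes g)=a_{L_\lambda,X,Y}\circ(f\otimes\mathrm{id}_Y)\circ g$ for $f\in\lambda\Omega_0(X)\nu$, $g\in\nu\Omega_0(Y)\mu$, and $\varphi_0:R\to\Omega_0(I)$, $\varphi_0(\lambda)=r_{L_\lambda}^{-1}$. (ii) The coend $C(\Omega_0)$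 of $\Omega_0^*\otimes\Omega_0$ in the category of $E$-bimodules exists, with universal dinatural maps $\kappa_X:\Omega_0(X)^*\otimes\Omega_0(X)\to C(\Omega_0)$. (Here $\langle\mathring\lambda\varphi\mathring\mu,m\rangle=\langle\varphi,\lambda m\mu\rangle$ for $\varphi\in\Omega_0(X)^*$, and $R$ acts on the second factor.) It carries a $\mathcal V$-face algebra structure which induces its $E$-bimodule structure and for which, with $\delta_X(m)=\sum_i m_i\otimes\kappa_X(m^i\otimes m)$ ($\{m_i\}$, $\{m^i\}$ dual bases of $\Omega_0(X)$ and $\Omega_0(X)^*$): $\Delta(\kappa_X(\varphi\otimes m))=\sum_i\kappa_X(\varphi\otimes m_i)\otimes\kappa_X(m^i\otimes m)$, $\varepsilon(\kappa_X(\varphi\otimes m))=\langle\varphi,m\rangle$, and the maps $\varphi_2$, $\varphi_0$ are compatible with the coactions. (iii) With the coactions $\delta_X$, $\Omega_0$ lifts to a $\mathbb K$-linear monoidal functor $\mathbf C\to\mathbf{com}(C(\Omega_0))$, with monoidal structure given by $\varphi_2,\varphi_0$, and this functor is an equivalence of categories. Thus $\Omega_0$ gives an equivalence of tensor categories $\mathbf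 C\simeq\mathbf{com}(C(\Omega_0))$. -/

import Mathlib

open CategoryTheory MonoidalCategory Limits
open scoped TensorProduct

universe v u

noncomputable section

/-- A bimodule structure over a `K`-algebra `A` on a `K`-vector space `M`: commuting `K`-linear
left and right actions of `A`, both inducing the given action of `K`. -/
structure BimoduleStr (K A M : Type*) [Field K] [Ring A] [Algebra K A]
    [AddCommGroup M] [Module K M] where
  left : A →ₐ[K] Module.End K M
  right : Aᵐᵒᵖ →ₐ[K] Module.End K M
  comm : ∀ (a : A) (b : Aᵐᵒᵖ) (m : M), left a (right b m) = right b (left a m)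

namespace BimoduleStr

section

variable {K A M N P Q : Type*} [Field K] [Ring A] [Algebra K A]
  [AddCommGroup M] [Module K M] [AddCommGroup N] [Module K N]
  [AddCommGroup P] [Module K P] [AddCommGroup Q] [Module K Q]

@[simp] lemma right_algebraMap (s : BimoduleStr K A M) (r : K) (m : M) :
    s.right (MulOpposite.op (algebraMap K A r)) m = r • m := by
  rw [← MulOpposite.algebraMap_apply, AlgHom.commutes]
  rfl

/-- The regular bimodule. -/
def regular (K A : Type*) [Field K] [Ring A] [Algebra K A] : BimoduleStr K A A where
  left := Algebra.lmul K A
  right :=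
    { toFun := fun b => LinearMap.mulRight K b.unop
      map_one' := by ext; simp
      map_mul' := fun a b => by ext; simp [mul_assoc]
      map_zero' := by ext; simp
      map_add' := fun a b => by ext; simp [mul_add]
      commutes' := fun r => by
        ext x
        change x * algebraMap K A r = r • x
        rw [← Algebra.commutes, Algebra.smul_def] }
  comm := fun a b m => by
    change a * (m * b.unop) = (a * m) * b.unop
    rw [mul_assoc]

@[simp] lemma regular_left (a x : A) : (regular K A).left a x = a * x := rfl
@[simp] lemma regular_right (a : Aᵐᵒᵖ) (x : A) : (regular K A).right a x = x * a.unop := rfl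

/-- Homomorphisms of `A`-bimodules, as a subspace of the space of linear maps. -/
def homs (s : BimoduleStr K A M) (t : BimoduleStr K A N) : Submodule K (M →ₗ[K] N) where
  carrier := {f | (∀ a x, f (s.left a x) = t.left a (f x)) ∧
    (∀ a x, f (s.right a x) = t.right a (f x))}
  add_mem' := fun hf hg => ⟨fun a x => by simp [hf.1, hg.1], fun a x => by simp [hf.2, hg.2]⟩
  zero_mem' := ⟨fun a x => by simp, fun a x => by simp⟩
  smul_mem' := fun c f hf => ⟨fun a x => by simp [hf.1], fun a x => by simp [hf.2]⟩

/-- The relations `m a ⊗ n = m ⊗ a n`. -/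
def balancing (s : BimoduleStr K A M) (t : BimoduleStr K A N) : Submodule K (M ⊗[K] N) :=
  Submodule.span K {x | ∃ (m : M) (a : A) (n : N),
    x = s.right (MulOpposite.op a) m ⊗ₜ[K] n - m ⊗ₜ[K] t.left a n}

/-- The tensor product `M ⊗_A N` of bimodules. -/
abbrev Tensor (s : BimoduleStr K A M) (t : BimoduleStr K A N) : Type _ :=
  (M ⊗[K] N) ⧸ balancing s t

/-- The class of `m ⊗ n` in `M ⊗_A N`. -/
def tmul (s : BimoduleStr K A M) (t : BimoduleStr K A N) : M →ₗ[K] N →ₗ[K] Tensor s t :=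
  (TensorProduct.mk K M N).compr₂ (balancing s t).mkQ

lemma tmul_balanced (s : BimoduleStr K A M) (t : BimoduleStr K A N) (m : M) (a : A) (n : N) :
    tmul s t (s.right (MulOpposite.op a) m) n = tmul s t m (t.left a n) := by
  change (balancing s t).mkQ _ = (balancing s t).mkQ _
  rw [← sub_eq_zero, ← map_sub, Submodule.mkQ_apply, Submodule.Quotient.mk_eq_zero]
  exact Submodule.subset_span ⟨m, a, n, rfl⟩

/-- The linear map on `M ⊗_A N` induced by a balanced bilinear map. -/
def lift (s : BimoduleStr K A M) (t : BimoduleStr K A N) (f : M →ₗ[K] N →ₗ[K] P)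
    (h : ∀ m a n, f (s.right (MulOpposite.op a) m) n = f m (t.left a n)) :
    Tensor s t →ₗ[K] P :=
  (balancing s t).liftQ (TensorProduct.lift f) (by
    rw [balancing, Submodule.span_le]
    rintro x ⟨m, a, n, rfl⟩
    simp [h])

@[simp] lemma lift_tmul (s : BimoduleStr K A M) (t : BimoduleStr K A N)
    (f : M →ₗ[K] N →ₗ[K] P) (h) (m : M) (n : N) : lift s t f h (tmul s t m n) = f m n := rfl

lemma Tensor.ext {s : BimoduleStr K A M} {t : BimoduleStr K A N} {f g : Tensor s t →ₗ[K] P}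
    (h : ∀ m n, f (tmul s t m n) = g (tmul s t m n)) : f = g := by
  apply Submodule.linearMap_qext
  apply TensorProduct.ext'
  exact h

lemma Tensor.induction {s : BimoduleStr K A M} {t : BimoduleStr K A N} {p : Tensor s t → Prop}
    (zero : p 0) (tm : ∀ m n, p (tmul s t m n)) (add : ∀ x y, p x → p y → p (x + y))
    (x : Tensor s t) : p x := by
  obtain ⟨y, rfl⟩ := Submodule.mkQ_surjective _ x
  induction y using TensorProduct.induction_on with
  | zero => simpa using zero
  | tmul m n => exact tm m n
  | add a b ha hb => rw [map_add]; exact add _ _ ha hb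

/-- `f ⊗_A g` for linear maps `f` respecting right actions and `g` respecting left actions. -/
def map {M' N' : Type*} [AddCommGroup M'] [Module K M'] [AddCommGroup N'] [Module K N']
    (s : BimoduleStr K A M) (t : BimoduleStr K A N)
    (s' : BimoduleStr K A M') (t' : BimoduleStr K A N') (f : M →ₗ[K] M') (g : N →ₗ[K] N')
    (hf : ∀ a x, f (s.right a x) = s'.right a (f x))
    (hg : ∀ a x, g (t.left a x) = t'.left a (g x)) : Tensor s t →ₗ[K] Tensor s' t' :=
  lift s t ((tmul s' t').compl₁₂ f g) (fun m a n => by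
    simp only [LinearMap.compl₁₂_apply, hf, hg, tmul_balanced])

@[simp] lemma map_tmul {M' N' : Type*} [AddCommGroup M'] [Module K M']
    [AddCommGroup N'] [Module K N']
    (s : BimoduleStr K A M) (t : BimoduleStr K A N)
    (s' : BimoduleStr K A M') (t' : BimoduleStr K A N') (f : M →ₗ[K] M') (g : N →ₗ[K] N')
    (hf) (hg) (m : M) (n : N) :
    map s t s' t' f g hf hg (tmul s t m n) = tmul s' t' (f m) (g n) := rfl

/-- The bimodule structure `a (m ⊗ n) b = a m ⊗ n b` on `M ⊗_A N`. -/
def tensor (s : BimoduleStr K A M) (t : BimoduleStr K A N) : BimoduleStr K A (Tensor s t) where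
  left :=
    { toFun := fun a => map s t s t (s.left a) LinearMap.id (fun b x => s.comm a b x)
        (fun _ _ => rfl)
      map_one' := Tensor.ext fun m n => by simp
      map_mul' := fun a b => Tensor.ext fun m n => by simp
      map_zero' := Tensor.ext fun m n => by simp
      map_add' := fun a b => Tensor.ext fun m n => by simp
      commutes' := fun r => Tensor.ext fun m n => by simp }
  right :=
    { toFun := fun a => map s t s t LinearMap.id (t.right a) (fun _ _ => rfl)
        (fun b x => (t.comm b a x).symm)
      map_one' := Tensor.ext fun m n => by simp
      map_mul' := fun a b => Tensor.ext fun m n => by simp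
      map_zero' := Tensor.ext fun m n => by simp
      map_add' := fun a b => Tensor.ext fun m n => by simp
      commutes' := fun r => Tensor.ext fun m n => by simp }
  comm := fun a b m => by
    induction m using Tensor.induction with
    | zero => simp
    | tm m n => rfl
    | add x y hx hy => simp only [map_add, hx, hy]

@[simp] lemma tensor_left (s : BimoduleStr K A M) (t : BimoduleStr K A N) (a : A) (m : M) (n : N) :
    (tensor s t).left a (tmul s t m n) = tmul s t (s.left a m) n := rfl
@[simp] lemma tensor_right (s : BimoduleStr K A M) (t : BimoduleStr K A N) (a : Aᵐᵒᵖ) (m : M)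
    (n : N) : (tensor s t).right a (tmul s t m n) = tmul s t m (t.right a n) := rfl

/-- `(M ⊗_A N) ⊗_A P → M ⊗_A (N ⊗_A P)`. -/
def assocHom (s : BimoduleStr K A M) (t : BimoduleStr K A N) (r : BimoduleStr K A P) :
    Tensor (tensor s t) r →ₗ[K] Tensor s (tensor t r) :=
  lift (tensor s t) r
    (lift s t (LinearMap.mk₂ K (fun m n => tmul s (tensor t r) m ∘ₗ tmul t r n)
      (fun _ _ _ => by ext; simp) (fun _ _ _ => by ext; simp)
      (fun _ _ _ => by ext; simp) (fun _ _ _ => by ext; simp))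
      (fun m a n => by ext p; simp [tmul_balanced]))
    (fun x a p => by
      induction x using Tensor.induction with
      | zero => simp
      | tm m n => simp [tmul_balanced]
      | add x y hx hy => simp only [map_add, LinearMap.add_apply, hx, hy])

@[simp] lemma assocHom_tmul (s : BimoduleStr K A M) (t : BimoduleStr K A N)
    (r : BimoduleStr K A P) (m : M) (n : N) (p : P) :
    assocHom s t r (tmul _ _ (tmul _ _ m n) p) = tmul _ _ m (tmul _ _ n p) := rfl

/-- `M ⊗_A (N ⊗_A P) → (M ⊗_A N) ⊗_A P`. -/
def assocInv (s : BimoduleStr K A M) (t : BimoduleStr K A N) (r : BimoduleStr K A P) :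
    Tensor s (tensor t r) →ₗ[K] Tensor (tensor s t) r :=
  lift s (tensor t r)
    (LinearMap.flip (lift t r (LinearMap.mk₂ K
      (fun n p => (tmul (tensor s t) r).flip p ∘ₗ (tmul s t).flip n)
      (fun _ _ _ => by ext; simp) (fun _ _ _ => by ext; simp)
      (fun _ _ _ => by ext; simp) (fun _ _ _ => by ext; simp))
      (fun n a p => by ext m; simp [← tmul_balanced])))
    (fun m a x => by
      induction x using Tensor.induction with
      | zero => simp
      | tm m n => simp [tmul_balanced]
      | add x y hx hy => simp only [map_add, hx, hy])

@[simp] lemma assocInv_tmul (s : BimoduleStr K A M) (t : BimoduleStr K A N)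
    (r : BimoduleStr K A P) (m : M) (n : N) (p : P) :
    assocInv s t r (tmul _ _ m (tmul _ _ n p)) = tmul _ _ (tmul _ _ m n) p := rfl

lemma Tensor.ext₃ {s : BimoduleStr K A M} {t : BimoduleStr K A N} {r : BimoduleStr K A P}
    {f g : Tensor (tensor s t) r →ₗ[K] Q}
    (h : ∀ m n p, f (tmul _ _ (tmul _ _ m n) p) = g (tmul _ _ (tmul _ _ m n) p)) : f = g := by
  refine Tensor.ext fun x p => ?_
  induction x using Tensor.induction with
  | zero => simp
  | tm m n => exact h m n p
  | add x y hx hy => simp only [map_add, LinearMap.add_apply, hx, hy]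

lemma Tensor.ext₃' {s : BimoduleStr K A M} {t : BimoduleStr K A N} {r : BimoduleStr K A P}
    {f g : Tensor s (tensor t r) →ₗ[K] Q}
    (h : ∀ m n p, f (tmul _ _ m (tmul _ _ n p)) = g (tmul _ _ m (tmul _ _ n p))) : f = g := by
  refine Tensor.ext fun m x => ?_
  induction x using Tensor.induction with
  | zero => simp
  | tm n p => exact h m n p
  | add x y hx hy => simp only [map_add, hx, hy]

lemma Tensor.ext₄ {O : Type*} [AddCommGroup O] [Module K O] {w : BimoduleStr K A O}
    {s : BimoduleStr K A M} {t : BimoduleStr K A N} {r : BimoduleStr K A P}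
    {f g : Tensor (tensor (tensor w s) t) r →ₗ[K] Q}
    (h : ∀ o m n p, f (tmul _ _ (tmul _ _ (tmul _ _ o m) n) p) =
      g (tmul _ _ (tmul _ _ (tmul _ _ o m) n) p)) : f = g := by
  refine Tensor.ext₃ fun x n p => ?_
  induction x using Tensor.induction with
  | zero => simp
  | tm o m => exact h o m n p
  | add x y hx hy => simp only [map_add, LinearMap.add_apply, hx, hy]

/-- `A ⊗_A M → M`. -/
def lunitHom (s : BimoduleStr K A M) : Tensor (regular K A) s →ₗ[K] M :=
  lift (regular K A) s s.left.toLinearMap (fun m a n => by simp)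

@[simp] lemma lunitHom_tmul (s : BimoduleStr K A M) (a : A) (m : M) :
    lunitHom s (tmul _ _ a m) = s.left a m := rfl

/-- `M ⊗_A A → M`. -/
def runitHom (s : BimoduleStr K A M) : Tensor s (regular K A) →ₗ[K] M :=
  lift s (regular K A)
    (LinearMap.flip (s.right.toLinearMap ∘ₗ (MulOpposite.opLinearEquiv K).toLinearMap))
    (fun m a n => by simp)

@[simp] lemma runitHom_tmul (s : BimoduleStr K A M) (m : M) (a : A) :
    runitHom s (tmul _ _ m a) = s.right (MulOpposite.op a) m := rfl

lemma map_left {M' N' : Type*} [AddCommGroup M'] [Module K M']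
    [AddCommGroup N'] [Module K N']
    (s : BimoduleStr K A M) (t : BimoduleStr K A N)
    (s' : BimoduleStr K A M') (t' : BimoduleStr K A N') (f : M →ₗ[K] M') (g : N →ₗ[K] N')
    (hf) (hg) (hf' : ∀ a x, f (s.left a x) = s'.left a (f x)) (a : A) (x : Tensor s t) :
    map s t s' t' f g hf hg ((tensor s t).left a x) =
      (tensor s' t').left a (map s t s' t' f g hf hg x) := by
  induction x using Tensor.induction with
  | zero => simp
  | tm m n => simp [hf']
  | add x y hx hy => simp only [map_add, hx, hy]

lemma map_right {M' N' : Type*} [AddCommGroup M'] [Module K M']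
    [AddCommGroup N'] [Module K N']
    (s : BimoduleStr K A M) (t : BimoduleStr K A N)
    (s' : BimoduleStr K A M') (t' : BimoduleStr K A N') (f : M →ₗ[K] M') (g : N →ₗ[K] N')
    (hf) (hg) (hg' : ∀ a x, g (t.right a x) = t'.right a (g x)) (a : Aᵐᵒᵖ) (x : Tensor s t) :
    map s t s' t' f g hf hg ((tensor s t).right a x) =
      (tensor s' t').right a (map s t s' t' f g hf hg x) := by
  induction x using Tensor.induction with
  | zero => simp
  | tm m n => simp [hg']
  | add x y hx hy => simp only [map_add, hx, hy]

lemma assocHom_left (s : BimoduleStr K A M) (t : BimoduleStr K A N) (r : BimoduleStr K A P)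
    (a : A) (x : Tensor (tensor s t) r) :
    assocHom s t r ((tensor (tensor s t) r).left a x) =
      (tensor s (tensor t r)).left a (assocHom s t r x) := by
  have h : assocHom s t r ∘ₗ (tensor (tensor s t) r).left a =
      (tensor s (tensor t r)).left a ∘ₗ assocHom s t r := Tensor.ext₃ fun _ _ _ => rfl
  exact LinearMap.congr_fun h x

lemma assocHom_right (s : BimoduleStr K A M) (t : BimoduleStr K A N) (r : BimoduleStr K A P)
    (a : Aᵐᵒᵖ) (x : Tensor (tensor s t) r) :
    assocHom s t r ((tensor (tensor s t) r).right a x) =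
      (tensor s (tensor t r)).right a (assocHom s t r x) := by
  have h : assocHom s t r ∘ₗ (tensor (tensor s t) r).right a =
      (tensor s (tensor t r)).right a ∘ₗ assocHom s t r := Tensor.ext₃ fun _ _ _ => rfl
  exact LinearMap.congr_fun h x

lemma lunitHom_left (s : BimoduleStr K A M) (a : A) (x : Tensor (regular K A) s) :
    lunitHom s ((tensor (regular K A) s).left a x) = s.left a (lunitHom s x) := by
  induction x using Tensor.induction with
  | zero => simp
  | tm m n => simp
  | add x y hx hy => simp only [map_add, hx, hy]

lemma lunitHom_right (s : BimoduleStr K A M) (a : Aᵐᵒᵖ) (x : Tensor (regular K A) s) :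
    lunitHom s ((tensor (regular K A) s).right a x) = s.right a (lunitHom s x) := by
  induction x using Tensor.induction with
  | zero => simp
  | tm m n => simp [s.comm]
  | add x y hx hy => simp only [map_add, hx, hy]

lemma runitHom_left (s : BimoduleStr K A M) (a : A) (x : Tensor s (regular K A)) :
    runitHom s ((tensor s (regular K A)).left a x) = s.left a (runitHom s x) := by
  induction x using Tensor.induction with
  | zero => simp
  | tm m n => simp [s.comm]
  | add x y hx hy => simp only [map_add, hx, hy]

lemma runitHom_right (s : BimoduleStr K A M) (a : Aᵐᵒᵖ) (x : Tensor s (regular K A)) :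
    runitHom s ((tensor s (regular K A)).right a x) = s.right a (runitHom s x) := by
  induction x using Tensor.induction with
  | zero => simp
  | tm m n => simp
  | add x y hx hy => simp only [map_add, hx, hy]

end

end BimoduleStr

open BimoduleStr

/-- Finite-dimensional bimodules over the `K`-algebra `A`. -/
structure Bmd (K A : Type v) [Field K] [Ring A] [Algebra K A] where
  carrier : Type v
  [addCommGroup : AddCommGroup carrier]
  [module : Module K carrier]
  [finite : FiniteDimensional K carrier]
  str : BimoduleStr K A carrier

attribute [instance] Bmd.addCommGroup Bmd.module Bmd.finite

namespace Bmd

section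

variable {K A : Type v} [Field K] [Ring A] [Algebra K A]

instance : Category (Bmd K A) where
  Hom M N := ↥(homs M.str N.str)
  id M := ⟨LinearMap.id, fun _ _ => rfl, fun _ _ => rfl⟩
  comp f g := ⟨g.1 ∘ₗ f.1, fun a x => by simp [f.2.1, g.2.1], fun a x => by simp [f.2.2, g.2.2]⟩

/-- The linear map underlying a homomorphism of bimodules. -/
def lin {M N : Bmd K A} (f : M ⟶ N) : M.carrier →ₗ[K] N.carrier := Subtype.val f

/-- A homomorphism of bimodules from a linear map. -/
def ofLin {M N : Bmd K A} (f : M.carrier →ₗ[K] N.carrier)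
    (hl : ∀ a x, f (M.str.left a x) = N.str.left a (f x))
    (hr : ∀ a x, f (M.str.right a x) = N.str.right a (f x)) : M ⟶ N :=
  (⟨f, hl, hr⟩ : ↥(homs M.str N.str))

@[simp] lemma lin_ofLin {M N : Bmd K A} (f : M.carrier →ₗ[K] N.carrier) (hl) (hr) :
    lin (ofLin f hl hr : M ⟶ N) = f := rfl
@[simp] lemma lin_id (M : Bmd K A) : lin (𝟙 M) = LinearMap.id := rfl
@[simp] lemma lin_comp {M N P : Bmd K A} (f : M ⟶ N) (g : N ⟶ P) :
    lin (f ≫ g) = lin g ∘ₗ lin f := rfl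
@[simp] lemma lin_left {M N : Bmd K A} (f : M ⟶ N) (a : A) (x : M.carrier) :
    lin f (M.str.left a x) = N.str.left a (lin f x) := f.2.1 a x
@[simp] lemma lin_right {M N : Bmd K A} (f : M ⟶ N) (a : Aᵐᵒᵖ) (x : M.carrier) :
    lin f (M.str.right a x) = N.str.right a (lin f x) := f.2.2 a x

lemma hom_ext {M N : Bmd K A} {f g : M ⟶ N} (h : lin f = lin g) : f = g := Subtype.ext h

instance : Preadditive (Bmd K A) where
  homGroup M N := inferInstanceAs (AddCommGroup ↥(homs M.str N.str))
  add_comp := fun _ _ _ f f' g => hom_ext (LinearMap.comp_add f.1 f'.1 g.1)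
  comp_add := fun _ _ _ f g g' => hom_ext (LinearMap.add_comp f.1 g'.1 g.1)

instance : Linear K (Bmd K A) where
  homModule M N := inferInstanceAs (Module K ↥(homs M.str N.str))
  smul_comp := fun _ _ _ r f g => hom_ext (LinearMap.comp_smul g.1 r f.1)
  comp_smul := fun _ _ _ f r g => hom_ext (LinearMap.smul_comp r g.1 f.1)

/-- An isomorphism of bimodules from two mutually inverse linear maps. -/
def isoOfLin {M N : Bmd K A} (f : M.carrier →ₗ[K] N.carrier) (g : N.carrier →ₗ[K] M.carrier)
    (h₁ : g ∘ₗ f = LinearMap.id) (h₂ : f ∘ₗ g = LinearMap.id)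
    (hl : ∀ a x, f (M.str.left a x) = N.str.left a (f x))
    (hr : ∀ a x, f (M.str.right a x) = N.str.right a (f x)) : M ≅ N where
  hom := ofLin f hl hr
  inv := ofLin g
    (fun a x => by
      have h := LinearMap.congr_fun h₂
      have h' := LinearMap.congr_fun h₁
      simp only [LinearMap.comp_apply, LinearMap.id_apply] at h h'
      conv_lhs => rw [← h x, ← hl, h'])
    (fun a x => by
      have h := LinearMap.congr_fun h₂
      have h' := LinearMap.congr_fun h₁
      simp only [LinearMap.comp_apply, LinearMap.id_apply] at h h'
      conv_lhs => rw [← h x, ← hr, h'])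
  hom_inv_id := hom_ext h₁
  inv_hom_id := hom_ext h₂

@[simp] lemma lin_isoOfLin_hom {M N : Bmd K A} (f : M.carrier →ₗ[K] N.carrier)
    (g : N.carrier →ₗ[K] M.carrier) (h₁) (h₂) (hl) (hr) :
    lin (isoOfLin f g h₁ h₂ hl hr : M ≅ N).hom = f := rfl

variable [FiniteDimensional K A]

/-- The tensor product `⊗_A`, with the regular bimodule as unit object. -/
instance : MonoidalCategoryStruct (Bmd K A) where
  tensorObj M N := ⟨Tensor M.str N.str, tensor M.str N.str⟩
  tensorUnit := ⟨A, regular K A⟩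
  tensorHom f g := ofLin
    (BimoduleStr.map _ _ _ _ (lin f) (lin g) (lin_right f) (lin_left g))
    (map_left _ _ _ _ _ _ _ _ (lin_left f)) (map_right _ _ _ _ _ _ _ _ (lin_right g))
  whiskerLeft M _ _ f := ofLin
    (BimoduleStr.map M.str _ M.str _ LinearMap.id (lin f) (fun _ _ => rfl) (lin_left f))
    (map_left _ _ _ _ _ _ _ _ (fun _ _ => rfl)) (map_right _ _ _ _ _ _ _ _ (lin_right f))
  whiskerRight f N := ofLin
    (BimoduleStr.map _ N.str _ N.str (lin f) LinearMap.id (lin_right f) (fun _ _ => rfl))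
    (map_left _ _ _ _ _ _ _ _ (lin_left f)) (map_right _ _ _ _ _ _ _ _ (fun _ _ => rfl))
  associator M N P := isoOfLin (assocHom M.str N.str P.str) (assocInv M.str N.str P.str)
    (Tensor.ext₃ fun _ _ _ => rfl) (Tensor.ext₃' fun _ _ _ => rfl)
    (assocHom_left _ _ _) (assocHom_right _ _ _)
  leftUnitor M := isoOfLin (lunitHom M.str) (tmul (regular K A) M.str 1)
    (Tensor.ext fun a m => by
      simp only [LinearMap.comp_apply, lunitHom_tmul, ← tmul_balanced]
      simp)
    (LinearMap.ext fun x => by simp) (lunitHom_left _) (lunitHom_right _)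
  rightUnitor M := isoOfLin (runitHom M.str) ((tmul M.str (regular K A)).flip 1)
    (Tensor.ext fun a m => by simp [tmul_balanced])
    (LinearMap.ext fun x => by simp) (runitHom_left _) (runitHom_right _)

instance : MonoidalCategory (Bmd K A) where
  tensorHom_def _ _ := hom_ext (Tensor.ext fun _ _ => rfl)
  id_tensorHom_id _ _ := hom_ext (Tensor.ext fun _ _ => rfl)
  tensorHom_comp_tensorHom _ _ _ _ := hom_ext (Tensor.ext fun _ _ => rfl)
  whiskerLeft_id _ _ := hom_ext (Tensor.ext fun _ _ => rfl)
  id_whiskerRight _ _ := hom_ext (Tensor.ext fun _ _ => rfl)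
  associator_naturality _ _ _ := hom_ext (Tensor.ext₃ fun _ _ _ => rfl)
  leftUnitor_naturality f := hom_ext (Tensor.ext fun a m => (lin_left f a m).symm)
  rightUnitor_naturality f := hom_ext (Tensor.ext fun m a => (lin_right f (.op a) m).symm)
  pentagon _ _ _ _ := hom_ext (Tensor.ext₄ fun _ _ _ _ => rfl)
  triangle M N := hom_ext (Tensor.ext₃ (s := M.str) (t := regular K A) (r := N.str) fun m a n => (tmul_balanced M.str N.str m a n).symm)

/-- The class of `m ⊗ n` in the tensor product bimodule. -/
def tmk (M N : Bmd K A) : M.carrier →ₗ[K] N.carrier →ₗ[K] (MonoidalCategoryStruct.tensorObj M N).carrier :=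
  tmul M.str N.str

end

end Bmd

/-- A `V`-face algebra over `K`: an algebra and coalgebra `H` together with an algebra map
`faceMap` from `E = R ⊗ R`, where `R = V → K`.  The face idempotent `λ°` is the image of
`λ ⊗ 1`, and `μ` is the image of `1 ⊗ μ`.  The fields `comul_faceMap` and `counit_faceMap` say
that `faceMap` is a coalgebra map for the coalgebra structure
`Δ(λ° μ) = ∑ ν, λ° ν ⊗ ν° μ`, `ε(λ° μ) = δ_{λ μ}` of `E`. -/
class FaceAlgebra (K V H : Type*) [Field K] [Fintype V] [DecidableEq V]
    [Ring H] [Algebra K H] [Coalgebra K H] where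
  faceMap : (V → K) ⊗[K] (V → K) →ₐ[K] H
  comul_faceMap : ∀ l m : V,
    Coalgebra.comul (R := K) (faceMap (Pi.single l 1 ⊗ₜ Pi.single m 1)) =
      ∑ n : V, faceMap (Pi.single l 1 ⊗ₜ Pi.single n 1) ⊗ₜ[K]
        faceMap (Pi.single n 1 ⊗ₜ Pi.single m 1)
  counit_faceMap : ∀ l m : V,
    Coalgebra.counit (R := K) (faceMap (Pi.single l 1 ⊗ₜ Pi.single m 1)) =
      if l = m then 1 else 0
  comul_mul : ∀ a b : H, Coalgebra.comul (R := K) (a * b) =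
    Coalgebra.comul (R := K) a * Coalgebra.comul (R := K) b
  counit_mul : ∀ a b : H, Coalgebra.counit (R := K) (a * b) =
    ∑ n : V, Coalgebra.counit (R := K) (a * faceMap (1 ⊗ₜ Pi.single n 1)) *
      Coalgebra.counit (R := K) (faceMap (Pi.single n 1 ⊗ₜ 1) * b)

namespace FaceAlgebra

section

variable {K V H : Type*} [Field K] [Fintype V] [DecidableEq V]
  [Ring H] [Algebra K H] [Coalgebra K H]

variable (K V H) in
/-- The `E`-bimodule structure of a face algebra given by multiplication. -/
def bimodule [FaceAlgebra K V H] : BimoduleStr K ((V → K) ⊗[K] (V → K)) H where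
  left := (Algebra.lmul K H).comp (faceMap (K := K) (V := V))
  right :=
    { toFun := fun b => LinearMap.mulRight K (faceMap (K := K) (V := V) b.unop)
      map_one' := by ext; simp
      map_mul' := fun a b => by ext; simp [mul_assoc]
      map_zero' := by ext; simp
      map_add' := fun a b => by ext; simp [mul_add]
      commutes' := fun r => by
        ext x
        change x * faceMap (K := K) (V := V) (algebraMap K _ r) = r • x
        rw [AlgHom.commutes, ← Algebra.commutes, Algebra.smul_def] }
  comm := fun a b m => (mul_assoc _ _ _).symm

variable (K V H) [FaceAlgebra K V H]

/-- The second factor `R → H` of `faceMap`: the face idempotent `μ` is `inner (Pi.single μ 1)`. -/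
def inner : (V → K) →ₐ[K] H :=
  (faceMap (K := K) (V := V) (H := H)).comp Algebra.TensorProduct.includeRight

/-- The first factor `R° → H` of `faceMap`: the face idempotent `λ°` is
`outer (Pi.single λ 1)`. -/
def outer : (V → K) →ₐ[K] H :=
  (faceMap (K := K) (V := V) (H := H)).comp Algebra.TensorProduct.includeLeft

variable {K V H}

lemma outer_mul_inner (a b : V → K) :
    outer K V H a * inner K V H b = faceMap (K := K) (V := V) (a ⊗ₜ b) := by
  simp [inner, outer, ← map_mul]

lemma inner_mul_outer (a b : V → K) :
    inner K V H a * outer K V H b = outer K V H b * inner K V H a := by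
  simp [inner, outer, ← map_mul]

lemma sum_single : ∑ l : V, (Pi.single l 1 : V → K) = 1 := by
  ext m
  simp [Finset.sum_apply, Pi.single_apply]

lemma comul_one_eq : Coalgebra.comul (R := K) (1 : H) =
    ∑ n : V, inner K V H (Pi.single n 1) ⊗ₜ[K] outer K V H (Pi.single n 1) := by
  have h1 : (1 : H) = ∑ l : V, ∑ m : V,
      faceMap (K := K) (V := V) ((Pi.single l 1 : V → K) ⊗ₜ[K] (Pi.single m 1 : V → K)) := by
    simp only [← map_sum, ← TensorProduct.sum_tmul, ← TensorProduct.tmul_sum, sum_single]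
    exact (map_one (faceMap (K := K) (V := V) (H := H))).symm
  rw [h1]
  simp only [map_sum, comul_faceMap]
  rw [Finset.sum_congr rfl fun l _ => Finset.sum_comm, Finset.sum_comm]
  refine Finset.sum_congr rfl fun n _ => ?_
  simp only [← TensorProduct.tmul_sum, ← TensorProduct.sum_tmul, ← map_sum, sum_single]
  rfl

lemma inner_single (m : V) : inner K V H (Pi.single m 1) = ∑ l : V,
    faceMap (K := K) (V := V) ((Pi.single l 1 : V → K) ⊗ₜ[K] (Pi.single m 1 : V → K)) := by
  simp only [← map_sum, ← TensorProduct.sum_tmul, sum_single]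
  rfl

lemma comul_inner (a : V → K) : Coalgebra.comul (R := K) (inner K V H a) =
    Coalgebra.comul (R := K) (1 : H) * ((1 : H) ⊗ₜ[K] inner K V H a) := by
  suffices h : Coalgebra.comul (R := K) (A := H) ∘ₗ (inner K V H).toLinearMap =
      (LinearMap.mulLeft K (Coalgebra.comul (R := K) (1 : H))) ∘ₗ
        TensorProduct.mk K H H 1 ∘ₗ (inner K V H).toLinearMap from LinearMap.congr_fun h a
  apply LinearMap.pi_ext'
  intro m
  ext
  simp only [LinearMap.comp_apply, LinearMap.single_apply, AlgHom.toLinearMap_apply,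
    LinearMap.mulLeft_apply, TensorProduct.mk_apply]
  rw [comul_one_eq (V := V), Finset.sum_mul]
  conv_lhs => rw [inner_single, map_sum]
  simp only [comul_faceMap]
  rw [Finset.sum_comm]
  refine Finset.sum_congr rfl fun n _ => ?_
  rw [Algebra.TensorProduct.tmul_mul_tmul, mul_one, outer_mul_inner,
    ← TensorProduct.sum_tmul, ← inner_single]

lemma comul_inner' (a : V → K) : Coalgebra.comul (R := K) (inner K V H a) =
    ((1 : H) ⊗ₜ[K] inner K V H a) * Coalgebra.comul (R := K) (1 : H) := by
  rw [comul_inner, comul_one_eq (V := V), Finset.sum_mul, Finset.mul_sum]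
  refine Finset.sum_congr rfl fun n _ => ?_
  simp [inner_mul_outer]

lemma comul_mul_inner (h : H) (a : V → K) : Coalgebra.comul (R := K) (h * inner K V H a) =
    Coalgebra.comul (R := K) h * ((1 : H) ⊗ₜ[K] inner K V H a) := by
  rw [comul_mul V, comul_inner, ← mul_assoc, ← comul_mul V, mul_one]

lemma comul_inner_mul (h : H) (a : V → K) : Coalgebra.comul (R := K) (inner K V H a * h) =
    ((1 : H) ⊗ₜ[K] inner K V H a) * Coalgebra.comul (R := K) h := by
  rw [comul_mul V, comul_inner', mul_assoc, ← comul_mul V, one_mul]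

lemma counit_inner (m : V) : Coalgebra.counit (R := K) (inner K V H (Pi.single m 1)) = 1 := by
  rw [inner_single, map_sum]
  simp [counit_faceMap]

lemma counit_inner_mul (m : V) (h : H) :
    Coalgebra.counit (R := K) (inner K V H (Pi.single m 1) * h) =
      Coalgebra.counit (R := K) (outer K V H (Pi.single m 1) * h) := by
  rw [counit_mul (V := V)]
  have e : ∀ n : V, inner K V H (Pi.single m 1) * faceMap (K := K) (V := V) ((1 : V → K) ⊗ₜ[K] Pi.single n 1) =
      if n = m then inner K V H (Pi.single m 1) else 0 := by
    intro n
    change inner K V H _ * inner K V H _ = _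
    rw [← map_mul]
    split_ifs with hn
    · subst hn
      rw [← Pi.single_mul, mul_one]
    · have : (Pi.single m 1 : V → K) * Pi.single n 1 = 0 := by
        ext x
        by_cases hx : x = m
        · subst hx; simp [Ne.symm hn]
        · simp [hx]
      rw [this, map_zero]
  simp only [e]
  rw [Finset.sum_eq_single m]
  · rw [if_pos rfl, counit_inner, one_mul]
    rfl
  · intro n _ hn
    simp [hn]
  · simp

lemma outer_single (l : V) : outer K V H (Pi.single l 1) = ∑ m : V,
    faceMap (K := K) (V := V) ((Pi.single l 1 : V → K) ⊗ₜ[K] (Pi.single m 1 : V → K)) := by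
  simp only [← map_sum, ← TensorProduct.tmul_sum, sum_single]
  rfl

lemma comul_outer (a : V → K) : Coalgebra.comul (R := K) (outer K V H a) =
    (outer K V H a ⊗ₜ[K] (1 : H)) * Coalgebra.comul (R := K) (1 : H) := by
  suffices h : Coalgebra.comul (R := K) (A := H) ∘ₗ (outer K V H).toLinearMap =
      (LinearMap.mulRight K (Coalgebra.comul (R := K) (1 : H))) ∘ₗ
        (TensorProduct.mk K H H).flip 1 ∘ₗ (outer K V H).toLinearMap from
    LinearMap.congr_fun h a
  apply LinearMap.pi_ext'
  intro m
  ext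
  simp only [LinearMap.comp_apply, LinearMap.single_apply, AlgHom.toLinearMap_apply,
    LinearMap.mulRight_apply, TensorProduct.mk_apply, LinearMap.flip_apply]
  rw [comul_one_eq (V := V), Finset.mul_sum]
  conv_lhs => rw [outer_single, map_sum]
  simp only [comul_faceMap]
  rw [Finset.sum_comm]
  refine Finset.sum_congr rfl fun n _ => ?_
  rw [Algebra.TensorProduct.tmul_mul_tmul, one_mul, outer_mul_inner,
    ← TensorProduct.tmul_sum, ← outer_single]

lemma comul_outer' (a : V → K) : Coalgebra.comul (R := K) (outer K V H a) =
    Coalgebra.comul (R := K) (1 : H) * (outer K V H a ⊗ₜ[K] (1 : H)) := by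
  rw [comul_outer, comul_one_eq (V := V), Finset.sum_mul, Finset.mul_sum]
  refine Finset.sum_congr rfl fun n _ => ?_
  simp [inner_mul_outer]

lemma comul_outer_mul (h : H) (a : V → K) : Coalgebra.comul (R := K) (outer K V H a * h) =
    (outer K V H a ⊗ₜ[K] (1 : H)) * Coalgebra.comul (R := K) h := by
  rw [comul_mul V, comul_outer, mul_assoc, ← comul_mul V, one_mul]

lemma comul_mul_outer (h : H) (a : V → K) : Coalgebra.comul (R := K) (h * outer K V H a) =
    Coalgebra.comul (R := K) h * (outer K V H a ⊗ₜ[K] (1 : H)) := by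
  rw [comul_mul V, comul_outer', ← mul_assoc, ← comul_mul V, mul_one]

lemma counit_outer (l : V) : Coalgebra.counit (R := K) (outer K V H (Pi.single l 1)) = 1 := by
  rw [outer_single, map_sum]
  simp [counit_faceMap]

lemma counit_mul_outer (m : V) (h : H) :
    Coalgebra.counit (R := K) (h * outer K V H (Pi.single m 1)) =
      Coalgebra.counit (R := K) (h * inner K V H (Pi.single m 1)) := by
  rw [counit_mul (V := V)]
  have e : ∀ n : V, faceMap (K := K) (V := V) (Pi.single n 1 ⊗ₜ[K] (1 : V → K)) *
      outer K V H (Pi.single m 1) = if n = m then outer K V H (Pi.single m 1) else 0 := by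
    intro n
    change outer K V H _ * outer K V H _ = _
    rw [← map_mul]
    split_ifs with hn
    · subst hn
      rw [← Pi.single_mul, mul_one]
    · have : (Pi.single n 1 : V → K) * Pi.single m 1 = 0 := by
        ext x
        by_cases hx : x = n
        · subst hx; simp [hn]
        · simp [hx]
      rw [this, map_zero]
  simp only [e]
  rw [Finset.sum_eq_single m]
  · rw [if_pos rfl, counit_outer, mul_one]
    rfl
  · intro n _ hn
    simp [hn]
  · simp

/-- `ε(a b) = ∑ ν, ε(a ν) ε(ν b)`. -/
lemma counit_mul' (a b : H) : Coalgebra.counit (R := K) (a * b) =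
    ∑ n : V, Coalgebra.counit (R := K) (a * inner K V H (Pi.single n 1)) *
      Coalgebra.counit (R := K) (inner K V H (Pi.single n 1) * b) := by
  rw [counit_mul (V := V)]
  exact Finset.sum_congr rfl fun n _ => by rw [counit_inner_mul]; rfl

end

end FaceAlgebra

/-- A right comodule structure on `M` over the coalgebra `H`. -/
structure ComoduleStr (K H M : Type*) [Field K] [AddCommGroup H] [Module K H] [Coalgebra K H]
    [AddCommGroup M] [Module K M] where
  coact : M →ₗ[K] M ⊗[K] H
  coassoc : (TensorProduct.assoc K M H H).toLinearMap ∘ₗ coact.rTensor H ∘ₗ coact =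
    (Coalgebra.comul (R := K) (A := H)).lTensor M ∘ₗ coact
  counit : (TensorProduct.rid K M).toLinearMap ∘ₗ
    (Coalgebra.counit (R := K) (A := H)).lTensor M ∘ₗ coact = LinearMap.id

namespace ComoduleStr

/-- `m ⊗ h ↦ φ(h) m`. -/
def contract {K H : Type*} (M : Type*) [Field K] [AddCommGroup H] [Module K H]
    [AddCommGroup M] [Module K M] (φ : H →ₗ[K] K) : M ⊗[K] H →ₗ[K] M :=
  (TensorProduct.rid K M).toLinearMap ∘ₗ φ.lTensor M

@[simp] lemma contract_tmul {K H M : Type*} [Field K] [AddCommGroup H] [Module K H]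
    [AddCommGroup M] [Module K M] (φ : H →ₗ[K] K) (m : M) (h : H) :
    contract M φ (m ⊗ₜ h) = φ h • m := by simp [contract]

section

variable {K H M N : Type*} [Field K] [AddCommGroup H] [Module K H] [Coalgebra K H]
  [AddCommGroup M] [Module K M] [AddCommGroup N] [Module K N]

/-- Comodule homomorphisms, as a subspace of the space of linear maps. -/
def homs (s : ComoduleStr K H M) (t : ComoduleStr K H N) : Submodule K (M →ₗ[K] N) where
  carrier := {f | ∀ m, t.coact (f m) = f.rTensor H (s.coact m)}
  add_mem' := fun hf hg m => by simp [hf m, hg m, LinearMap.rTensor_add]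
  zero_mem' := fun m => by simp
  smul_mem' := fun c f hf m => by simp [hf m, LinearMap.rTensor_smul]

/-- The action `m ↦ ∑ φ(m₁) m₀` of a functional `φ` on a comodule. -/
def act (s : ComoduleStr K H M) (φ : H →ₗ[K] K) : M →ₗ[K] M := contract M φ ∘ₗ s.coact

lemma act_counit (s : ComoduleStr K H M) : s.act (Coalgebra.counit (R := K) (A := H)) =
    LinearMap.id := by
  rw [← s.counit]
  rfl

lemma coact_contract (s : ComoduleStr K H M) (φ : H →ₗ[K] K) (x : M ⊗[K] H) :
    s.coact (contract M φ x) =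
      (contract H φ).lTensor M (TensorProduct.assoc K M H H (s.coact.rTensor H x)) := by
  induction x using TensorProduct.induction_on with
  | zero => simp
  | tmul m h =>
    simp only [contract_tmul, map_smul, LinearMap.rTensor_tmul]
    generalize s.coact m = y
    induction y using TensorProduct.induction_on with
    | zero => simp
    | tmul m' k => simp
    | add a b ha hb => simp only [smul_add, TensorProduct.add_tmul, map_add, ha, hb]
  | add a b ha hb => simp only [map_add, ha, hb]

lemma coact_act (s : ComoduleStr K H M) (T : H →ₗ[K] H)
    (hT : ∀ h, Coalgebra.comul (R := K) (T h) = T.lTensor H (Coalgebra.comul (R := K) h))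
    (m : M) :
    s.coact (s.act (Coalgebra.counit (R := K) ∘ₗ T) m) = T.lTensor M (s.coact m) := by
  have h1 : contract H (Coalgebra.counit (R := K) ∘ₗ T) ∘ₗ Coalgebra.comul (R := K) = T := by
    ext h
    have h2 := Coalgebra.lTensor_counit_comul (R := K) (T h)
    rw [hT, ← LinearMap.comp_apply, ← LinearMap.lTensor_comp] at h2
    simp only [contract, LinearMap.comp_apply]
    rw [h2]
    simp
  have h3 := LinearMap.congr_fun s.coassoc m
  simp only [LinearMap.comp_apply, LinearEquiv.coe_coe] at h3
  rw [act, LinearMap.comp_apply, coact_contract, h3, ← LinearMap.comp_apply,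
    ← LinearMap.lTensor_comp, h1]

lemma act_hom (s : ComoduleStr K H M) (t : ComoduleStr K H N) (f : M →ₗ[K] N)
    (hf : f ∈ homs s t) (φ : H →ₗ[K] K) (m : M) : f (s.act φ m) = t.act φ (f m) := by
  simp only [act, LinearMap.comp_apply, hf m]
  generalize s.coact m = x
  induction x using TensorProduct.induction_on with
  | zero => simp
  | tmul m h => simp
  | add a b ha hb => simp only [map_add, ha, hb]

end

section

variable {K V H M N P : Type*} [Field K] [Fintype V] [DecidableEq V]
  [Ring H] [Algebra K H] [Coalgebra K H] [FaceAlgebra K V H]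
  [AddCommGroup M] [Module K M] [AddCommGroup N] [Module K N] [AddCommGroup P] [Module K P]

/-- `h ↦ a h b` for `a b : R`. -/
def sandwich (K : Type*) {V : Type*} (H : Type*) [Field K] [Fintype V] [DecidableEq V]
    [Ring H] [Algebra K H] [Coalgebra K H] [FaceAlgebra K V H] (a b : V → K) : H →ₗ[K] H :=
  LinearMap.mulLeft K (FaceAlgebra.inner K V H a) ∘ₗ
    LinearMap.mulRight K (FaceAlgebra.inner K V H b)

@[simp] lemma sandwich_apply (a b : V → K) (h : H) : sandwich K H a b h =
    FaceAlgebra.inner K V H a * (h * FaceAlgebra.inner K V H b) := rfl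

lemma comul_sandwich (a b : V → K) (h : H) :
    Coalgebra.comul (R := K) (sandwich K H a b h) =
      (sandwich K H a b).lTensor H (Coalgebra.comul (R := K) h) := by
  rw [sandwich_apply, FaceAlgebra.comul_inner_mul, FaceAlgebra.comul_mul_inner]
  generalize Coalgebra.comul (R := K) h = x
  induction x using TensorProduct.induction_on with
  | zero => simp
  | tmul m h => simp
  | add a b ha hb => simp only [map_add, mul_add, add_mul, ha, hb]

/-- The functional `h ↦ ε(a h b)`. -/
def eps (K : Type*) {V : Type*} (H : Type*) [Field K] [Fintype V] [DecidableEq V]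
    [Ring H] [Algebra K H] [Coalgebra K H] [FaceAlgebra K V H] (a b : V → K) : H →ₗ[K] K :=
  Coalgebra.counit (R := K) ∘ₗ sandwich K H a b

@[simp] lemma eps_apply (a b : V → K) (h : H) : eps K H a b h =
    Coalgebra.counit (R := K)
      (FaceAlgebra.inner K V H a * (h * FaceAlgebra.inner K V H b)) := rfl

lemma act_eps_act_eps (s : ComoduleStr K H M) (a b c d : V → K) (m : M) :
    s.act (eps K H a b) (s.act (eps K H c d) m) = s.act (eps K H (a * c) (d * b)) m := by
  conv_lhs => rw [act, LinearMap.comp_apply, eps, eps, coact_act _ _ (comul_sandwich c d)]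
  simp only [act, LinearMap.comp_apply]
  generalize s.coact m = x
  induction x using TensorProduct.induction_on with
  | zero => simp
  | tmul m h => simp [mul_assoc]
  | add a b ha hb => simp only [map_add, ha, hb]

variable (V) in
lemma act_eps_one (s : ComoduleStr K H M) : s.act (eps K H (1 : V → K) 1) = LinearMap.id := by
  rw [← s.act_counit]
  congr 1
  ext h
  simp

lemma act_ext (s : ComoduleStr K H M) {φ ψ : H →ₗ[K] K} (h : φ = ψ) (m : M) :
    s.act φ m = s.act ψ m := by rw [h]

lemma act_add (s : ComoduleStr K H M) (φ ψ : H →ₗ[K] K) :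
    s.act (φ + ψ) = s.act φ + s.act ψ := by
  ext m
  simp [act, contract, LinearMap.lTensor_add]

lemma act_smul (s : ComoduleStr K H M) (c : K) (φ : H →ₗ[K] K) :
    s.act (c • φ) = c • s.act φ := by
  ext m
  simp [act, contract, LinearMap.lTensor_smul]

/-- The `R`-bimodule structure `a m b = ∑ m₀ ε(a m₁ b)` on a comodule of a face algebra. -/
def bimodule (V : Type*) [Fintype V] [DecidableEq V] [FaceAlgebra K V H]
    (s : ComoduleStr K H M) : BimoduleStr K (V → K) M where
  left := AlgHom.ofLinearMap
    { toFun := fun a => s.act (eps K H a 1)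
      map_add' := fun a b => by
        rw [← act_add]; congr 1; ext h; simp [add_mul]
      map_smul' := fun c a => by
        rw [RingHom.id_apply, ← act_smul]; congr 1; ext h; simp }
    (act_eps_one V s)
    (fun a b => LinearMap.ext fun m => by
      have h := act_eps_act_eps s a 1 b 1 m
      rw [mul_one] at h
      exact h.symm)
  right := AlgHom.ofLinearMap
    { toFun := fun b => s.act (eps K H 1 b.unop)
      map_add' := fun a b => by
        rw [← act_add]; congr 1; ext h; simp [mul_add]
      map_smul' := fun c a => by
        rw [RingHom.id_apply, ← act_smul]; congr 1; ext h; simp }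
    (act_eps_one V s)
    (fun a b => LinearMap.ext fun m => by
      have h := act_eps_act_eps s 1 a.unop 1 b.unop m
      rw [mul_one] at h
      exact h.symm)
  comm := fun a b m => by
    have h := act_eps_act_eps s a 1 1 b.unop m
    have h' := act_eps_act_eps s 1 b.unop a 1 m
    rw [mul_one, mul_one] at h
    rw [one_mul, one_mul] at h'
    exact h.trans h'.symm

lemma bimodule_left (s : ComoduleStr K H M) (a : V → K) (m : M) :
    (s.bimodule V).left a m = s.act (eps K H a 1) m := rfl

lemma bimodule_right (s : ComoduleStr K H M) (b : (V → K)ᵐᵒᵖ) (m : M) :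
    (s.bimodule V).right b m = s.act (eps K H 1 b.unop) m := rfl

lemma left_right (s : ComoduleStr K H M) (a b : V → K) (m : M) :
    (s.bimodule V).left a ((s.bimodule V).right (.op b) m) = s.act (eps K H a b) m := by
  have h := act_eps_act_eps s a 1 1 b m
  rw [mul_one, mul_one] at h
  exact h

lemma coact_left (s : ComoduleStr K H M) (a : V → K) (m : M) :
    s.coact ((s.bimodule V).left a m) = (sandwich K H a 1).lTensor M (s.coact m) :=
  coact_act s _ (comul_sandwich a 1) m

lemma coact_right (s : ComoduleStr K H M) (a : (V → K)ᵐᵒᵖ) (m : M) :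
    s.coact ((s.bimodule V).right a m) = (sandwich K H 1 a.unop).lTensor M (s.coact m) :=
  coact_act s _ (comul_sandwich 1 a.unop) m

lemma hom_left (s : ComoduleStr K H M) (t : ComoduleStr K H N) {f : M →ₗ[K] N}
    (hf : f ∈ homs s t) (a : V → K) (m : M) :
    f ((s.bimodule V).left a m) = (t.bimodule V).left a (f m) := act_hom s t f hf _ m

lemma hom_right (s : ComoduleStr K H M) (t : ComoduleStr K H N) {f : M →ₗ[K] N}
    (hf : f ∈ homs s t) (a : (V → K)ᵐᵒᵖ) (m : M) :
    f ((s.bimodule V).right a m) = (t.bimodule V).right a (f m) := act_hom s t f hf _ m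

variable (V)

/-- The map `(m ⊗ h, n ⊗ k) ↦ (m ⊗_R n) ⊗ h k`. -/
def mulCoact (s : ComoduleStr K H M) (t : ComoduleStr K H N) :
    M ⊗[K] H →ₗ[K] N ⊗[K] H →ₗ[K] Tensor (s.bimodule V) (t.bimodule V) ⊗[K] H :=
  TensorProduct.map₂ (tmul (s.bimodule V) (t.bimodule V)) (LinearMap.mul K H)

@[simp] lemma mulCoact_tmul (s : ComoduleStr K H M) (t : ComoduleStr K H N)
    (m : M) (h : H) (n : N) (k : H) :
    mulCoact V s t (m ⊗ₜ h) (n ⊗ₜ k) = tmul _ _ m n ⊗ₜ (h * k) := rfl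

/-- The coaction `m ⊗_R n ↦ ∑ (m₀ ⊗_R n₀) ⊗ m₁ n₁` on `M ⊗_R N`. -/
def tensorCoact (s : ComoduleStr K H M) (t : ComoduleStr K H N) :
    Tensor (s.bimodule V) (t.bimodule V) →ₗ[K]
      Tensor (s.bimodule V) (t.bimodule V) ⊗[K] H :=
  lift _ _ ((mulCoact V s t).compl₁₂ s.coact t.coact) (fun m a n => by
    simp only [LinearMap.compl₁₂_apply, coact_left, coact_right]
    generalize s.coact m = x
    generalize t.coact n = y
    induction x using TensorProduct.induction_on with
    | zero => simp
    | tmul m h =>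
      induction y using TensorProduct.induction_on with
      | zero => simp
      | tmul n k => simp [mul_assoc]
      | add a b ha hb => simp only [map_add, ha, hb]
    | add a b ha hb => simp only [map_add, LinearMap.add_apply, ha, hb])

@[simp] lemma tensorCoact_tmul (s : ComoduleStr K H M) (t : ComoduleStr K H N) (m : M) (n : N) :
    tensorCoact V s t (tmul _ _ m n) = mulCoact V s t (s.coact m) (t.coact n) := rfl

lemma contract_mulCoact (s : ComoduleStr K H M) (t : ComoduleStr K H N) (a b : V → K)
    (x : M ⊗[K] H) (y : N ⊗[K] H) :
    contract _ (eps K H a b) (mulCoact V s t x y) =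
      ∑ n : V, tmul _ _ (contract M (eps K H a (Pi.single n 1)) x)
        (contract N (eps K H (Pi.single n 1) b) y) := by
  induction x using TensorProduct.induction_on with
  | zero => simp
  | tmul m h =>
    induction y using TensorProduct.induction_on with
    | zero => simp
    | tmul n k =>
      simp only [mulCoact_tmul, contract_tmul, map_smul, LinearMap.smul_apply, smul_smul,
        ← Finset.sum_smul, eps_apply]
      rw [mul_assoc h k, ← mul_assoc, FaceAlgebra.counit_mul' (V := V)]
      congr 1
      exact Finset.sum_congr rfl fun n _ => by rw [mul_assoc, mul_comm]
    | add a b ha hb => simp only [map_add, ha, hb, Finset.sum_add_distrib]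
  | add a b ha hb =>
    simp only [map_add, LinearMap.add_apply, ha, hb, Finset.sum_add_distrib]

lemma contract_tensorCoact (s : ComoduleStr K H M) (t : ComoduleStr K H N) (a b : V → K)
    (m : M) (n : N) :
    contract _ (eps K H a b) (tensorCoact V s t (tmul _ _ m n)) =
      tmul _ _ ((s.bimodule V).left a m) ((t.bimodule V).right (.op b) n) := by
  rw [tensorCoact_tmul, contract_mulCoact]
  have h : ∀ k : V, tmul (s.bimodule V) (t.bimodule V)
      (contract M (eps K H a (Pi.single k 1)) (s.coact m))
      (contract N (eps K H (Pi.single k 1) b) (t.coact n)) =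
      tmul _ _ ((s.bimodule V).right (.op (Pi.single k 1)) ((s.bimodule V).left a m))
        ((t.bimodule V).right (.op b) n) := by
    intro k
    have e1 := left_right s a (Pi.single k 1) m
    have e2 := left_right t (Pi.single k 1) b n
    simp only [act, LinearMap.comp_apply] at e1 e2
    rw [← e1, ← e2, ← tmul_balanced, BimoduleStr.comm, ← Module.End.mul_apply, ← map_mul,
      ← MulOpposite.op_mul, ← Pi.single_mul, mul_one]
  have e : ∑ k : V, MulOpposite.op (Pi.single k 1 : V → K) = 1 := by
    rw [← MulOpposite.op_one, ← FaceAlgebra.sum_single]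
    exact (map_sum MulOpposite.opAddEquiv _ _).symm
  simp only [h, ← LinearMap.sum_apply, ← map_sum]
  rw [e]
  simp

/-- The tensor product `M ⊗_R N` of comodules of a face algebra. -/
def tensor (s : ComoduleStr K H M) (t : ComoduleStr K H N) :
    ComoduleStr K H (Tensor (s.bimodule V) (t.bimodule V)) where
  coact := tensorCoact V s t
  coassoc := Tensor.ext fun m n => by
    have hs := LinearMap.congr_fun s.coassoc m
    have ht := LinearMap.congr_fun t.coassoc n
    simp only [LinearMap.comp_apply, LinearEquiv.coe_coe, tensorCoact_tmul] at hs ht ⊢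
    set Q : M ⊗[K] (H ⊗[K] H) →ₗ[K] N ⊗[K] (H ⊗[K] H) →ₗ[K]
        Tensor (s.bimodule V) (t.bimodule V) ⊗[K] (H ⊗[K] H) :=
      TensorProduct.map₂ (tmul (s.bimodule V) (t.bimodule V)) (LinearMap.mul K (H ⊗[K] H)) with hQ
    have h1 : ∀ (x : M ⊗[K] H) (y : N ⊗[K] H),
        TensorProduct.assoc K _ H H ((tensorCoact V s t).rTensor H (mulCoact V s t x y)) =
        Q (TensorProduct.assoc K _ H H (s.coact.rTensor H x))
          (TensorProduct.assoc K _ H H (t.coact.rTensor H y)) := by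
      intro x y
      induction x using TensorProduct.induction_on with
      | zero => simp
      | tmul m h =>
        induction y using TensorProduct.induction_on with
        | zero => simp
        | tmul n k =>
          simp only [mulCoact_tmul, LinearMap.rTensor_tmul, tensorCoact_tmul]
          generalize s.coact m = x
          generalize t.coact n = y
          induction x using TensorProduct.induction_on with
          | zero => simp
          | tmul m h =>
            induction y using TensorProduct.induction_on with
            | zero => simp
            | tmul n k => simp [hQ]
            | add a b ha hb => simp only [map_add, TensorProduct.add_tmul, ha, hb]
          | add a b ha hb =>
            simp only [map_add, TensorProduct.add_tmul, LinearMap.add_apply, ha, hb]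
        | add a b ha hb => simp only [map_add, ha, hb]
      | add a b ha hb => simp only [map_add, LinearMap.add_apply, ha, hb]
    have h2 : ∀ (x : M ⊗[K] H) (y : N ⊗[K] H),
        (Coalgebra.comul (R := K) (A := H)).lTensor _ (mulCoact V s t x y) =
        Q ((Coalgebra.comul (R := K) (A := H)).lTensor M x)
          ((Coalgebra.comul (R := K) (A := H)).lTensor N y) := by
      intro x y
      induction x using TensorProduct.induction_on with
      | zero => simp
      | tmul m h =>
        induction y using TensorProduct.induction_on with
        | zero => simp
        | tmul n k => simp [hQ, FaceAlgebra.comul_mul V]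
        | add a b ha hb => simp only [map_add, ha, hb]
      | add a b ha hb => simp only [map_add, LinearMap.add_apply, ha, hb]
    rw [h1, h2, hs, ht]
  counit := Tensor.ext fun m n => by
    have h := contract_tensorCoact V s t 1 1 m n
    have e : eps K H (1 : V → K) 1 = Coalgebra.counit (R := K) := by ext h; simp
    rw [e] at h
    simp only [map_one, MulOpposite.op_one, Module.End.one_apply] at h
    exact h

/-- On `M ⊗_R N`, the `R`-bimodule structure obtained from the coaction is the usual one. -/
lemma bimodule_tensor (s : ComoduleStr K H M) (t : ComoduleStr K H N) :
    (tensor V s t).bimodule V = BimoduleStr.tensor (s.bimodule V) (t.bimodule V) := by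
  have h1 : ((tensor V s t).bimodule V).left =
      (BimoduleStr.tensor (s.bimodule V) (t.bimodule V)).left :=
    AlgHom.ext fun a => Tensor.ext fun m n => by
      refine (contract_tensorCoact V s t a 1 m n).trans ?_
      simp
  have h2 : ((tensor V s t).bimodule V).right =
      (BimoduleStr.tensor (s.bimodule V) (t.bimodule V)).right :=
    AlgHom.ext fun a => Tensor.ext fun m n => by
      refine (contract_tensorCoact V s t 1 a.unop m n).trans ?_
      simp
  cases h : (tensor V s t).bimodule V
  cases h' : BimoduleStr.tensor (s.bimodule V) (t.bimodule V)
  simp only [h, h'] at h1 h2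
  subst h1 h2
  rfl

variable (K H)

/-- The coaction `μ ↦ ∑ λ, λ ⊗ λ° μ` on `R`. -/
def unitCoact : (V → K) →ₗ[K] (V → K) ⊗[K] H :=
  ∑ l : V, (TensorProduct.mk K (V → K) H (Pi.single l 1)) ∘ₗ
    (FaceAlgebra.faceMap (K := K) (V := V) (H := H)).toLinearMap ∘ₗ
      TensorProduct.mk K (V → K) (V → K) (Pi.single l 1)

variable {K H}

lemma unitCoact_apply (a : V → K) : unitCoact K V H a =
    ∑ l : V, (Pi.single l 1 : V → K) ⊗ₜ[K]
      FaceAlgebra.faceMap (K := K) (V := V) (H := H) (Pi.single l 1 ⊗ₜ a) := by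
  simp [unitCoact]

variable {V}

lemma comul_faceMap' (l : V) (a : V → K) :
    Coalgebra.comul (R := K)
      (FaceAlgebra.faceMap (K := K) (V := V) (H := H) (Pi.single l 1 ⊗ₜ a)) =
      ∑ n : V, FaceAlgebra.faceMap (K := K) (V := V) (Pi.single l 1 ⊗ₜ Pi.single n 1) ⊗ₜ[K]
        FaceAlgebra.faceMap (K := K) (V := V) (Pi.single n 1 ⊗ₜ a) := by
  rw [pi_eq_sum_univ' a]
  simp only [TensorProduct.tmul_sum, map_sum, TensorProduct.tmul_smul, map_smul]
  rw [Finset.sum_comm]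
  refine Finset.sum_congr rfl fun m _ => ?_
  rw [← Finset.smul_sum]
  congr 1
  convert FaceAlgebra.comul_faceMap l m using 5

lemma counit_faceMap' (l : V) (a : V → K) :
    Coalgebra.counit (R := K)
      (FaceAlgebra.faceMap (K := K) (V := V) (H := H) (Pi.single l 1 ⊗ₜ a)) = a l := by
  conv_lhs => rw [pi_eq_sum_univ a]
  simp only [TensorProduct.tmul_sum, map_sum, TensorProduct.tmul_smul, map_smul]
  have h : ∀ m : V, Coalgebra.counit (R := K)
      (FaceAlgebra.faceMap (K := K) (V := V) (H := H)
        (Pi.single l 1 ⊗ₜ fun j => if m = j then 1 else 0)) = if l = m then 1 else 0 := by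
    intro m
    rw [← FaceAlgebra.counit_faceMap (K := K) (H := H) l m]
    congr 4
    ext j
    simp [Pi.single_apply, eq_comm]
  simp only [h]
  simp

variable (K V H)

/-- The unit comodule `R` with coaction `μ ↦ ∑ λ, λ ⊗ λ° μ`. -/
def unit : ComoduleStr K H (V → K) where
  coact := unitCoact K V H
  coassoc := LinearMap.ext fun a => by
    simp only [LinearMap.comp_apply, LinearEquiv.coe_coe, unitCoact_apply, map_sum,
      LinearMap.rTensor_tmul, LinearMap.lTensor_tmul, comul_faceMap', TensorProduct.sum_tmul,
      TensorProduct.tmul_sum, TensorProduct.assoc_tmul]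
    exact Finset.sum_comm
  counit := LinearMap.ext fun a => by
    simp only [LinearMap.comp_apply, LinearEquiv.coe_coe, unitCoact_apply, map_sum,
      LinearMap.lTensor_tmul, counit_faceMap', TensorProduct.rid_tmul, LinearMap.id_apply]
    ext m
    simp [Finset.sum_apply, Pi.single_apply]

lemma act_unit (a b x : V → K) : (unit K V H).act (eps K H a b) x = a * x * b := by
  have h : ∀ l : V, eps K H a b
      (FaceAlgebra.faceMap (K := K) (V := V) (H := H) (Pi.single l 1 ⊗ₜ x)) =
        (a * x * b) l := by
    intro l
    rw [← counit_faceMap' (H := H) l (a * x * b), eps_apply]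
    congr 1
    change FaceAlgebra.faceMap (K := K) (V := V) (1 ⊗ₜ a) *
      (_ * FaceAlgebra.faceMap (K := K) (V := V) (1 ⊗ₜ b)) = _
    simp [← map_mul, mul_assoc]
  change contract _ _ (unitCoact K V H x) = _
  simp only [unitCoact_apply, map_sum, contract_tmul, h]
  ext m
  simp [Finset.sum_apply, Pi.single_apply]

lemma bimodule_unit : (unit K V H).bimodule V = BimoduleStr.regular K (V → K) := by
  have h1 : ((unit K V H).bimodule V).left = (BimoduleStr.regular K (V → K)).left :=
    AlgHom.ext fun a => LinearMap.ext fun x => by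
      refine (act_unit K V H a 1 x).trans ?_
      simp
  have h2 : ((unit K V H).bimodule V).right = (BimoduleStr.regular K (V → K)).right :=
    AlgHom.ext fun a => LinearMap.ext fun x => by
      refine (act_unit K V H 1 a.unop x).trans ?_
      simp
  cases h : (unit K V H).bimodule V
  cases h' : BimoduleStr.regular K (V → K)
  simp only [h, h'] at h1 h2
  subst h1 h2
  rfl

variable {K H}

lemma rTensor_act (s : ComoduleStr K H M) (φ : H →ₗ[K] K) (T : H →ₗ[K] H)
    (hT : ∀ h, φ.rTensor H (Coalgebra.comul (R := K) h) = 1 ⊗ₜ[K] T h) (m : M) :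
    (s.act φ).rTensor H (s.coact m) = T.lTensor M (s.coact m) := by
  have h1 : ∀ x : M ⊗[K] H, (s.act φ).rTensor H x =
      (TensorProduct.lid K H ∘ₗ φ.rTensor H).lTensor M
        (TensorProduct.assoc K M H H (s.coact.rTensor H x)) := by
    intro x
    induction x using TensorProduct.induction_on with
    | zero => simp
    | tmul m h =>
      simp only [act, LinearMap.rTensor_tmul, LinearMap.comp_apply]
      generalize s.coact m = y
      induction y using TensorProduct.induction_on with
      | zero => simp
      | tmul m' k => simp [TensorProduct.smul_tmul]
      | add a b ha hb => simp only [TensorProduct.add_tmul, map_add, ha, hb]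
    | add a b ha hb => simp only [map_add, ha, hb]
  have h3 := LinearMap.congr_fun s.coassoc m
  simp only [LinearMap.comp_apply, LinearEquiv.coe_coe] at h3
  have h2 : (TensorProduct.lid K H ∘ₗ φ.rTensor H) ∘ₗ Coalgebra.comul (R := K) = T := by
    ext h
    simp [hT]
  rw [h1, h3, ← LinearMap.comp_apply, ← LinearMap.lTensor_comp, h2]

lemma rTensor_left (s : ComoduleStr K H M) (l : V) (m : M) :
    ((s.bimodule V).left (Pi.single l 1)).rTensor H (s.coact m) =
      (LinearMap.mulLeft K (FaceAlgebra.outer K V H (Pi.single l 1))).lTensor M (s.coact m) := by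
  refine rTensor_act s _ _ (fun h => ?_) m
  have e : eps K H (Pi.single l 1 : V → K) 1 = Coalgebra.counit (R := K) ∘ₗ
      LinearMap.mulLeft K (FaceAlgebra.outer K V H (Pi.single l 1)) := by
    ext h
    simp [FaceAlgebra.counit_inner_mul]
  have h1 := Coalgebra.rTensor_counit_comul (R := K) (FaceAlgebra.outer K V H (Pi.single l 1) * h)
  rw [FaceAlgebra.comul_outer_mul] at h1
  rw [LinearMap.mulLeft_apply, ← h1, e, LinearMap.rTensor_comp_apply]
  congr 1
  generalize Coalgebra.comul (R := K) h = x
  induction x using TensorProduct.induction_on with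
  | zero => simp
  | tmul m h => simp
  | add a b ha hb => simp only [map_add, mul_add, ha, hb]

lemma rTensor_right (s : ComoduleStr K H M) (l : V) (m : M) :
    ((s.bimodule V).right (.op (Pi.single l 1))).rTensor H (s.coact m) =
      (LinearMap.mulRight K (FaceAlgebra.outer K V H (Pi.single l 1))).lTensor M
        (s.coact m) := by
  refine rTensor_act s _ _ (fun h => ?_) m
  have e : eps K H 1 (Pi.single l 1 : V → K) = Coalgebra.counit (R := K) ∘ₗ
      LinearMap.mulRight K (FaceAlgebra.outer K V H (Pi.single l 1)) := by
    ext h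
    simp [FaceAlgebra.counit_mul_outer]
  have h1 := Coalgebra.rTensor_counit_comul (R := K) (h * FaceAlgebra.outer K V H (Pi.single l 1))
  rw [FaceAlgebra.comul_mul_outer] at h1
  rw [LinearMap.mulRight_apply, ← h1, MulOpposite.unop_op, e, LinearMap.rTensor_comp_apply]
  congr 1
  generalize Coalgebra.comul (R := K) h = x
  induction x using TensorProduct.induction_on with
  | zero => simp
  | tmul m h => simp
  | add a b ha hb => simp only [map_add, add_mul, ha, hb]

lemma assoc_comodule (s : ComoduleStr K H M) (t : ComoduleStr K H N) (r : ComoduleStr K H P)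
    (F : Tensor ((tensor V s t).bimodule V) (r.bimodule V) →ₗ[K]
      Tensor (s.bimodule V) ((tensor V t r).bimodule V))
    (hF : ∀ m n p, F (tmul _ _ (tmul (s.bimodule V) (t.bimodule V) m n) p) =
      tmul _ _ m (tmul (t.bimodule V) (r.bimodule V) n p))
    (x : Tensor ((tensor V s t).bimodule V) (r.bimodule V)) :
    (tensor V s (tensor V t r)).coact (F x) =
      F.rTensor H ((tensor V (tensor V s t) r).coact x) := by
  have key : ∀ (x : M ⊗[K] H) (y : N ⊗[K] H) (z : P ⊗[K] H),
      mulCoact V s (tensor V t r) x (mulCoact V t r y z) =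
      F.rTensor H (mulCoact V (tensor V s t) r (mulCoact V s t x y) z) := by
    intro x y z
    induction x using TensorProduct.induction_on with
    | zero => simp
    | tmul m h =>
      induction y using TensorProduct.induction_on with
      | zero => simp
      | tmul n k =>
        induction z using TensorProduct.induction_on with
        | zero => simp
        | tmul p l => simp [hF, mul_assoc]
        | add a b ha hb => simp only [map_add, ha, hb]
      | add a b ha hb => simp only [map_add, LinearMap.add_apply, ha, hb]
    | add a b ha hb => simp only [map_add, LinearMap.add_apply, ha, hb]
  induction x using Tensor.induction with
  | zero => simp
  | tm y p =>
    induction y using Tensor.induction with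
    | zero => simp
    | tm m n =>
      rw [hF]
      exact key _ _ _
    | add a b ha hb => simp only [map_add, LinearMap.add_apply, ha, hb]
  | add a b ha hb => simp only [map_add, ha, hb]

lemma lunit_comodule (s : ComoduleStr K H M)
    (F : Tensor ((unit K V H).bimodule V) (s.bimodule V) →ₗ[K] M)
    (hF : ∀ a m, F (tmul _ _ a m) = (s.bimodule V).left a m)
    (x : Tensor ((unit K V H).bimodule V) (s.bimodule V)) :
    s.coact (F x) = F.rTensor H ((tensor V (unit K V H) s).coact x) := by
  induction x using Tensor.induction with
  | zero => simp
  | add a b ha hb => simp only [map_add, ha, hb]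
  | tm a m =>
    rw [hF, coact_left]
    change _ = F.rTensor H (mulCoact V (unit K V H) s (unitCoact K V H a) (s.coact m))
    have h1 : ∀ (l : V) (y : M ⊗[K] H), F.rTensor H (mulCoact V (unit K V H) s
        ((Pi.single l 1 : V → K) ⊗ₜ[K]
          FaceAlgebra.faceMap (K := K) (V := V) (H := H) (Pi.single l 1 ⊗ₜ a)) y) =
        (LinearMap.mulLeft K (FaceAlgebra.faceMap (K := K) (V := V) (H := H)
          (Pi.single l 1 ⊗ₜ a))).lTensor M
            (((s.bimodule V).left (Pi.single l 1)).rTensor H y) := by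
      intro l y
      induction y using TensorProduct.induction_on with
      | zero => simp
      | tmul m h => simp [hF]
      | add a b ha hb => simp only [map_add, ha, hb]
    simp only [unitCoact_apply, map_sum, LinearMap.sum_apply, h1, rTensor_left]
    generalize s.coact m = y
    induction y using TensorProduct.induction_on with
    | zero => simp
    | tmul m h =>
      have e : ∀ l : V, FaceAlgebra.faceMap (K := K) (V := V) (H := H) (Pi.single l 1 ⊗ₜ a) *
          FaceAlgebra.outer K V H (Pi.single l 1) =
          FaceAlgebra.faceMap (K := K) (V := V) (H := H) (Pi.single l 1 ⊗ₜ a) := by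
        intro l
        change _ * FaceAlgebra.faceMap (K := K) (V := V) (_ ⊗ₜ 1) = _
        rw [← map_mul, Algebra.TensorProduct.tmul_mul_tmul, ← Pi.single_mul, mul_one, mul_one]
      simp only [LinearMap.lTensor_tmul, LinearMap.mulLeft_apply, sandwich_apply, ← mul_assoc, e,
        ← TensorProduct.tmul_sum, ← Finset.sum_mul, ← map_sum, ← TensorProduct.sum_tmul,
        FaceAlgebra.sum_single]
      simp only [map_one, mul_one]
      rfl
    | add a b ha hb => simp only [map_add, ha, hb, Finset.sum_add_distrib]

lemma runit_comodule (s : ComoduleStr K H M)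
    (F : Tensor (s.bimodule V) ((unit K V H).bimodule V) →ₗ[K] M)
    (hF : ∀ m a, F (tmul _ _ m a) = (s.bimodule V).right (.op a) m)
    (x : Tensor (s.bimodule V) ((unit K V H).bimodule V)) :
    s.coact (F x) = F.rTensor H ((tensor V s (unit K V H)).coact x) := by
  induction x using Tensor.induction with
  | zero => simp
  | add a b ha hb => simp only [map_add, ha, hb]
  | tm m a =>
    rw [hF, coact_right]
    change _ = F.rTensor H (mulCoact V s (unit K V H) (s.coact m) (unitCoact K V H a))
    have h1 : ∀ (l : V) (y : M ⊗[K] H), F.rTensor H (mulCoact V s (unit K V H) y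
        ((Pi.single l 1 : V → K) ⊗ₜ[K]
          FaceAlgebra.faceMap (K := K) (V := V) (H := H) (Pi.single l 1 ⊗ₜ a))) =
        (LinearMap.mulRight K (FaceAlgebra.faceMap (K := K) (V := V) (H := H)
          (Pi.single l 1 ⊗ₜ a))).lTensor M
            (((s.bimodule V).right (.op (Pi.single l 1))).rTensor H y) := by
      intro l y
      induction y using TensorProduct.induction_on with
      | zero => simp
      | tmul m h => simp [hF]
      | add a b ha hb => simp only [map_add, LinearMap.add_apply, ha, hb]
    simp only [unitCoact_apply, map_sum, h1, rTensor_right]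
    generalize s.coact m = y
    induction y using TensorProduct.induction_on with
    | zero => simp
    | tmul m h =>
      have e : ∀ l : V, FaceAlgebra.outer K V H (Pi.single l 1) *
          FaceAlgebra.faceMap (K := K) (V := V) (H := H) (Pi.single l 1 ⊗ₜ a) =
          FaceAlgebra.faceMap (K := K) (V := V) (H := H) (Pi.single l 1 ⊗ₜ a) := by
        intro l
        change FaceAlgebra.faceMap (K := K) (V := V) (_ ⊗ₜ 1) * _ = _
        rw [← map_mul, Algebra.TensorProduct.tmul_mul_tmul, ← Pi.single_mul, mul_one, one_mul]
      simp only [LinearMap.lTensor_tmul, LinearMap.mulRight_apply, sandwich_apply, mul_assoc, e,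
        ← TensorProduct.tmul_sum, ← Finset.mul_sum, ← map_sum, ← TensorProduct.sum_tmul,
        FaceAlgebra.sum_single]
      simp only [map_one, one_mul]
      rfl
    | add a b ha hb => simp only [map_add, ha, hb, Finset.sum_add_distrib]

end

end ComoduleStr

/-- Finite-dimensional right comodules of the `V`-face algebra `H`. -/
structure Com (K V H : Type v) [Field K] [Fintype V] [DecidableEq V]
    [Ring H] [Algebra K H] [Coalgebra K H] [FaceAlgebra K V H] where
  carrier : Type v
  [addCommGroup : AddCommGroup carrier]
  [module : Module K carrier]
  [finite : FiniteDimensional K carrier]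
  str : ComoduleStr K H carrier

attribute [instance] Com.addCommGroup Com.module Com.finite

namespace Com

section

variable {K V H : Type v} [Field K] [Fintype V] [DecidableEq V]
    [Ring H] [Algebra K H] [Coalgebra K H] [FaceAlgebra K V H]

instance : Category (Com K V H) where
  Hom M N := ↥(ComoduleStr.homs M.str N.str)
  id M := ⟨LinearMap.id, fun m => by simp⟩
  comp f g := ⟨g.1 ∘ₗ f.1, fun m => by simp [g.2 _, f.2 _, LinearMap.rTensor_comp]⟩

/-- The linear map underlying a homomorphism of comodules. -/
def lin {M N : Com K V H} (f : M ⟶ N) : M.carrier →ₗ[K] N.carrier := Subtype.val f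

/-- A homomorphism of comodules from a linear map. -/
def ofLin {M N : Com K V H} (f : M.carrier →ₗ[K] N.carrier)
    (h : ∀ m, N.str.coact (f m) = f.rTensor H (M.str.coact m)) : M ⟶ N :=
  (⟨f, h⟩ : ↥(ComoduleStr.homs M.str N.str))

lemma coact_lin {M N : Com K V H} (f : M ⟶ N) (m : M.carrier) :
    N.str.coact (lin f m) = (lin f).rTensor H (M.str.coact m) := f.2 m

lemma hom_ext {M N : Com K V H} {f g : M ⟶ N} (h : lin f = lin g) : f = g := Subtype.ext h

instance : Preadditive (Com K V H) where
  homGroup M N := inferInstanceAs (AddCommGroup ↥(ComoduleStr.homs M.str N.str))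
  add_comp := fun _ _ _ f f' g => hom_ext (LinearMap.comp_add f.1 f'.1 g.1)
  comp_add := fun _ _ _ f g g' => hom_ext (LinearMap.add_comp f.1 g'.1 g.1)

instance : Linear K (Com K V H) where
  homModule M N := inferInstanceAs (Module K ↥(ComoduleStr.homs M.str N.str))
  smul_comp := fun _ _ _ r f g => hom_ext (LinearMap.comp_smul g.1 r f.1)
  comp_smul := fun _ _ _ f r g => hom_ext (LinearMap.smul_comp r g.1 f.1)

variable (K V H) in
/-- The functor from comodules to `R`-bimodules, `a m b = ∑ m₀ ε(a m₁ b)`. -/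
def forget : Com K V H ⥤ Bmd K (V → K) where
  obj M := ⟨M.carrier, M.str.bimodule V⟩
  map f := Bmd.ofLin (lin f) (ComoduleStr.hom_left _ _ f.2) (ComoduleStr.hom_right _ _ f.2)

instance : (forget K V H).Faithful where
  map_injective h := hom_ext (congrArg Bmd.lin h)

/-- The linear map underlying an isomorphism of the underlying bimodules. -/
def bmdLin {M N : Com K V H} (e : (forget K V H).obj M ⟶ (forget K V H).obj N) :
    M.carrier →ₗ[K] N.carrier := Bmd.lin e

/-- An isomorphism of bimodules whose underlying map is a comodule map. -/
def isoOfBmd {M N : Com K V H} (e : (forget K V H).obj M ≅ (forget K V H).obj N)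
    (h : ∀ m : M.carrier,
      N.str.coact (bmdLin e.hom m) = (bmdLin e.hom).rTensor H (M.str.coact m)) : M ≅ N where
  hom := ofLin (bmdLin e.hom) h
  inv := ofLin (bmdLin e.inv) (fun n => by
    have h1 : bmdLin e.inv ∘ₗ bmdLin e.hom = LinearMap.id := congrArg Bmd.lin e.hom_inv_id
    have h2 : ∀ x, (bmdLin e.hom) (bmdLin e.inv x) = x := fun x =>
      LinearMap.congr_fun (congrArg Bmd.lin e.inv_hom_id) x
    have h4 := h (bmdLin e.inv n)
    rw [h2] at h4
    have h5 := LinearMap.rTensor_comp_apply H (bmdLin e.inv) (bmdLin e.hom)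
      (M.str.coact (bmdLin e.inv n))
    rw [h1, LinearMap.rTensor_id] at h5
    rw [h4]
    exact h5)
  hom_inv_id := hom_ext (congrArg Bmd.lin e.hom_inv_id)
  inv_hom_id := hom_ext (congrArg Bmd.lin e.inv_hom_id)

/-- The tensor product of comodules. -/
def tensorObj (M N : Com K V H) : Com K V H :=
  ⟨Tensor (M.str.bimodule V) (N.str.bimodule V), ComoduleStr.tensor V M.str N.str⟩

variable (K V H) in
/-- The unit comodule `R`. -/
def tensorUnit : Com K V H := ⟨V → K, ComoduleStr.unit K V H⟩

/-- The identity map, as an isomorphism of bimodules. -/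
def tensorIso (M N : Com K V H) : (forget K V H).obj M ⊗ (forget K V H).obj N ≅
    (forget K V H).obj (tensorObj M N) :=
  Bmd.isoOfLin
    (M := MonoidalCategoryStruct.tensorObj ((forget K V H).obj M) ((forget K V H).obj N))
    (N := (forget K V H).obj (tensorObj M N))
    (LinearMap.id (M := Tensor (M.str.bimodule V) (N.str.bimodule V)))
    (LinearMap.id (M := Tensor (M.str.bimodule V) (N.str.bimodule V))) rfl rfl
    (fun a x => LinearMap.congr_fun
      (DFunLike.congr_fun (congrArg BimoduleStr.left
        (ComoduleStr.bimodule_tensor V M.str N.str).symm) a) x)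
    (fun a x => LinearMap.congr_fun
      (DFunLike.congr_fun (congrArg BimoduleStr.right
        (ComoduleStr.bimodule_tensor V M.str N.str).symm) a) x)

variable (K V H) in
/-- The identity map of `R`, as an isomorphism of bimodules. -/
def unitIso : 𝟙_ (Bmd K (V → K)) ≅ (forget K V H).obj (tensorUnit K V H) :=
  Bmd.isoOfLin (M := MonoidalCategoryStruct.tensorUnit (Bmd K (V → K)))
    (N := (forget K V H).obj (tensorUnit K V H))
    (LinearMap.id (M := V → K)) (LinearMap.id (M := V → K)) rfl rfl
    (fun a x => LinearMap.congr_fun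
      (DFunLike.congr_fun (congrArg BimoduleStr.left
        (ComoduleStr.bimodule_unit K V H).symm) a) x)
    (fun a x => LinearMap.congr_fun
      (DFunLike.congr_fun (congrArg BimoduleStr.right
        (ComoduleStr.bimodule_unit K V H).symm) a) x)

lemma map_comodule {M N M' N' : Com K V H} (f : M ⟶ M') (g : N ⟶ N') (hf) (hg)
    (x : Tensor (M.str.bimodule V) (N.str.bimodule V)) :
    (ComoduleStr.tensor V M'.str N'.str).coact
      (BimoduleStr.map (M.str.bimodule V) (N.str.bimodule V) (M'.str.bimodule V)
        (N'.str.bimodule V) (lin f) (lin g) hf hg x) =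
      (BimoduleStr.map (M.str.bimodule V) (N.str.bimodule V) (M'.str.bimodule V)
        (N'.str.bimodule V) (lin f) (lin g) hf hg).rTensor H
        ((ComoduleStr.tensor V M.str N.str).coact x) := by
  induction x using Tensor.induction with
  | zero => simp
  | tm m n =>
    simp only [ComoduleStr.tensor, map_tmul, ComoduleStr.tensorCoact_tmul, coact_lin]
    generalize M.str.coact m = x
    generalize N.str.coact n = y
    induction x using TensorProduct.induction_on with
    | zero => simp
    | tmul m h =>
      induction y using TensorProduct.induction_on with
      | zero => simp
      | tmul n k => simp
      | add a b ha hb => simp only [map_add, ha, hb]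
    | add a b ha hb => simp only [map_add, LinearMap.add_apply, ha, hb]
  | add x y hx hy => simp only [map_add, hx, hy]

/-- The tensor product of comodule homomorphisms. -/
def tensorMap {M N M' N' : Com K V H} (f : M ⟶ M') (g : N ⟶ N') :
    tensorObj M N ⟶ tensorObj M' N' :=
  ofLin (BimoduleStr.map (M.str.bimodule V) (N.str.bimodule V) (M'.str.bimodule V)
    (N'.str.bimodule V) (lin f) (lin g) (ComoduleStr.hom_right _ _ f.2)
    (ComoduleStr.hom_left _ _ g.2)) (map_comodule f g _ _)

/-- The associativity constraint of `R`-bimodules, for comodules. -/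
def assocIso (M N P : Com K V H) :
    (forget K V H).obj (tensorObj (tensorObj M N) P) ≅
      (forget K V H).obj (tensorObj M (tensorObj N P)) :=
  ((tensorIso (tensorObj M N) P).symm ≪≫ ((tensorIso M N).symm ⊗ᵢ .refl _)) ≪≫
    α_ ((forget K V H).obj M) ((forget K V H).obj N) ((forget K V H).obj P) ≪≫
      ((.refl _ ⊗ᵢ tensorIso N P) ≪≫ tensorIso M (tensorObj N P))

lemma assocIso_tmul (M N P : Com K V H) (m : M.carrier) (n : N.carrier) (p : P.carrier) :
    bmdLin (assocIso M N P).hom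
      (tmul ((tensorObj M N).str.bimodule V) (P.str.bimodule V)
        (tmul (M.str.bimodule V) (N.str.bimodule V) m n) p) =
      tmul (M.str.bimodule V) ((tensorObj N P).str.bimodule V) m
        (tmul (N.str.bimodule V) (P.str.bimodule V) n p) := rfl

/-- The left unit constraint of `R`-bimodules, for comodules. -/
def leftIso (M : Com K V H) :
    (forget K V H).obj (tensorObj (tensorUnit K V H) M) ≅ (forget K V H).obj M :=
  ((tensorIso (tensorUnit K V H) M).symm ≪≫ ((unitIso K V H).symm ⊗ᵢ .refl _)) ≪≫
    λ_ ((forget K V H).obj M)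

lemma leftIso_tmul (M : Com K V H) (a : V → K) (m : M.carrier) :
    bmdLin (leftIso M).hom
      (tmul ((tensorUnit K V H).str.bimodule V) (M.str.bimodule V) a m) =
      (M.str.bimodule V).left a m := rfl

/-- The right unit constraint of `R`-bimodules, for comodules. -/
def rightIso (M : Com K V H) :
    (forget K V H).obj (tensorObj M (tensorUnit K V H)) ≅ (forget K V H).obj M :=
  ((tensorIso M (tensorUnit K V H)).symm ≪≫ (.refl _ ⊗ᵢ (unitIso K V H).symm)) ≪≫
    ρ_ ((forget K V H).obj M)

lemma rightIso_tmul (M : Com K V H) (m : M.carrier) (a : V → K) :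
    bmdLin (rightIso M).hom
      (tmul (M.str.bimodule V) ((tensorUnit K V H).str.bimodule V) m a) =
      (M.str.bimodule V).right (.op a) m := rfl

/-- The monoidal structure `⊗_R` on comodules, with associativity and unit constraints those of
`R`-bimodules. -/
instance : MonoidalCategoryStruct (Com K V H) where
  tensorObj := tensorObj
  tensorUnit := tensorUnit K V H
  tensorHom := tensorMap
  whiskerLeft M _ _ f := tensorMap (𝟙 M) f
  whiskerRight f N := tensorMap f (𝟙 N)
  associator M N P := isoOfBmd (assocIso M N P) (ComoduleStr.assoc_comodule V M.str N.str P.str _ (assocIso_tmul M N P))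
  leftUnitor M := isoOfBmd (leftIso M)
    (ComoduleStr.lunit_comodule V M.str _ (leftIso_tmul M))
  rightUnitor M := isoOfBmd (rightIso M)
    (ComoduleStr.runit_comodule V M.str _ (rightIso_tmul M))

/-- Comparison data between the tensor products of comodules and of bimodules. -/
def inducingData : Monoidal.InducingFunctorData (forget K V H) where
  μIso := tensorIso
  εIso := unitIso K V H
  whiskerLeft_eq _ _ _ _ := Bmd.hom_ext (Tensor.ext fun _ _ => rfl)
  whiskerRight_eq _ _ := Bmd.hom_ext (Tensor.ext fun _ _ => rfl)
  tensorHom_eq _ _ := Bmd.hom_ext (Tensor.ext fun _ _ => rfl)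
  associator_eq _ _ _ := rfl
  leftUnitor_eq _ := rfl
  rightUnitor_eq _ := rfl

instance : MonoidalCategory (Com K V H) := Monoidal.induced (forget K V H) inducingData

instance : (forget K V H).Monoidal := Monoidal.fromInducedMonoidal (forget K V H) inducingData

end

end Com

namespace BimoduleStr

section

variable {K A M N P Q : Type*} [Field K] [AddCommGroup M] [Module K M]
  [AddCommGroup N] [Module K N]

/-- The dual `M^*` of a bimodule over a commutative algebra, with `⟨a φ b, m⟩ = ⟨φ, a m b⟩`. -/
def dual [CommRing A] [Algebra K A] (s : BimoduleStr K A M) :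
    BimoduleStr K A (Module.Dual K M) where
  left :=
    { toFun := fun a => (s.left a).dualMap
      map_one' := by ext; simp
      map_mul' := fun a b => by rw [mul_comm]; ext; simp
      map_zero' := by ext; simp
      map_add' := fun a b => by ext; simp
      commutes' := fun r => by ext; simp }
  right :=
    { toFun := fun a => (s.right a).dualMap
      map_one' := by ext; simp
      map_mul' := fun a b => by rw [mul_comm]; ext; simp
      map_zero' := by ext; simp
      map_add' := fun a b => by ext; simp
      commutes' := fun r => by ext; simp }
  comm := fun a b φ => LinearMap.ext fun m => (congrArg φ (s.comm a b m)).symm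

/-- The `A ⊗ B`-bimodule `M ⊗ N`, with `(a ⊗ b) (m ⊗ n) (a' ⊗ b') = a m a' ⊗ b n b'`. -/
def outerTensor {B : Type*} [Ring A] [Algebra K A] [Ring B] [Algebra K B]
    (s : BimoduleStr K A M) (t : BimoduleStr K B N) :
    BimoduleStr K (A ⊗[K] B) (M ⊗[K] N) where
  left := (Module.endTensorEndAlgHom (R := K) (S := K) (A := K)).comp
    (Algebra.TensorProduct.map s.left t.left)
  right := ((Module.endTensorEndAlgHom (R := K) (S := K) (A := K)).comp
    (Algebra.TensorProduct.map s.right t.right)).comp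
      (Algebra.TensorProduct.opAlgEquiv K K A B).symm.toAlgHom
  comm := fun a b x => by
    induction b using MulOpposite.rec' with
    | _ b =>
    induction a using TensorProduct.induction_on with
    | zero => simp
    | add a a' ha ha' => simp only [map_add, LinearMap.add_apply, ha, ha']
    | tmul a a' =>
      induction b using TensorProduct.induction_on with
      | zero => simp
      | add b b' hb hb' => simp only [map_add, MulOpposite.op_add, LinearMap.add_apply, hb, hb']
      | tmul b b' =>
        induction x using TensorProduct.induction_on with
        | zero => simp
        | add x y hx hy => simp only [map_add, hx, hy]
        | tmul m n => exact congrArg₂ (fun x y => x ⊗ₜ[K] y) (s.comm a (.op b) m) (t.comm a' (.op b') n)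

lemma outerTensor_left {B : Type*} [Ring A] [Algebra K A] [Ring B] [Algebra K B]
    (s : BimoduleStr K A M) (t : BimoduleStr K B N) (a : A) (b : B) (m : M) (n : N) :
    (outerTensor s t).left (a ⊗ₜ b) (m ⊗ₜ n) = s.left a m ⊗ₜ t.left b n := rfl

lemma outerTensor_right {B : Type*} [Ring A] [Algebra K A] [Ring B] [Algebra K B]
    (s : BimoduleStr K A M) (t : BimoduleStr K B N) (a : A) (b : B) (m : M) (n : N) :
    (outerTensor s t).right (.op (a ⊗ₜ b)) (m ⊗ₜ n) =
      s.right (.op a) m ⊗ₜ t.right (.op b) n := rfl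

end

end BimoduleStr

/-- The objects `L l`, `l : V`, exhibit `C` as a split finite semisimple category: they satisfy
Schur's lemma `C(L l, L m) = K δ_{l m} id`, and every object is isomorphic to a finite direct sum
of them. -/
structure IsSplitFiniteSemisimple (K : Type*) {V C : Type*} [Field K] [Category C]
    [Preadditive C] [Linear K C] (L : V → C) : Prop where
  hom_eq_zero : ∀ l m : V, l ≠ m → ∀ f : L l ⟶ L m, f = 0
  end_bijective : ∀ l : V, Function.Bijective fun c : K => c • 𝟙 (L l)
  exists_iso : ∀ X : C, ∃ (n : ℕ) (f : Fin n → V) (b : Bicone fun i => L (f i)),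
    Nonempty b.IsBilimit ∧ Nonempty (X ≅ b.pt)

lemma IsSplitFiniteSemisimple.finite_hom {K V C : Type*} [Field K] [Category C]
    [Preadditive C] [Linear K C] {L : V → C} (hL : IsSplitFiniteSemisimple K L) (l : V) (X : C) :
    FiniteDimensional K (L l ⟶ X) := by
  obtain ⟨n, f, b, ⟨hb⟩, ⟨e⟩⟩ := hL.exists_iso X
  have h1 : ∀ i, FiniteDimensional K (L l ⟶ L (f i)) := by
    intro i
    rcases eq_or_ne l (f i) with h | h
    · rw [← h]
      exact Module.Finite.of_surjective
        (LinearMap.toSpanSingleton K (L l ⟶ L l) (𝟙 (L l))) (hL.end_bijective l).2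
    · have : Subsingleton (L l ⟶ L (f i)) :=
        ⟨fun a b => by rw [hL.hom_eq_zero _ _ h a, hL.hom_eq_zero _ _ h b]⟩
      infer_instance
  let T : (L l ⟶ X) →ₗ[K] (∀ i, L l ⟶ L (f i)) :=
    LinearMap.pi fun i => Linear.rightComp K (L l) (e.hom ≫ b.π i)
  refine FiniteDimensional.of_injective T fun g h hgh => ?_
  rw [← cancel_mono e.hom]
  refine hb.isLimit.hom_ext fun ⟨i⟩ => ?_
  simpa [T] using congrFun hgh i

section Tannaka

variable {K V : Type v} [Field K] [Fintype V] [DecidableEq V]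
  {C : Type u} [Category.{v} C]

/-- `(H, κ)` is the coend of `Ω^* ⊗ Ω : Cᵒᵖ × C ⥤ Bmd(E)`, where `E = R ⊗ R`. -/
structure IsFaceCoend (Ω : C ⥤ Bmd K (V → K)) {H : Type v} [AddCommGroup H] [Module K H]
    (s : BimoduleStr K ((V → K) ⊗[K] (V → K)) H)
    (κ : ∀ X : C, Module.Dual K (Ω.obj X).carrier ⊗[K] (Ω.obj X).carrier →ₗ[K] H) : Prop where
  bimodule : ∀ X, κ X ∈ homs (outerTensor (Ω.obj X).str.dual (Ω.obj X).str) s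
  dinatural : ∀ {X Y : C} (f : X ⟶ Y) (φ : Module.Dual K (Ω.obj Y).carrier)
    (x : (Ω.obj X).carrier),
      κ Y (φ ⊗ₜ Bmd.lin (Ω.map f) x) = κ X ((φ ∘ₗ Bmd.lin (Ω.map f)) ⊗ₜ x)
  universal : ∀ (M : Type v) [AddCommGroup M] [Module K M]
    (t : BimoduleStr K ((V → K) ⊗[K] (V → K)) M)
    (ι : ∀ X : C, Module.Dual K (Ω.obj X).carrier ⊗[K] (Ω.obj X).carrier →ₗ[K] M),
    (∀ X, ι X ∈ homs (outerTensor (Ω.obj X).str.dual (Ω.obj X).str) t) →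
    (∀ {X Y : C} (f : X ⟶ Y) (φ : Module.Dual K (Ω.obj Y).carrier) (x : (Ω.obj X).carrier),
      ι Y (φ ⊗ₜ Bmd.lin (Ω.map f) x) = ι X ((φ ∘ₗ Bmd.lin (Ω.map f)) ⊗ₜ x)) →
    ∃! h : H →ₗ[K] M, h ∈ homs s t ∧ ∀ X, h ∘ₗ κ X = ι X

/-- `δ_X(m) = ∑ i, m_i ⊗ κ_X(m^i ⊗ m)`, for a basis `m_i` of `Ω(X)` with dual basis `m^i`. -/
def tannakaCoact {Ω : C ⥤ Bmd K (V → K)} {H : Type v} [AddCommGroup H] [Module K H]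
    (κ : ∀ X : C, Module.Dual K (Ω.obj X).carrier ⊗[K] (Ω.obj X).carrier →ₗ[K] H) (X : C) :
    (Ω.obj X).carrier →ₗ[K] (Ω.obj X).carrier ⊗[K] H :=
  ∑ i, TensorProduct.mk K (Ω.obj X).carrier H (Module.finBasis K (Ω.obj X).carrier i) ∘ₗ
    κ X ∘ₗ TensorProduct.mk K _ _ ((Module.finBasis K (Ω.obj X).carrier).coord i)

/-- `H` with `κ` is the face algebra `C(Ω)` of a monoidal functor `Ω : C ⥤ bmd(R)`: the coend
of `Ω^* ⊗ Ω` as an `E`-bimodule, with the coalgebra structure making each `δ_X` a coaction,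
the product for which `φ₂ : Ω(X) ⊗_R Ω(Y) ≅ Ω(X ⊗ Y)` is compatible with the coactions, and the
map `E → H` for which `φ₀ : R ≅ Ω(I)` is compatible with the coactions. -/
structure IsTannakaFaceAlgebra [MonoidalCategory C] (Ω : C ⥤ Bmd K (V → K)) [Ω.Monoidal]
    {H : Type v} [Ring H] [Algebra K H] [Coalgebra K H] [FaceAlgebra K V H]
    (κ : ∀ X : C, Module.Dual K (Ω.obj X).carrier ⊗[K] (Ω.obj X).carrier →ₗ[K] H) : Prop where
  isFaceCoend : IsFaceCoend Ω (FaceAlgebra.bimodule K V H) κ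
  comul : ∀ (X : C) (φ : Module.Dual K (Ω.obj X).carrier) (m : (Ω.obj X).carrier),
    Coalgebra.comul (R := K) (κ X (φ ⊗ₜ m)) =
      ∑ i, κ X (φ ⊗ₜ Module.finBasis K (Ω.obj X).carrier i) ⊗ₜ[K]
        κ X ((Module.finBasis K (Ω.obj X).carrier).coord i ⊗ₜ m)
  counit : ∀ (X : C) (φ : Module.Dual K (Ω.obj X).carrier) (m : (Ω.obj X).carrier),
    Coalgebra.counit (R := K) (κ X (φ ⊗ₜ m)) = φ m
  mul : ∀ (X Y : C) (x : (Ω.obj X).carrier) (y : (Ω.obj Y).carrier),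
    tannakaCoact κ (X ⊗ Y) (Bmd.lin (Functor.LaxMonoidal.μ Ω X Y) (Bmd.tmk _ _ x y)) =
      TensorProduct.map₂
        ((Bmd.tmk (Ω.obj X) (Ω.obj Y)).compr₂ (Bmd.lin (Functor.LaxMonoidal.μ Ω X Y)))
        (LinearMap.mul K H) (tannakaCoact κ X x) (tannakaCoact κ Y y)
  unit : ∀ m : V,
    tannakaCoact κ (𝟙_ C) (Bmd.lin (Functor.LaxMonoidal.ε Ω) (Pi.single m 1 : V → K)) =
      ∑ l : V, Bmd.lin (Functor.LaxMonoidal.ε Ω) (Pi.single l 1 : V → K) ⊗ₜ[K]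
        FaceAlgebra.faceMap (K := K) (V := V) (Pi.single l 1 ⊗ₜ Pi.single m 1)

variable [Preadditive C] [Linear K C] [MonoidalCategory C] [MonoidalPreadditive C]
  [MonoidalLinear K C]

variable (K) in
/-- The `R`-bimodule structure on `⨁ λ μ, C(L_μ, L_λ ⊗ X)` for which
`λ Ω₀(X) μ = C(L_μ, L_λ ⊗ X)`. -/
def omega0Str (L : V → C) (X : C) :
    BimoduleStr K (V → K) (∀ l m : V, L m ⟶ L l ⊗ X) where
  left :=
    { toFun := fun a =>
        { toFun := fun f l m => a l • f l m
          map_add' := fun f g => by ext l m; simp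
          map_smul' := fun c f => funext fun l => funext fun m => smul_comm (a l) c (f l m) }
      map_one' := by ext f l m; simp
      map_mul' := fun a b => by ext f l m; simp [smul_smul]
      map_zero' := by ext f l m; simp
      map_add' := fun a b => by ext f l m; simp [add_smul]
      commutes' := fun r => by ext f l m; simp }
  right :=
    { toFun := fun b =>
        { toFun := fun f l m => b.unop m • f l m
          map_add' := fun f g => by ext l m; simp
          map_smul' := fun c f => funext fun l => funext fun m =>
            smul_comm (b.unop m) c (f l m) }
      map_one' := by ext f l m; simp
      map_mul' := fun a b => by ext f l m; simp [smul_smul, mul_comm]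
      map_zero' := by ext f l m; simp
      map_add' := fun a b => by ext f l m; simp [add_smul]
      commutes' := fun r => by ext f l m; simp }
  comm := fun a b f => funext fun l => funext fun m => smul_comm _ _ _

/-- The functor `Ω₀`, with `λ Ω₀(X) μ = C(L_μ, L_λ ⊗ X)` and `Ω₀(f)(k) = (id ⊗ f) ∘ k`. -/
def Omega0 (L : V → C) (hL : IsSplitFiniteSemisimple K L) : C ⥤ Bmd K (V → K) where
  obj X :=
    { carrier := ∀ l m : V, L m ⟶ L l ⊗ X
      finite :=
        have := fun l m : V => hL.finite_hom m (L l ⊗ X)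
        inferInstance
      str := omega0Str K L X }
  map {X Y} f := Bmd.ofLin
    { toFun := fun k l m => k l m ≫ L l ◁ f
      map_add' := fun k k' => by ext l m; simp
      map_smul' := fun c k => by ext l m; simp }
    (fun a k => funext fun l => funext fun m => Linear.smul_comp _ _ _ (a l) (k l m) (L l ◁ f))
    (fun a k => funext fun l => funext fun m =>
      Linear.smul_comp _ _ _ (a.unop m) (k l m) (L l ◁ f))
  map_id X := Bmd.hom_ext <| LinearMap.ext fun k => funext fun l => funext fun m => by
    change k l m ≫ L l ◁ 𝟙 X = k l m
    simp
  map_comp {X Y Z} f g := Bmd.hom_ext <| LinearMap.ext fun k => funext fun l => funext fun m => by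
    change k l m ≫ L l ◁ (f ≫ g) = (k l m ≫ L l ◁ f) ≫ L l ◁ g
    simp

/-- An element of `Ω₀(X)`, as a family of morphisms `L_μ ⟶ L_λ ⊗ X`. -/
abbrev omega0Elt (L : V → C) (hL : IsSplitFiniteSemisimple K L) {X : C}
    (k : ∀ l m : V, L m ⟶ L l ⊗ X) : ((Omega0 L hL).obj X).carrier := k

end Tannaka

end

set_option linter.unusedSectionVars false

noncomputable section

open BimoduleStr

/-! Semisimplicity enters through two facts. The identity of every object is a sum of composites
through simple objects (`Resolution`), and a morphism between simple objects is zero or a scalar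
(`IsSplitFiniteSemisimple.hom_induction`). They give every morphism `f` a partner `s` with `f ≫ s ≫
f = f`, so kernels and cokernels split and every additive functor out of `C` is exact. They also
make `φ₂` invertible: a morphism `L m ⟶ L l ⊗ (X ⊗ Y)` is decomposed by resolving `L l ⊗ X` into
simple objects. Faithfulness of `Ω₀` holds because `L l ◁ f`, for all `l`, determines `𝟙_ C ◁ f`,
hence `f`.

The remainder is Tannaka reconstruction for any faithful `K`-linear monoidal functor `Ω : C ⥤ Bmd K
(V → K)`. The coend is the finite direct sum of the spaces `Ω(L l)^* ⊗ Ω(L l)`; it is spanned by the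
matrix coefficients `κ_X(φ ⊗ x)` of all objects `X`. Each structure map is prescribed on matrix
coefficients, exists because the prescription is dinatural (`desc_kap`), and satisfies its axioms
because these can be tested on matrix coefficients (`Tannaka.hom_ext`). Identities involving dual
bases rest on one principle, `Module.Basis.sum_eq_of_rank_one`: a sum of rank one tensors `u i ⊗ ξ
i` depends only on the operator it represents. Thus naturality of the coaction expresses `Ω(f)` in
two ways, and multiplicativity of `Δ` expresses the identity of `Ω(X ⊗ Y)` in two ways
(`sum_ten_dualTen`).

For the equivalence, the coend is as a coalgebra a direct sum of matrix coalgebras, so its dual is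
the product of the algebras `End Ω(L l)`, and comodules are modules over this product. Rank one
operators (`rankOne`) make this explicit. They act on `Ω(L l)` as themselves, which gives Schur's
lemma for these comodules and hence fullness. On an arbitrary comodule `M`, the image of a rank one
idempotent of `End Ω(L l)` is the multiplicity space of `Ω(L l)` in `M`, which gives essential
surjectivity. Faithfulness of `Ω` ensures `Ω(L l) ≠ 0`, so that such idempotents exist. -/

/-! ### Semisimplicity: generalized inverses and exactness of additive functors -/

/-- Over a field, `T` has a section over its range, and this section extends linearly to all of `N`.
-/
lemma LinearMap.exists_generalizedInverse {K M N : Type*} [Field K] [AddCommGroup M] [Module K M]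
    [AddCommGroup N] [Module K N] (T : M →ₗ[K] N) :
    ∃ S : N →ₗ[K] M, ∀ x, T (S (T x)) = T x := by
  obtain ⟨r, hr⟩ := T.rangeRestrict.exists_rightInverse_of_surjective T.range_rangeRestrict
  obtain ⟨S, hS⟩ := r.exists_extend
  refine ⟨S, fun x => ?_⟩
  have h1 : S (T x) = r (T.rangeRestrict x) := LinearMap.congr_fun hS (T.rangeRestrict x)
  rw [h1]
  exact congrArg Subtype.val (LinearMap.congr_fun hr (T.rangeRestrict x))

namespace IsSplitFiniteSemisimple

section

variable {K V C : Type*} [Field K] [Category C] [Preadditive C] [Linear K C] {L : V → C}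

/-- A resolution of the identity of `X` through the simple objects `L l`. -/
structure Resolution (L : V → C) (X : C) where
  n : ℕ
  idx : Fin n → V
  ι : ∀ i, L (idx i) ⟶ X
  π : ∀ i, X ⟶ L (idx i)
  total : ∑ i, π i ≫ ι i = 𝟙 X

/-- Only the completeness relation of a biproduct decomposition is retained. Orthogonality of the
components is never needed, which is why `Resolution` omits it. -/
lemma nonempty_resolution (hL : IsSplitFiniteSemisimple K L) (X : C) :
    Nonempty (Resolution L X) := by
  obtain ⟨n, f, b, ⟨hb⟩, ⟨e⟩⟩ := hL.exists_iso X
  refine ⟨⟨n, f, fun i => b.ι i ≫ e.inv, fun i => e.hom ≫ b.π i, ?_⟩⟩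
  have h := IsBilimit.total hb
  have h2 : ∑ i, (e.hom ≫ b.π i) ≫ b.ι i ≫ e.inv = e.hom ≫ (∑ i, b.π i ≫ b.ι i) ≫ e.inv := by
    simp [Preadditive.comp_sum, Preadditive.sum_comp]
  rw [h2, h]
  simp

/-- A chosen resolution of the identity of `X` through the simple objects. -/
def resolution (hL : IsSplitFiniteSemisimple K L) (X : C) : Resolution L X :=
  (hL.nonempty_resolution X).some

/-- Schur's lemma in the form of an induction principle; naturality with respect to morphisms
between simple objects then reduces to linearity. -/
lemma hom_induction (hL : IsSplitFiniteSemisimple K L) {p : ∀ l m : V, (L l ⟶ L m) → Prop}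
    (zero : ∀ l m, l ≠ m → p l m 0) (smul : ∀ l (c : K), p l l (c • 𝟙 (L l)))
    {l m : V} (g : L l ⟶ L m) : p l m g := by
  rcases eq_or_ne l m with rfl | h
  · obtain ⟨c, rfl⟩ := (hL.end_bijective l).2 g
    exact smul l c
  · rw [hL.hom_eq_zero l m h g]
    exact zero l m h

/-- The simple objects separate morphisms, since the identity of `X` factors through them. -/
lemma eq_zero_of_comp (hL : IsSplitFiniteSemisimple K L) {X Y : C} {f : X ⟶ Y}
    (h : ∀ (l : V) (k : L l ⟶ X), k ≫ f = 0) : f = 0 := by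
  rw [← Category.id_comp f, ← (hL.resolution X).total, Preadditive.sum_comp]
  exact Finset.sum_eq_zero fun i _ => by rw [Category.assoc, h, comp_zero]

/-- Generalized inverses of the linear maps `C(L l, X) → C(L l, Y)` given by `f` are chosen
independently for each `l`. By Schur's lemma any such choice is natural in `l`, and by
semisimplicity a natural family is composition with a morphism `Y ⟶ X`. -/
lemma exists_generalizedInverse (hL : IsSplitFiniteSemisimple K L) {X Y : C} (f : X ⟶ Y) :
    ∃ s : Y ⟶ X, f ≫ s ≫ f = f := by
  choose S hS using fun l => LinearMap.exists_generalizedInverse (Linear.rightComp K (L l) f)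
  simp only [Linear.rightComp_apply] at hS
  have key : ∀ {l m : V} (g : L l ⟶ L m) (k : L m ⟶ Y), g ≫ S m k = S l (g ≫ k) := fun {l m} g =>
    hL.hom_induction (p := fun l m g => ∀ k : L m ⟶ Y, g ≫ S m k = S l (g ≫ k))
      (by simp) (by simp) g
  let r := hL.resolution Y
  -- A Yoneda argument: the value of the family on the identity of `Y`, spread over a resolution, is
  -- the representing morphism.
  have h2 : ∀ (l : V) (k : L l ⟶ Y), k ≫ (∑ j, r.π j ≫ S _ (r.ι j)) = S l k := by
    intro l k
    rw [Preadditive.comp_sum]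
    simp only [← Category.assoc, key, ← map_sum]
    simp only [Category.assoc, ← Preadditive.comp_sum, r.total, Category.comp_id]
  refine ⟨∑ j, r.π j ≫ S _ (r.ι j), ?_⟩
  rw [← sub_eq_zero]
  refine hL.eq_zero_of_comp fun l k => ?_
  rw [Preadditive.comp_sub, ← Category.assoc k f, ← Category.assoc (k ≫ f), h2, hS, sub_self]

end

section

variable {K V : Type*} {C D : Type*} [Field K] [Category C] [Abelian C] [Linear K C] {L : V → C}
  [Category D] [Preadditive D] (F : C ⥤ D) [F.Additive]

/-- With `f ≫ s ≫ f = f`, the endomorphism `𝟙 X - f ≫ s` is annihilated by `f` and is the identity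
on the kernel. It therefore gives a retraction of `kernel.ι f`, and a kernel split by such equations
is preserved by every additive functor. -/
lemma preservesKernel (hL : IsSplitFiniteSemisimple K L) {X Y : C} (f : X ⟶ Y) :
    PreservesLimit (parallelPair f 0) F := by
  obtain ⟨s, hs⟩ := hL.exists_generalizedInverse f
  let r : X ⟶ kernel f := kernel.lift f (𝟙 X - f ≫ s) (by simp [hs])
  have hr : r ≫ kernel.ι f = 𝟙 X - f ≫ s := kernel.lift_ι _ _ _
  have hr' : kernel.ι f ≫ r = 𝟙 _ := by
    rw [← cancel_mono (kernel.ι f), Category.assoc, hr]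
    simp
  refine preservesLimit_of_preserves_limit_cone (kernelIsKernel f) ?_
  refine (KernelFork.isLimitMapConeEquiv _ F).symm ?_
  refine KernelFork.IsLimit.ofι (F.map (kernel.ι f))
    (by rw [← F.map_comp, kernel.condition, F.map_zero]) (fun g _ => g ≫ F.map r) (fun {W'} g hg => ?_)
    (fun {W'} g hg m hm => ?_)
  · rw [Category.assoc, ← F.map_comp, hr]
    simp [reassoc_of% hg]
  · change m ≫ F.map (kernel.ι f) = g at hm
    rw [← hm, Category.assoc, ← F.map_comp, hr']
    simp

/-- Dual to `preservesKernel`: the complementary endomorphism `𝟙 Y - s ≫ f` yields a section of the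
cokernel projection. -/
lemma preservesCokernel (hL : IsSplitFiniteSemisimple K L) {X Y : C} (f : X ⟶ Y) :
    PreservesColimit (parallelPair f 0) F := by
  obtain ⟨s, hs⟩ := hL.exists_generalizedInverse f
  let r : cokernel f ⟶ Y := cokernel.desc f (𝟙 Y - s ≫ f) (by simp [hs])
  have hr : cokernel.π f ≫ r = 𝟙 Y - s ≫ f := cokernel.π_desc _ _ _
  have hr' : r ≫ cokernel.π f = 𝟙 _ := by
    rw [← cancel_epi (cokernel.π f), ← Category.assoc, hr]
    simp
  refine preservesColimit_of_preserves_colimit_cocone (cokernelIsCokernel f) ?_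
  refine (CokernelCofork.isColimitMapCoconeEquiv _ F).symm ?_
  refine CokernelCofork.IsColimit.ofπ (F.map (cokernel.π f))
    (by rw [← F.map_comp, cokernel.condition, F.map_zero]) (fun g _ => F.map r ≫ g) (fun {W'} g hg => ?_)
    (fun {W'} g hg m hm => ?_)
  · rw [← Category.assoc, ← F.map_comp, hr]
    simp [hg]
  · change F.map (cokernel.π f) ≫ m = g at hm
    rw [← hm, ← Category.assoc, ← F.map_comp, hr']
    simp

open ZeroObject in
lemma hasZeroObject_of_additive (F : C ⥤ D) [F.Additive] : HasZeroObject D :=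
  ⟨F.obj 0, by rw [IsZero.iff_id_eq_zero, ← F.map_id, id_zero, F.map_zero]⟩

lemma preservesFiniteLimits (hL : IsSplitFiniteSemisimple K L) : PreservesFiniteLimits F := by
  have := fun {X Y : C} (f : X ⟶ Y) => hL.preservesKernel F f
  have := hasZeroObject_of_additive F
  exact F.preservesFiniteLimits_of_preservesKernels

lemma preservesFiniteColimits (hL : IsSplitFiniteSemisimple K L) : PreservesFiniteColimits F := by
  have := fun {X Y : C} (f : X ⟶ Y) => hL.preservesCokernel F f
  have := hasZeroObject_of_additive F
  exact F.preservesFiniteColimits_of_preservesCokernels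

end

end IsSplitFiniteSemisimple

/-! ### The functor `Ω₀`: tensorator, unit and faithfulness -/

namespace Omega0

section

variable {K V : Type v} [Field K] [Fintype V] [DecidableEq V]
  {C : Type u} [Category.{v} C] [Preadditive C] [Linear K C] [MonoidalCategory C]
  [MonoidalPreadditive C] [MonoidalLinear K C] {L : V → C}

variable (K L) in
/-- A morphism `L m ⟶ L l ⊗ X` as an element of `Ω₀(X)`. -/
def single {X : C} (l m : V) : (L m ⟶ L l ⊗ X) →ₗ[K] (∀ l m : V, L m ⟶ L l ⊗ X) :=
  LinearMap.single K (fun l => ∀ m, L m ⟶ L l ⊗ X) l ∘ₗ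
    LinearMap.single K (fun m => L m ⟶ L l ⊗ X) m

lemma single_apply {X : C} (l m : V) (k : L m ⟶ L l ⊗ X) :
    single K L l m k = Pi.single l (Pi.single m k) := rfl

lemma sum_single_eq {X : C} (f : ∀ l m : V, L m ⟶ L l ⊗ X) :
    ∑ l, ∑ m, single K L l m (f l m) = f := by
  refine Eq.trans (Finset.sum_congr rfl fun l _ => ?_) (Finset.univ_sum_single f)
  simp only [single, LinearMap.comp_apply, ← map_sum]
  exact congrArg (Pi.single l) (Finset.univ_sum_single (f l))

lemma left_single {X : C} (a : V → K) (l m : V) (k : L m ⟶ L l ⊗ X) :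
    (omega0Str K L X).left a (single K L l m k) = a l • single K L l m k := by
  ext l' m'
  change a l' • single K L l m k l' m' = a l • single K L l m k l' m'
  rcases eq_or_ne l' l with rfl | h
  · rfl
  · simp [single_apply, h]

lemma right_single {X : C} (a : V → K) (l m : V) (k : L m ⟶ L l ⊗ X) :
    (omega0Str K L X).right (.op a) (single K L l m k) = a m • single K L l m k := by
  ext l' m'
  change a m' • single K L l m k l' m' = a m • single K L l m k l' m'
  rcases eq_or_ne l' l with rfl | h
  · rcases eq_or_ne m' m with rfl | h'
    · rfl
    · simp [single_apply, h']
  · simp [single_apply, h]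

/-- The idempotent of `n`, moved across the tensor sign, fixes the left factor and kills the right
one. -/
lemma tmul_single_of_ne {X Y : C} {l n n' m : V} (h : n ≠ n') (e : L n ⟶ L l ⊗ X)
    (g : L m ⟶ L n' ⊗ Y) :
    tmul (omega0Str K L X) (omega0Str K L Y) (single K L l n e) (single K L n' m g) = 0 := by
  have h1 := tmul_balanced (omega0Str K L X) (omega0Str K L Y) (single K L l n e)
    (Pi.single n 1) (single K L n' m g)
  simpa [left_single, right_single, h.symm] using h1

/-- Tensors over `R` are balanced not only for `R` but for all morphisms between simple objects,
because these are scalars or zero. This is what allows `mulInv` to be built from an arbitrary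
resolution. -/
lemma tmul_single_comp (hL : IsSplitFiniteSemisimple K L) {X Y : C} {l m n n' : V}
    (k : L n ⟶ L n') (e : L n' ⟶ L l ⊗ X) (g : L m ⟶ L n ⊗ Y) :
    tmul (omega0Str K L X) (omega0Str K L Y) (single K L l n' e)
        (single K L n' m (g ≫ k ▷ Y)) =
      tmul (omega0Str K L X) (omega0Str K L Y) (single K L l n (k ≫ e)) (single K L n m g) := by
  refine hL.hom_induction (p := fun n n' k => ∀ (e : L n' ⟶ L l ⊗ X) (g : L m ⟶ L n ⊗ Y),
    tmul (omega0Str K L X) (omega0Str K L Y) (single K L l n' e)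
        (single K L n' m (g ≫ k ▷ Y)) =
      tmul (omega0Str K L X) (omega0Str K L Y) (single K L l n (k ≫ e)) (single K L n m g))
    (by simp) (fun n c e g => ?_) k e g
  simp [MonoidalLinear.smul_whiskerRight]

/-- Homogeneous tensors whose middle indices disagree vanish, so the composable pairs span the
tensor product over `R`. -/
lemma tensor_ext {X Y : C} {P : Type*} [AddCommGroup P] [Module K P]
    {F G : Tensor (omega0Str K L X) (omega0Str K L Y) →ₗ[K] P}
    (h : ∀ (l n m : V) (e : L n ⟶ L l ⊗ X) (g : L m ⟶ L n ⊗ Y),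
      F (tmul _ _ (single K L l n e) (single K L n m g)) =
        G (tmul _ _ (single K L l n e) (single K L n m g))) : F = G := by
  refine Tensor.ext fun f g => ?_
  rw [← sum_single_eq (K := K) f, ← sum_single_eq (K := K) g]
  simp only [map_sum, LinearMap.sum_apply]
  refine Finset.sum_congr rfl fun l _ => Finset.sum_congr rfl fun m _ =>
    Finset.sum_congr rfl fun l' _ => Finset.sum_congr rfl fun n _ => ?_
  rcases eq_or_ne n l with rfl | hm
  · exact h _ _ _ _ _
  · rw [tmul_single_of_ne hm, map_zero, map_zero]

/-- The tensorator `φ₂` of `Ω₀`, as a linear map. -/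
def mul (X Y : C) : Tensor (omega0Str K L X) (omega0Str K L Y) →ₗ[K]
    (∀ l m : V, L m ⟶ L l ⊗ (X ⊗ Y)) :=
  lift _ _ (LinearMap.mk₂ K
    (fun f g l m => ∑ n : V, g n m ≫ (f l n ▷ Y) ≫ (α_ (L l) X Y).hom)
    (fun f f' g => by ext l m; simp [Finset.sum_add_distrib])
    (fun c f g => by ext l m; simp [Finset.smul_sum, MonoidalLinear.smul_whiskerRight])
    (fun f g g' => by ext l m; simp [Finset.sum_add_distrib])
    (fun c f g => by ext l m; simp [Finset.smul_sum]))
  (fun f a g => by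
    ext l m
    change ∑ n, g n m ≫ ((a n • f l n) ▷ Y) ≫ (α_ (L l) X Y).hom = ∑ n, (a n • g n m) ≫ (f l n ▷ Y) ≫ (α_ (L l) X Y).hom
    simp [MonoidalLinear.smul_whiskerRight])

lemma mul_tmul {X Y : C} (f : ∀ l m : V, L m ⟶ L l ⊗ X) (g : ∀ l m : V, L m ⟶ L l ⊗ Y) (l m : V) :
    mul (K := K) X Y (tmul _ _ f g) l m = ∑ n : V, g n m ≫ (f l n ▷ Y) ≫ (α_ (L l) X Y).hom := rfl

lemma mul_left (X Y : C) (a : V → K) (x : Tensor (omega0Str K L X) (omega0Str K L Y)) :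
    mul X Y ((tensor _ _).left a x) = (omega0Str K L (X ⊗ Y)).left a (mul X Y x) := by
  induction x using Tensor.induction with
  | zero => simp
  | add x y hx hy => simp only [map_add, hx, hy]
  | tm f g =>
    ext l m
    change ∑ n, g n m ≫ ((a l • f l n) ▷ Y) ≫ (α_ (L l) X Y).hom = a l • ∑ n, g n m ≫ (f l n ▷ Y) ≫ (α_ (L l) X Y).hom
    simp [MonoidalLinear.smul_whiskerRight, Finset.smul_sum]

lemma mul_right (X Y : C) (a : (V → K)ᵐᵒᵖ) (x : Tensor (omega0Str K L X) (omega0Str K L Y)) :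
    mul X Y ((tensor _ _).right a x) = (omega0Str K L (X ⊗ Y)).right a (mul X Y x) := by
  induction x using Tensor.induction with
  | zero => simp
  | add x y hx hy => simp only [map_add, hx, hy]
  | tm f g =>
    ext l m
    change ∑ n, (a.unop m • g n m) ≫ (f l n ▷ Y) ≫ (α_ (L l) X Y).hom =
      a.unop m • ∑ n, g n m ≫ (f l n ▷ Y) ≫ (α_ (L l) X Y).hom
    simp [Finset.smul_sum]

lemma mul_single {X Y : C} {l m n : V} (e : L n ⟶ L l ⊗ X) (g : L m ⟶ L n ⊗ Y) :
    mul (K := K) X Y (tmul _ _ (single K L l n e) (single K L n m g)) =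
      single K L l m (g ≫ e ▷ Y ≫ (α_ (L l) X Y).hom) := by
  ext l' m'
  rw [mul_tmul, Finset.sum_eq_single n]
  · rcases eq_or_ne l' l with rfl | h
    · rcases eq_or_ne m' m with rfl | h'
      · simp [single_apply]
      · simp [single_apply, h']
    · simp [single_apply, h]
  · intro n' _ h
    simp [single_apply, h]
  · simp

/-- The inverse of the tensorator `φ₂` of `Ω₀`. -/
def mulInv (hL : IsSplitFiniteSemisimple K L) (X Y : C) : (∀ l m : V, L m ⟶ L l ⊗ (X ⊗ Y)) →ₗ[K]
    Tensor (omega0Str K L X) (omega0Str K L Y) :=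
  -- A morphism `h : L m ⟶ L l ⊗ (X ⊗ Y)` is reassociated and split along a resolution of `L l ⊗ X`.
  -- The inclusion `ι i` becomes the element of `Ω₀(X)`, and the composite of `h` with `π i ▷ Y` the
  -- element of `Ω₀(Y)`.
  ∑ l : V, ∑ m : V, (∑ i, tmul (omega0Str K L X) (omega0Str K L Y)
      (single K L l _ ((hL.resolution (L l ⊗ X)).ι i)) ∘ₗ single K L _ m ∘ₗ
    Linear.rightComp K (L m) ((α_ (L l) X Y).inv ≫ (hL.resolution (L l ⊗ X)).π i ▷ Y)) ∘ₗ
      LinearMap.proj (φ := fun m => L m ⟶ L l ⊗ (X ⊗ Y)) m ∘ₗ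
      LinearMap.proj (φ := fun l => ∀ m, L m ⟶ L l ⊗ (X ⊗ Y)) l

lemma mulInv_single (hL : IsSplitFiniteSemisimple K L) {X Y : C} (l m : V)
    (h : L m ⟶ L l ⊗ (X ⊗ Y)) :
    mulInv hL X Y (single K L l m h) = ∑ i, tmul (omega0Str K L X) (omega0Str K L Y)
      (single K L l _ ((hL.resolution (L l ⊗ X)).ι i))
      (single K L _ m (h ≫ (α_ (L l) X Y).inv ≫ (hL.resolution (L l ⊗ X)).π i ▷ Y)) := by
  rw [mulInv, LinearMap.sum_apply, Finset.sum_eq_single l, LinearMap.sum_apply,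
    Finset.sum_eq_single m]
  · simp [single_apply]
  · intro m' _ hm
    simp [single_apply, hm]
  · simp
  · intro l' _ hl
    simp [single_apply, hl]
  · simp

/-- By `tmul_single_comp` the morphism `e ≫ π i` crosses the tensor sign and meets `ι i`, after
which the completeness relation for `L l ⊗ X` sums to `e`. -/
lemma mulInv_mul (hL : IsSplitFiniteSemisimple K L) (X Y : C) :
    mulInv hL X Y ∘ₗ mul X Y = LinearMap.id := by
  refine tensor_ext fun l n m e g => ?_
  rw [LinearMap.comp_apply, mul_single, mulInv_single]
  simp only [Category.assoc, Iso.hom_inv_id_assoc, ← comp_whiskerRight]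
  simp only [tmul_single_comp hL]
  simp only [← LinearMap.sum_apply, ← map_sum, Category.assoc, ← Preadditive.comp_sum,
    (hL.resolution (L l ⊗ X)).total, Category.comp_id, LinearMap.id_apply]

/-- The completeness relation for `L l ⊗ X`, whiskered by `Y`. -/
lemma mul_mulInv (hL : IsSplitFiniteSemisimple K L) (X Y : C) :
    mul X Y ∘ₗ mulInv hL X Y = LinearMap.id := by
  refine LinearMap.ext fun f => ?_
  rw [← sum_single_eq (K := K) f]
  simp only [map_sum]
  refine Finset.sum_congr rfl fun l _ => Finset.sum_congr rfl fun m _ => ?_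
  rw [LinearMap.comp_apply, mulInv_single, map_sum]
  simp only [mul_single, LinearMap.id_apply]
  rw [← map_sum]
  congr 1
  simp only [Category.assoc, ← Preadditive.comp_sum]
  have h : ∑ i, (hL.resolution (L l ⊗ X)).π i ▷ Y ≫ (hL.resolution (L l ⊗ X)).ι i ▷ Y ≫
      (α_ (L l) X Y).hom = (α_ (L l) X Y).hom := by
    simp only [← comp_whiskerRight_assoc, ← Preadditive.sum_comp, ← sum_whiskerRight,
      (hL.resolution (L l ⊗ X)).total, id_whiskerRight, Category.id_comp]
  rw [h]
  simp

/-- The unit `φ₀` of `Ω₀`, as a linear map. -/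
def one (K : Type v) [Field K] [Linear K C] (L : V → C) : (V → K) →ₗ[K] (∀ l m : V, L m ⟶ L l ⊗ 𝟙_ C) :=
  ∑ l : V, single K L l l ∘ₗ LinearMap.toSpanSingleton K _ (ρ_ (L l)).inv ∘ₗ
    LinearMap.proj l

lemma one_apply (a : V → K) (l : V) :
    one K L a l = Pi.single l (a l • (ρ_ (L l)).inv) := by
  rw [one, LinearMap.sum_apply, Finset.sum_apply, Finset.sum_eq_single l]
  · simp [single_apply, ← Pi.single_smul]
  · intro l' _ h
    simp [single_apply, h.symm]
  · simp

lemma one_same (a : V → K) (l : V) : one K L a l l = a l • (ρ_ (L l)).inv := by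
  rw [one_apply, Pi.single_eq_same]

lemma one_of_ne (a : V → K) {l m : V} (h : l ≠ m) : one K L a l m = 0 := by
  rw [one_apply, Pi.single_eq_of_ne h.symm]

/-- The inverse of the unit `φ₀` of `Ω₀`. -/
def oneInv (hL : IsSplitFiniteSemisimple K L) :
    (∀ l m : V, L m ⟶ L l ⊗ 𝟙_ C) →ₗ[K] (V → K) :=
  LinearMap.pi fun l => (LinearEquiv.ofBijective
    (LinearMap.toSpanSingleton K (L l ⟶ L l) (𝟙 (L l))) (hL.end_bijective l)).symm.toLinearMap ∘ₗ
      Linear.rightComp K (L l) (ρ_ (L l)).hom ∘ₗ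
      LinearMap.proj (φ := fun m => L m ⟶ L l ⊗ 𝟙_ C) l ∘ₗ
      LinearMap.proj (φ := fun l => ∀ m, L m ⟶ L l ⊗ 𝟙_ C) l

lemma oneInv_smul (hL : IsSplitFiniteSemisimple K L) (f : ∀ l m : V, L m ⟶ L l ⊗ 𝟙_ C) (l : V) :
    oneInv hL f l • 𝟙 (L l) = f l l ≫ (ρ_ (L l)).hom :=
  LinearEquiv.apply_symm_apply (LinearEquiv.ofBijective
    (LinearMap.toSpanSingleton K (L l ⟶ L l) (𝟙 (L l))) (hL.end_bijective l)) _

/-- Composition with `ρ_ (L l)` identifies the entries with morphisms `L m ⟶ L l`. Schur's lemma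
makes the diagonal ones scalars and the others zero. -/
lemma one_oneInv (hL : IsSplitFiniteSemisimple K L) : one K L ∘ₗ oneInv hL = LinearMap.id := by
  refine LinearMap.ext fun f => funext fun l => funext fun m => ?_
  rcases eq_or_ne l m with rfl | h
  · have h1 := oneInv_smul hL f l
    rw [LinearMap.comp_apply, one_same, ← Category.id_comp (ρ_ (L l)).inv, ← Linear.smul_comp, h1]
    simp
  · rw [LinearMap.comp_apply, one_of_ne _ h, LinearMap.id_apply, ← cancel_mono (ρ_ (L l)).hom,
      zero_comp, hL.hom_eq_zero _ _ h.symm (f l m ≫ (ρ_ (L l)).hom)]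

lemma oneInv_one (hL : IsSplitFiniteSemisimple K L) : oneInv hL ∘ₗ one K L = LinearMap.id := by
  refine LinearMap.ext fun a => funext fun l => (hL.end_bijective l).1 ?_
  change oneInv hL (one K L a) l • 𝟙 (L l) = a l • 𝟙 (L l)
  rw [oneInv_smul, one_same]
  simp

/-- The strong monoidal structure `φ₂`, `φ₀` of `Ω₀`. -/
def coreMonoidal (hL : IsSplitFiniteSemisimple K L) : (Omega0 L hL).CoreMonoidal where
  εIso := Bmd.isoOfLin (M := MonoidalCategoryStruct.tensorUnit (Bmd K (V → K)))
    (N := (Omega0 L hL).obj (𝟙_ C)) (one K L) (oneInv hL) (oneInv_one hL) (one_oneInv hL)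
    (fun a (x : V → K) => by
      refine funext fun l => funext fun m => ?_
      change one K L (a * x) l m = a l • one K L x l m
      rcases eq_or_ne l m with rfl | h
      · rw [one_same, one_same, Pi.mul_apply, mul_smul]
      · simp [one_of_ne _ h])
    (fun a (x : V → K) => by
      refine funext fun l => funext fun m => ?_
      change one K L (x * a.unop) l m = a.unop m • one K L x l m
      rcases eq_or_ne l m with rfl | h
      · rw [one_same, one_same, Pi.mul_apply, mul_comm, mul_smul]
      · simp [one_of_ne _ h])
  μIso X Y := Bmd.isoOfLin
    (M := MonoidalCategoryStruct.tensorObj ((Omega0 L hL).obj X) ((Omega0 L hL).obj Y))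
    (N := (Omega0 L hL).obj (X ⊗ Y)) (mul X Y) (mulInv hL X Y) (mulInv_mul hL X Y)
    (mul_mulInv hL X Y)
    (mul_left X Y) (mul_right X Y)
  μIso_hom_natural_left {X X'} f Y := Bmd.hom_ext <| Tensor.ext fun x y =>
    funext fun l => funext fun m => by
      change ∑ n, y n m ≫ ((x l n ≫ L l ◁ f) ▷ Y) ≫ (α_ (L l) X' Y).hom =
        (∑ n, y n m ≫ (x l n ▷ Y) ≫ (α_ (L l) X Y).hom) ≫ L l ◁ (f ▷ Y)
      simp [Preadditive.sum_comp]
  μIso_hom_natural_right {Y Y'} X f := Bmd.hom_ext <| Tensor.ext fun x y =>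
    funext fun l => funext fun m => by
      change ∑ n, (y n m ≫ L n ◁ f) ≫ (x l n ▷ Y') ≫ (α_ (L l) X Y').hom =
        (∑ n, y n m ≫ (x l n ▷ Y) ≫ (α_ (L l) X Y).hom) ≫ L l ◁ (X ◁ f)
      simp [Preadditive.sum_comp, whisker_exchange_assoc]
  associativity X Y Z := Bmd.hom_ext <| Tensor.ext₃ fun x y z =>
    funext fun l => funext fun m => by
      change (∑ n, z n m ≫ ((∑ p, y p n ≫ (x l p ▷ Y) ≫ (α_ (L l) X Y).hom) ▷ Z) ≫
          (α_ (L l) (X ⊗ Y) Z).hom) ≫ L l ◁ (α_ X Y Z).hom =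
        ∑ p, (∑ n, z n m ≫ (y p n ▷ Z) ≫ (α_ (L p) Y Z).hom) ≫ (x l p ▷ (Y ⊗ Z)) ≫
          (α_ (L l) X (Y ⊗ Z)).hom
      simp only [sum_whiskerRight, Preadditive.sum_comp, Preadditive.comp_sum]
      rw [Finset.sum_comm]
      -- The double sums over the two intermediate simple objects agree term by term, by the
      -- pentagon identity for `L l, X, Y, Z`.
      simp [pentagon]
  left_unitality X := Bmd.hom_ext <| Tensor.ext fun (a : V → K) x =>
    funext fun l => funext fun m => by
      change a l • x l m = (∑ n, x n m ≫ (one K L a l n ▷ X) ≫ (α_ (L l) (𝟙_ C) X).hom) ≫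
        L l ◁ (λ_ X).hom
      rw [Finset.sum_eq_single l]
      · simp [one_same, MonoidalLinear.smul_whiskerRight]
      · intro n _ h
        simp [one_of_ne a h.symm]
      · simp
  right_unitality X := Bmd.hom_ext <| Tensor.ext fun x (a : V → K) =>
    funext fun l => funext fun m => by
      change a m • x l m = (∑ n, one K L a n m ≫ (x l n ▷ 𝟙_ C) ≫ (α_ (L l) X (𝟙_ C)).hom) ≫
        L l ◁ (ρ_ X).hom
      rw [Finset.sum_eq_single m]
      · simp [one_same]
      · intro n _ h
        simp [one_of_ne a h]
      · simp

instance (hL : IsSplitFiniteSemisimple K L) : (Omega0 L hL).Additive where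
  map_add {X Y f g} := Bmd.hom_ext <| LinearMap.ext fun k => funext fun l => funext fun m => by
    change k l m ≫ L l ◁ (f + g) = k l m ≫ L l ◁ f + k l m ≫ L l ◁ g
    simp

instance (hL : IsSplitFiniteSemisimple K L) : (Omega0 L hL).Linear K where
  map_smul {X Y} f r := Bmd.hom_ext <| LinearMap.ext fun k => funext fun l => funext fun m => by
    change k l m ≫ L l ◁ (r • f) = r • (k l m ≫ L l ◁ f)
    simp

/-- If `Ω₀` identifies `f` and `g`, then `L l ◁ (f - g) = 0` for every `l`. The unit object is
itself resolved by the `L l`, so `𝟙_ C ◁ (f - g) = 0`, and the left unit constraint removes the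
unit. -/
lemma faithful (hL : IsSplitFiniteSemisimple K L) : (Omega0 L hL).Faithful where
  map_injective {X Y f g} hfg := by
    have h1 : ∀ l, L l ◁ (f - g) = 0 := fun l => hL.eq_zero_of_comp fun m k => by
      have h := congrFun (congrFun (LinearMap.congr_fun (congrArg Bmd.lin hfg) (single K L l m k)) l) m
      change single K L l m k l m ≫ L l ◁ f = single K L l m k l m ≫ L l ◁ g at h
      rw [show L l ◁ (f - g) = L l ◁ f - L l ◁ g from (tensorLeft (L l)).map_sub, Preadditive.comp_sub,
        sub_eq_zero]
      simpa [single_apply] using h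
    have h2 : 𝟙_ C ◁ (f - g) = 0 := by
      rw [← Category.id_comp (𝟙_ C ◁ (f - g)), ← id_whiskerRight,
        ← (hL.resolution (𝟙_ C)).total, sum_whiskerRight, Preadditive.sum_comp]
      refine Finset.sum_eq_zero fun i _ => ?_
      -- The interchange law moves `f - g` past `ι i`, to where it is whiskered by a simple object
      -- and vanishes.
      rw [comp_whiskerRight, Category.assoc, ← whisker_exchange, h1]
      simp
    rw [← sub_eq_zero]
    simpa using (λ_ X).inv ≫= h2 =≫ (λ_ Y).hom

end

end Omega0

/-- Since `M` is finite-dimensional, `N ⊗ M^*` is the space of linear maps `M → N`. Two sums of pure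
tensors that represent the same operator are therefore equal, and have the same image under any
bilinear map. All identities involving a choice of dual bases are deduced from this. -/
lemma Module.Basis.sum_eq_of_rank_one {K M N P ι κ : Type*} [Field K]
    [AddCommGroup M] [Module K M] [FiniteDimensional K M] [AddCommGroup N] [Module K N]
    [AddCommGroup P] [Module K P] [Fintype ι] [Fintype κ]
    (B : N →ₗ[K] Module.Dual K M →ₗ[K] P) (u : ι → N) (ξ : ι → Module.Dual K M)
    (w : κ → N) (ζ : κ → Module.Dual K M)
    (h : ∀ z, ∑ i, ξ i z • u i = ∑ j, ζ j z • w j) :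
    ∑ i, B (u i) (ξ i) = ∑ j, B (w j) (ζ j) := by
  let b := Module.finBasis K M
  have key : ∀ (x : N) (η : Module.Dual K M), B x η = ∑ k, B (η (b k) • x) (b.coord k) := by
    intro x η
    conv_lhs => rw [← b.sum_dual_apply_smul_coord η]
    simp only [map_sum, map_smul, LinearMap.smul_apply]
  simp only [key (u _), key (w _)]
  rw [Finset.sum_comm, Finset.sum_comm (s := (Finset.univ : Finset κ))]
  refine Finset.sum_congr rfl fun k _ => ?_
  simp only [← LinearMap.sum_apply, ← map_sum, h]

/-! ### The coend as a vector space -/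

namespace Tannaka

section

variable {K V : Type v} [Field K] [Fintype V] [DecidableEq V]
  {C : Type u} [Category.{v} C] [Preadditive C] [Linear K C] {L : V → C}

/-- The vector space underlying the coend of `Ω^* ⊗ Ω`. -/
def Coend (Ω : C ⥤ Bmd K (V → K)) (_hL : IsSplitFiniteSemisimple K L) : Type v :=
  ∀ l : V, Module.Dual K (Ω.obj (L l)).carrier ⊗[K] (Ω.obj (L l)).carrier

variable (Ω : C ⥤ Bmd K (V → K)) (hL : IsSplitFiniteSemisimple K L)

instance : AddCommGroup (Coend Ω hL) :=
  inferInstanceAs (AddCommGroup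
    (∀ l : V, Module.Dual K (Ω.obj (L l)).carrier ⊗[K] (Ω.obj (L l)).carrier))

instance : Module K (Coend Ω hL) :=
  inferInstanceAs (Module K
    (∀ l : V, Module.Dual K (Ω.obj (L l)).carrier ⊗[K] (Ω.obj (L l)).carrier))

/-- The summand of the coend given by `L l`. -/
def single (l : V) : Module.Dual K (Ω.obj (L l)).carrier ⊗[K] (Ω.obj (L l)).carrier →ₗ[K]
    Coend Ω hL :=
  LinearMap.single K
    (fun l => Module.Dual K (Ω.obj (L l)).carrier ⊗[K] (Ω.obj (L l)).carrier) l

/-- The projection of the coend to the summand given by `L l`. -/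
def proj (l : V) : Coend Ω hL →ₗ[K]
    Module.Dual K (Ω.obj (L l)).carrier ⊗[K] (Ω.obj (L l)).carrier :=
  LinearMap.proj
    (φ := fun l => Module.Dual K (Ω.obj (L l)).carrier ⊗[K] (Ω.obj (L l)).carrier) l

lemma proj_single_same (l : V)
    (t : Module.Dual K (Ω.obj (L l)).carrier ⊗[K] (Ω.obj (L l)).carrier) :
    proj Ω hL l (single Ω hL l t) = t := Pi.single_eq_same _ _

lemma proj_single_of_ne {l m : V} (h : m ≠ l)
    (t : Module.Dual K (Ω.obj (L l)).carrier ⊗[K] (Ω.obj (L l)).carrier) :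
    proj Ω hL m (single Ω hL l t) = 0 := Pi.single_eq_of_ne h _

lemma sum_single_proj (h : Coend Ω hL) : ∑ l, single Ω hL l (proj Ω hL l h) = h :=
  Finset.univ_sum_single (M := fun l =>
    Module.Dual K (Ω.obj (L l)).carrier ⊗[K] (Ω.obj (L l)).carrier) h

/-- The universal dinatural map `κ_X`. -/
def kap (X : C) : Module.Dual K (Ω.obj X).carrier ⊗[K] (Ω.obj X).carrier →ₗ[K] Coend Ω hL :=
  ∑ i, single Ω hL _ ∘ₗ TensorProduct.map
    (Bmd.lin (Ω.map ((hL.resolution X).ι i))).dualMap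
    (Bmd.lin (Ω.map ((hL.resolution X).π i)))

lemma kap_tmul (X : C) (φ : Module.Dual K (Ω.obj X).carrier) (x : (Ω.obj X).carrier) :
    kap Ω hL X (φ ⊗ₜ x) = ∑ i, single Ω hL _
      ((φ ∘ₗ Bmd.lin (Ω.map ((hL.resolution X).ι i))) ⊗ₜ
        Bmd.lin (Ω.map ((hL.resolution X).π i)) x) := by
  simp [kap, LinearMap.sum_apply]
  rfl

/-- Dinaturality of a family of maps `Ω(X)^* ⊗ Ω(X) → P`. -/
def IsDinatural {P : Type*} [AddCommGroup P] [Module K P]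
    (ι : ∀ X : C, Module.Dual K (Ω.obj X).carrier ⊗[K] (Ω.obj X).carrier →ₗ[K] P) : Prop :=
  ∀ {X Y : C} (f : X ⟶ Y) (φ : Module.Dual K (Ω.obj Y).carrier) (x : (Ω.obj X).carrier),
    ι Y (φ ⊗ₜ Bmd.lin (Ω.map f) x) = ι X ((φ ∘ₗ Bmd.lin (Ω.map f)) ⊗ₜ x)

/-- The map out of the coend given by a dinatural family. -/
def desc {P : Type*} [AddCommGroup P] [Module K P]
    (ι : ∀ X : C, Module.Dual K (Ω.obj X).carrier ⊗[K] (Ω.obj X).carrier →ₗ[K] P) :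
    Coend Ω hL →ₗ[K] P :=
  ∑ l, ι (L l) ∘ₗ proj Ω hL l

lemma desc_single {P : Type*} [AddCommGroup P] [Module K P]
    (ι : ∀ X : C, Module.Dual K (Ω.obj X).carrier ⊗[K] (Ω.obj X).carrier →ₗ[K] P) (l : V)
    (t : Module.Dual K (Ω.obj (L l)).carrier ⊗[K] (Ω.obj (L l)).carrier) :
    desc Ω hL ι (single Ω hL l t) = ι (L l) t := by
  rw [desc, LinearMap.sum_apply, Finset.sum_eq_single l]
  · rw [LinearMap.comp_apply, proj_single_same]
  · intro m _ h
    rw [LinearMap.comp_apply, proj_single_of_ne _ _ h, map_zero]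
  · simp

variable [Ω.Additive]

lemma sum_lin_map_comp {ι : Type*} [Fintype ι] {X Y : C} {Z : ι → C} (f : ∀ i, X ⟶ Z i)
    (g : ∀ i, Z i ⟶ Y) : ∑ i, Bmd.lin (Ω.map (g i)) ∘ₗ Bmd.lin (Ω.map (f i)) =
      Bmd.lin (Ω.map (∑ i, f i ≫ g i)) := by
  let T : ((Ω.obj X ⟶ Ω.obj Y)) →+ ((Ω.obj X).carrier →ₗ[K] (Ω.obj Y).carrier) :=
    ⟨⟨Bmd.lin, rfl⟩, fun _ _ => rfl⟩
  change _ = T _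
  rw [Functor.map_sum, map_sum]
  refine Finset.sum_congr rfl fun i _ => ?_
  rw [Functor.map_comp]
  rfl

lemma sum_lin_resolution {X : C} (r : IsSplitFiniteSemisimple.Resolution L X) :
    ∑ i, Bmd.lin (Ω.map (r.ι i)) ∘ₗ Bmd.lin (Ω.map (r.π i)) = LinearMap.id := by
  rw [sum_lin_map_comp, r.total, CategoryTheory.Functor.map_id]
  rfl

/-- Dinaturality along `ι i` moves each summand from a simple object back to `X`, where the
completeness relation under `Ω` reassembles `x`. A dinatural family is thus determined by its
components at the simple objects. -/
lemma desc_kap {P : Type*} [AddCommGroup P] [Module K P]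
    {ι : ∀ X : C, Module.Dual K (Ω.obj X).carrier ⊗[K] (Ω.obj X).carrier →ₗ[K] P}
    (hι : IsDinatural Ω ι) (X : C)
    (t : Module.Dual K (Ω.obj X).carrier ⊗[K] (Ω.obj X).carrier) :
    desc Ω hL ι (kap Ω hL X t) = ι X t := by
  induction t using TensorProduct.induction_on with
  | zero => simp
  | add a b ha hb => simp only [map_add, ha, hb]
  | tmul φ x =>
    rw [kap_tmul, map_sum]
    refine (Finset.sum_congr rfl fun i _ =>
      (desc_single Ω hL ι _ _).trans (hι ((hL.resolution X).ι i) φ _).symm).trans ?_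
    rw [← map_sum, ← TensorProduct.tmul_sum]
    congr 2
    have h := LinearMap.congr_fun (sum_lin_resolution Ω (hL.resolution X)) x
    simpa [LinearMap.sum_apply] using h

variable [Ω.Linear K]

/-- By Schur's lemma only zero and scalar morphisms occur, and scalars pass through the tensor
product over `K`. -/
lemma single_dinatural {l m : V} (g : L l ⟶ L m) (φ : Module.Dual K (Ω.obj (L m)).carrier)
    (x : (Ω.obj (L l)).carrier) :
    single Ω hL m (φ ⊗ₜ Bmd.lin (Ω.map g) x) =
      single Ω hL l ((φ ∘ₗ Bmd.lin (Ω.map g)) ⊗ₜ x) := by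
  refine hL.hom_induction (p := fun l m g => ∀ (φ : Module.Dual K (Ω.obj (L m)).carrier)
    (x : (Ω.obj (L l)).carrier), single Ω hL m (φ ⊗ₜ Bmd.lin (Ω.map g) x) =
      single Ω hL l ((φ ∘ₗ Bmd.lin (Ω.map g)) ⊗ₜ x)) (fun l m h φ x => ?_)
    (fun l c φ x => ?_) g φ x
  · rw [Functor.map_zero]
    change single Ω hL m (φ ⊗ₜ 0) = single Ω hL l ((φ ∘ₗ (0 : _ →ₗ[K] _)) ⊗ₜ x)
    simp
  · rw [Functor.map_smul, CategoryTheory.Functor.map_id]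
    change single Ω hL l (φ ⊗ₜ (c • x)) = single Ω hL l ((φ ∘ₗ (c • LinearMap.id)) ⊗ₜ x)
    rw [LinearMap.comp_smul, TensorProduct.smul_tmul]
    rfl

/-- Resolving both `X` and `Y` turns `f` into a matrix of morphisms between simple objects, to which
`single_dinatural` applies entry by entry. With `f` an identity, the same argument explains why the
chosen resolutions do not matter. -/
lemma kap_dinatural : IsDinatural Ω (kap Ω hL) := by
  intro X Y f φ x
  let r := hL.resolution X
  let r' := hL.resolution Y
  have key : ∀ i j, single Ω hL _ ((φ ∘ₗ Bmd.lin (Ω.map (r'.ι j))) ⊗ₜ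
      Bmd.lin (Ω.map (r'.π j)) (Bmd.lin (Ω.map f) (Bmd.lin (Ω.map (r.ι i))
        (Bmd.lin (Ω.map (r.π i)) x)))) =
      single Ω hL _ ((φ ∘ₗ Bmd.lin (Ω.map (r'.ι j)) ∘ₗ Bmd.lin (Ω.map (r'.π j)) ∘ₗ
        Bmd.lin (Ω.map f) ∘ₗ Bmd.lin (Ω.map (r.ι i))) ⊗ₜ Bmd.lin (Ω.map (r.π i)) x) := by
    intro i j
    have h := single_dinatural Ω hL (r.ι i ≫ f ≫ r'.π j) (φ ∘ₗ Bmd.lin (Ω.map (r'.ι j)))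
      (Bmd.lin (Ω.map (r.π i)) x)
    simp only [Functor.map_comp, Bmd.lin_comp] at h
    exact h
  have h1 := LinearMap.congr_fun (sum_lin_resolution Ω r) x
  simp only [LinearMap.sum_apply, LinearMap.comp_apply, LinearMap.id_apply] at h1
  have h2 := sum_lin_resolution Ω r'
  rw [kap_tmul, kap_tmul]
  conv_lhs =>
    rw [← h1]
    simp only [map_sum, TensorProduct.tmul_sum]
  rw [Finset.sum_comm]
  refine Finset.sum_congr rfl fun i _ => ?_
  refine (Finset.sum_congr rfl fun j _ => key i j).trans ?_
  rw [← map_sum, ← TensorProduct.sum_tmul]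
  congr 2
  refine LinearMap.ext fun z => ?_
  have h3 := LinearMap.congr_fun h2 (Bmd.lin (Ω.map f) (Bmd.lin (Ω.map (r.ι i)) z))
  simp only [LinearMap.sum_apply, LinearMap.comp_apply, LinearMap.id_apply] at h3 ⊢
  rw [← map_sum, h3]

/-- The chosen resolution of `L l` need not be the trivial one, so this is not a computation:
`single_dinatural` collects every summand in position `l`. -/
lemma kap_L (l : V) (t : Module.Dual K (Ω.obj (L l)).carrier ⊗[K] (Ω.obj (L l)).carrier) :
    kap Ω hL (L l) t = single Ω hL l t := by
  induction t using TensorProduct.induction_on with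
  | zero => simp
  | add a b ha hb => simp only [map_add, ha, hb]
  | tmul φ x =>
    rw [kap_tmul]
    simp only [single_dinatural]
    rw [← map_sum, ← TensorProduct.sum_tmul]
    congr 2
    refine LinearMap.ext fun z => ?_
    have h3 := LinearMap.congr_fun (sum_lin_resolution Ω (hL.resolution (L l))) z
    simp only [LinearMap.sum_apply, LinearMap.comp_apply, LinearMap.id_apply] at h3 ⊢
    rw [← map_sum, h3]

variable {Ω hL} in
-- Matrix coefficients span the coend, already those of simple objects. Stating the hypothesis for
-- all `X` lets it be checked with formulas such as those for the product, where `X ⊗ Y` is not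
-- simple.
lemma hom_ext {P : Type*} [AddCommGroup P] [Module K P] {F G : Coend Ω hL →ₗ[K] P}
    (h : ∀ (X : C) φ x, F (kap Ω hL X (φ ⊗ₜ x)) = G (kap Ω hL X (φ ⊗ₜ x))) : F = G := by
  refine LinearMap.ext fun z => ?_
  rw [← sum_single_proj Ω hL z, map_sum, map_sum]
  refine Finset.sum_congr rfl fun l _ => ?_
  rw [← kap_L]
  generalize proj Ω hL l z = t
  induction t using TensorProduct.induction_on with
  | zero => simp
  | add a b ha hb => simp only [map_add, ha, hb]
  | tmul φ x => exact h _ _ _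

end

end Tannaka

/-! ### The coalgebra structure and the coactions -/

namespace Tannaka

section

variable {K V : Type v} [Field K] [Fintype V] [DecidableEq V]
  {C : Type u} [Category.{v} C] [Preadditive C] [Linear K C] {L : V → C}
  (Ω : C ⥤ Bmd K (V → K)) (hL : IsSplitFiniteSemisimple K L) [Ω.Additive] [Ω.Linear K]

lemma tannakaCoact_apply {H : Type v} [AddCommGroup H] [Module K H]
    (κ : ∀ X : C, Module.Dual K (Ω.obj X).carrier ⊗[K] (Ω.obj X).carrier →ₗ[K] H) (X : C)
    (x : (Ω.obj X).carrier) :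
    tannakaCoact κ X x = ∑ i, Module.finBasis K (Ω.obj X).carrier i ⊗ₜ[K]
      κ X ((Module.finBasis K (Ω.obj X).carrier).coord i ⊗ₜ x) := by
  simp [tannakaCoact, LinearMap.sum_apply]

/-- The comultiplication on matrix coefficients. -/
def comulFam (X : C) : Module.Dual K (Ω.obj X).carrier ⊗[K] (Ω.obj X).carrier →ₗ[K]
    Coend Ω hL ⊗[K] Coend Ω hL :=
  ∑ i, TensorProduct.map
    (kap Ω hL X ∘ₗ (TensorProduct.mk K _ _).flip (Module.finBasis K (Ω.obj X).carrier i))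
    (kap Ω hL X ∘ₗ TensorProduct.mk K _ _ ((Module.finBasis K (Ω.obj X).carrier).coord i))

lemma comulFam_tmul (X : C) (φ : Module.Dual K (Ω.obj X).carrier) (x : (Ω.obj X).carrier) :
    comulFam Ω hL X (φ ⊗ₜ x) = ∑ i, kap Ω hL X (φ ⊗ₜ Module.finBasis K (Ω.obj X).carrier i) ⊗ₜ[K]
        kap Ω hL X ((Module.finBasis K (Ω.obj X).carrier).coord i ⊗ₜ x) := by
  simp [comulFam, LinearMap.sum_apply]

/-- After `f` is moved inside the two factors by dinaturality of `kap`, both sides come from rank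
one expansions of the operator `Ω(f)`, one through a basis of `Ω(Y)` and one through a basis of
`Ω(X)`. -/
lemma comulFam_dinatural : IsDinatural Ω (comulFam Ω hL) := by
  intro X Y f φ x
  simp only [comulFam_tmul, kap_dinatural Ω hL f _ x]
  simp only [← kap_dinatural Ω hL f φ _]
  refine Module.Basis.sum_eq_of_rank_one ((TensorProduct.mk K _ _).compl₁₂
    (TensorProduct.curry (kap Ω hL Y) φ) ((TensorProduct.curry (kap Ω hL X)).flip x))
    _ _ _ _ fun z => ?_
  have h1 := (Module.finBasis K (Ω.obj X).carrier).sum_repr z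
  have h2 := (Module.finBasis K (Ω.obj Y).carrier).sum_repr (Bmd.lin (Ω.map f) z)
  simp only [LinearMap.comp_apply, Module.Basis.coord_apply]
  rw [h2]
  simp only [← map_smul, ← map_sum, h1]

lemma contractLeft_dinatural : IsDinatural Ω
    (fun X => contractLeft K (Ω.obj X).carrier) := fun _ _ _ => rfl

instance : CoalgebraStruct K (Coend Ω hL) where
  comul := desc Ω hL (comulFam Ω hL)
  counit := desc Ω hL fun X => contractLeft K (Ω.obj X).carrier

lemma comul_kap (X : C) (φ : Module.Dual K (Ω.obj X).carrier) (x : (Ω.obj X).carrier) :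
    Coalgebra.comul (R := K) (kap Ω hL X (φ ⊗ₜ x)) =
      ∑ i, kap Ω hL X (φ ⊗ₜ Module.finBasis K (Ω.obj X).carrier i) ⊗ₜ[K]
        kap Ω hL X ((Module.finBasis K (Ω.obj X).carrier).coord i ⊗ₜ x) :=
  (desc_kap Ω hL (comulFam_dinatural Ω hL) X _).trans (comulFam_tmul Ω hL X φ x)

lemma counit_kap (X : C) (φ : Module.Dual K (Ω.obj X).carrier) (x : (Ω.obj X).carrier) :
    Coalgebra.counit (R := K) (kap Ω hL X (φ ⊗ₜ x)) = φ x :=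
  desc_kap Ω hL (contractLeft_dinatural Ω) X _

-- On matrix coefficients of a fixed `X` the axioms are those of a matrix coalgebra: coassociativity
-- interchanges two sums, and the counit laws expand a functional and a vector in dual bases.
instance : Coalgebra K (Coend Ω hL) where
  coassoc := hom_ext fun X φ x => by
    simp only [LinearMap.comp_apply, LinearEquiv.coe_coe, comul_kap, map_sum,
      LinearMap.rTensor_tmul, LinearMap.lTensor_tmul, TensorProduct.sum_tmul,
      TensorProduct.tmul_sum, TensorProduct.assoc_tmul]
    exact Finset.sum_comm
  rTensor_counit_comp_comul := hom_ext fun X φ x => by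
    simp only [LinearMap.comp_apply, comul_kap, map_sum, LinearMap.rTensor_tmul, counit_kap,
      TensorProduct.mk_apply]
    conv_rhs => rw [← (Module.finBasis K (Ω.obj X).carrier).sum_dual_apply_smul_coord φ,
      TensorProduct.sum_tmul, map_sum, TensorProduct.tmul_sum]
    refine Finset.sum_congr rfl fun i _ => ?_
    rw [← TensorProduct.smul_tmul', map_smul, TensorProduct.tmul_smul, TensorProduct.smul_tmul',
      smul_eq_mul, mul_one]
  lTensor_counit_comp_comul := hom_ext fun X φ x => by
    simp only [LinearMap.comp_apply, comul_kap, map_sum, LinearMap.lTensor_tmul, counit_kap,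
      LinearMap.flip_apply, TensorProduct.mk_apply]
    conv_rhs => rw [← (Module.finBasis K (Ω.obj X).carrier).sum_repr x,
      TensorProduct.tmul_sum, map_sum, TensorProduct.sum_tmul]
    refine Finset.sum_congr rfl fun i _ => ?_
    rw [TensorProduct.tmul_smul, map_smul, ← TensorProduct.smul_tmul', ← TensorProduct.tmul_smul,
      smul_eq_mul, mul_one, Module.Basis.coord_apply]

lemma kap_coassoc (X : C) :
    (TensorProduct.assoc K _ _ _).toLinearMap ∘ₗ (tannakaCoact (kap Ω hL) X).rTensor _ ∘ₗ
        tannakaCoact (kap Ω hL) X =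
      (Coalgebra.comul (R := K) (A := Coend Ω hL)).lTensor _ ∘ₗ tannakaCoact (kap Ω hL) X := by
  refine LinearMap.ext fun x => ?_
  simp only [LinearMap.comp_apply, LinearEquiv.coe_coe, comul_kap, map_sum, tannakaCoact_apply,
      LinearMap.rTensor_tmul, LinearMap.lTensor_tmul, TensorProduct.sum_tmul,
      TensorProduct.tmul_sum, TensorProduct.assoc_tmul]
  exact Finset.sum_comm

lemma kap_counit (X : C) :
    (TensorProduct.rid K _).toLinearMap ∘ₗ
      (Coalgebra.counit (R := K) (A := Coend Ω hL)).lTensor _ ∘ₗ tannakaCoact (kap Ω hL) X =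
      LinearMap.id := by
  refine LinearMap.ext fun x => ?_
  simp [tannakaCoact_apply, counit_kap]

/-- Both sides arise from rank one expansions of `Ω(f)`, so every `Ω(f)` is a comodule map. -/
lemma tannakaCoact_map {X Y : C} (f : X ⟶ Y) (x : (Ω.obj X).carrier) :
    tannakaCoact (kap Ω hL) Y (Bmd.lin (Ω.map f) x) =
      (Bmd.lin (Ω.map f)).rTensor _ (tannakaCoact (kap Ω hL) X x) := by
  simp only [tannakaCoact_apply, map_sum, LinearMap.rTensor_tmul, kap_dinatural Ω hL f _ x]
  refine Module.Basis.sum_eq_of_rank_one ((TensorProduct.mk K (Ω.obj Y).carrier (Coend Ω hL)).compl₁₂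
    LinearMap.id ((TensorProduct.curry (kap Ω hL X)).flip x))
    (Module.finBasis K (Ω.obj Y).carrier) _
    (fun i => Bmd.lin (Ω.map f) (Module.finBasis K (Ω.obj X).carrier i)) _ fun z => ?_
  have h1 := (Module.finBasis K (Ω.obj X).carrier).sum_repr z
  have h2 := (Module.finBasis K (Ω.obj Y).carrier).sum_repr (Bmd.lin (Ω.map f) z)
  simp only [LinearMap.comp_apply, Module.Basis.coord_apply]
  rw [h2]
  simp only [← map_smul, ← map_sum, h1]

end

end Tannaka

/-! ### Functionals on a tensor product over `R` -/

namespace BimoduleStr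

section

variable {K V M N : Type*} [Field K] [Fintype V] [DecidableEq V]
  [AddCommGroup M] [Module K M] [AddCommGroup N] [Module K N]

lemma mul_single_one (a : V → K) (n : V) : a * Pi.single n 1 = a n • Pi.single n 1 := by
  ext m
  rcases eq_or_ne m n with rfl | h
  · simp
  · simp [h]

lemma eq_sum_smul_single (a : V → K) : a = ∑ n, a n • (Pi.single n 1 : V → K) := by
  simp only [← mul_single_one, ← Finset.mul_sum, FaceAlgebra.sum_single, mul_one]

lemma left_eq_sum (s : BimoduleStr K (V → K) M) (a : V → K) (x : M) :
    s.left a x = ∑ n, a n • s.left (Pi.single n 1) x := by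
  conv_lhs => rw [eq_sum_smul_single a]
  simp

lemma right_eq_sum (s : BimoduleStr K (V → K) M) (a : V → K) (x : M) :
    s.right (.op a) x = ∑ n, a n • s.right (.op (Pi.single n 1)) x := by
  conv_lhs => rw [eq_sum_smul_single a]
  rw [show MulOpposite.op (∑ n, a n • (Pi.single n 1 : V → K)) =
    ∑ n, a n • MulOpposite.op (Pi.single n 1 : V → K) from
      map_sum (MulOpposite.opLinearEquiv K) _ _]
  simp

lemma left_single_left (s : BimoduleStr K (V → K) M) (a : V → K) (n : V) (x : M) :
    s.left (Pi.single n 1) (s.left a x) = a n • s.left (Pi.single n 1) x := by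
  rw [← Module.End.mul_apply, ← map_mul, mul_comm, mul_single_one, map_smul, LinearMap.smul_apply]

lemma right_single_right (s : BimoduleStr K (V → K) M) (a : V → K) (n : V) (x : M) :
    s.right (.op (Pi.single n 1)) (s.right (.op a) x) =
      a n • s.right (.op (Pi.single n 1)) x := by
  rw [← Module.End.mul_apply, ← map_mul, ← MulOpposite.op_mul, mul_single_one,
    MulOpposite.op_smul, map_smul, LinearMap.smul_apply]

/-- The functional `m ⊗ n ↦ ∑ ν, φ(m ν) ψ(ν n)` on `M ⊗_R N`. -/
def dualTensor (s : BimoduleStr K (V → K) M) (t : BimoduleStr K (V → K) N) :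
    Module.Dual K M →ₗ[K] Module.Dual K N →ₗ[K] Module.Dual K (Tensor s t) :=
  LinearMap.mk₂ K (fun φ ψ => lift s t
    -- The plain product of `φ` and `ψ` is not balanced over `R`. Inserting the idempotents means
    -- composing it with the section of `M ⊗ N → M ⊗_R N` that sends `m ⊗ n` to the sum of the `m ν
    -- ⊗ ν n`.
    (∑ n : V, (LinearMap.mul K K).compl₁₂ (φ ∘ₗ s.right (.op (Pi.single n 1)))
      (ψ ∘ₗ t.left (Pi.single n 1)))
    (fun m a n => by
      simp only [LinearMap.sum_apply, LinearMap.compl₁₂_apply, LinearMap.comp_apply,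
        right_single_right, left_single_left]
      simp [mul_assoc, mul_left_comm]))
    (fun φ φ' ψ => Tensor.ext fun m n => by
      simp [LinearMap.sum_apply, Finset.sum_add_distrib])
    (fun c φ ψ => Tensor.ext fun m n => by
      simp [LinearMap.sum_apply, mul_assoc, Finset.mul_sum])
    (fun φ ψ ψ' => Tensor.ext fun m n => by
      simp [LinearMap.sum_apply, mul_add, Finset.sum_add_distrib])
    (fun c φ ψ => Tensor.ext fun m n => by
      simp [LinearMap.sum_apply, mul_left_comm, Finset.mul_sum])

lemma dualTensor_tmul (s : BimoduleStr K (V → K) M) (t : BimoduleStr K (V → K) N)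
    (φ : Module.Dual K M) (ψ : Module.Dual K N) (m : M) (n : N) :
    dualTensor s t φ ψ (tmul s t m n) =
      ∑ k : V, φ (s.right (.op (Pi.single k 1)) m) * ψ (t.left (Pi.single k 1) n) := by
  simp [dualTensor, LinearMap.sum_apply]

end

end BimoduleStr

/-! ### The monoidal structure of `Ω` on vectors and on functionals -/

namespace Tannaka

section

variable {K V : Type v} [Field K] [Fintype V] [DecidableEq V]
  {C : Type u} [Category.{v} C] [MonoidalCategory C] (Ω : C ⥤ Bmd K (V → K)) [Ω.Monoidal]

open Functor.LaxMonoidal Functor.OplaxMonoidal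

/-- The bilinear map `Ω(X) × Ω(Y) → Ω(X ⊗ Y)` given by the tensorator. -/
def ten (X Y : C) : (Ω.obj X).carrier →ₗ[K] (Ω.obj Y).carrier →ₗ[K] (Ω.obj (X ⊗ Y)).carrier :=
  (Bmd.tmk (Ω.obj X) (Ω.obj Y)).compr₂ (Bmd.lin (μ Ω X Y))

/-- The functional on `Ω(X ⊗ Y)` given by functionals on `Ω(X)` and `Ω(Y)`. -/
def dualTen (X Y : C) : Module.Dual K (Ω.obj X).carrier →ₗ[K]
    Module.Dual K (Ω.obj Y).carrier →ₗ[K] Module.Dual K (Ω.obj (X ⊗ Y)).carrier :=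
  (dualTensor (Ω.obj X).str (Ω.obj Y).str).compr₂
    (Bmd.lin (δ Ω X Y) : _ →ₗ[K] Tensor (Ω.obj X).str (Ω.obj Y).str).dualMap

/-- The comultiplicative map `δ` inverts the tensorator. Together with `ten_ext` this formula
determines `dualTen`, and it later becomes the axiom for `ε(ab)`. -/
lemma dualTen_ten {X Y : C} (φ : Module.Dual K (Ω.obj X).carrier)
    (ψ : Module.Dual K (Ω.obj Y).carrier) (x : (Ω.obj X).carrier) (y : (Ω.obj Y).carrier) :
    dualTen Ω X Y φ ψ (ten Ω X Y x y) = ∑ k : V,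
      φ ((Ω.obj X).str.right (.op (Pi.single k 1)) x) *
        ψ ((Ω.obj Y).str.left (Pi.single k 1) y) := by
  have h := LinearMap.congr_fun (congrArg Bmd.lin (Functor.Monoidal.μ_δ Ω X Y))
    (Bmd.tmk (Ω.obj X) (Ω.obj Y) x y)
  refine Eq.trans ?_ (dualTensor_tmul (Ω.obj X).str (Ω.obj Y).str φ ψ x y)
  exact congrArg (dualTensor (Ω.obj X).str (Ω.obj Y).str φ ψ) h

variable {Ω} in
-- As the tensorator is invertible, the products `ten Ω X Y x y` span `Ω(X ⊗ Y)`.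
lemma ten_ext {X Y : C} {P : Type*} [AddCommGroup P] [Module K P]
    {F G : (Ω.obj (X ⊗ Y)).carrier →ₗ[K] P}
    (h : ∀ x y, F (ten Ω X Y x y) = G (ten Ω X Y x y)) : F = G := by
  have h1 : F ∘ₗ Bmd.lin (μ Ω X Y) = G ∘ₗ Bmd.lin (μ Ω X Y) := Tensor.ext h
  refine LinearMap.ext fun z => ?_
  have h2 := LinearMap.congr_fun (congrArg Bmd.lin (Functor.Monoidal.δ_μ Ω X Y)) z
  have h3 := LinearMap.congr_fun h1 (Bmd.lin (δ Ω X Y) z)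
  simp only [Bmd.lin_comp, LinearMap.comp_apply, Bmd.lin_id, LinearMap.id_apply] at h2 h3
  rwa [h2] at h3

lemma ten_map_left {X X' : C} (f : X ⟶ X') (Y : C) (x : (Ω.obj X).carrier)
    (y : (Ω.obj Y).carrier) :
    ten Ω X' Y (Bmd.lin (Ω.map f) x) y = Bmd.lin (Ω.map (f ▷ Y)) (ten Ω X Y x y) :=
  LinearMap.congr_fun (congrArg Bmd.lin (μ_natural_left Ω f Y)) (Bmd.tmk _ _ x y)

lemma ten_map_right (X : C) {Y Y' : C} (f : Y ⟶ Y') (x : (Ω.obj X).carrier)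
    (y : (Ω.obj Y).carrier) :
    ten Ω X Y' x (Bmd.lin (Ω.map f) y) = Bmd.lin (Ω.map (X ◁ f)) (ten Ω X Y x y) :=
  LinearMap.congr_fun (congrArg Bmd.lin (μ_natural_right Ω X f)) (Bmd.tmk _ _ x y)

lemma ten_assoc {X Y Z : C} (x : (Ω.obj X).carrier) (y : (Ω.obj Y).carrier)
    (z : (Ω.obj Z).carrier) :
    Bmd.lin (Ω.map (α_ X Y Z).hom) (ten Ω _ _ (ten Ω _ _ x y) z) =
      ten Ω _ _ x (ten Ω _ _ y z) :=
  LinearMap.congr_fun (congrArg Bmd.lin (Functor.LaxMonoidal.associativity Ω X Y Z))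
    (Bmd.tmk (Ω.obj X ⊗ Ω.obj Y) (Ω.obj Z) (Bmd.tmk _ _ x y) z)

lemma ten_left {X Y : C} (a : V → K) (x : (Ω.obj X).carrier) (y : (Ω.obj Y).carrier) :
    (Ω.obj (X ⊗ Y)).str.left a (ten Ω X Y x y) = ten Ω X Y ((Ω.obj X).str.left a x) y :=
  (Bmd.lin_left (μ Ω X Y) a (Bmd.tmk _ _ x y)).symm

lemma ten_right {X Y : C} (a : (V → K)ᵐᵒᵖ) (x : (Ω.obj X).carrier) (y : (Ω.obj Y).carrier) :
    (Ω.obj (X ⊗ Y)).str.right a (ten Ω X Y x y) = ten Ω X Y x ((Ω.obj Y).str.right a y) :=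
  (Bmd.lin_right (μ Ω X Y) a (Bmd.tmk _ _ x y)).symm

lemma ten_balanced {X Y : C} (a : V → K) (x : (Ω.obj X).carrier) (y : (Ω.obj Y).carrier) :
    ten Ω X Y ((Ω.obj X).str.right (.op a) x) y = ten Ω X Y x ((Ω.obj Y).str.left a y) :=
  congrArg (Bmd.lin (μ Ω X Y)) (tmul_balanced _ _ x a y)

/-- The map `R → Ω(I)` given by the unit of `Ω`. -/
def unitElt : (V → K) →ₗ[K] (Ω.obj (𝟙_ C)).carrier := Bmd.lin (ε Ω)

/-- The map `a ↦ (ε(b) ↦ ∑ ν, a ν * b ν)` from `R` to the dual of `Ω(I)`. -/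
def unitDual : (V → K) →ₗ[K] Module.Dual K (Ω.obj (𝟙_ C)).carrier :=
  (Bmd.lin (η Ω) : _ →ₗ[K] (V → K)).dualMap ∘ₗ
    (LinearMap.mul K (V → K)).compr₂ (∑ l : V, LinearMap.proj l)

/-- As `ε` is inverted by `η`, the vectors `unitElt` and the functionals `unitDual` at the
idempotents of `R` form dual bases of `Ω(𝟙_ C)`. -/
lemma unitDual_unitElt (a b : V → K) : unitDual Ω a (unitElt Ω b) = ∑ l, a l * b l := by
  have h := LinearMap.congr_fun (congrArg Bmd.lin (Functor.Monoidal.ε_η Ω)) b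
  refine (congrArg ((LinearMap.mul K (V → K)).compr₂ (∑ l : V, LinearMap.proj l) a) h).trans ?_
  simp [LinearMap.sum_apply]

lemma unitElt_surjective : Function.Surjective (unitElt Ω) := fun z =>
  ⟨Bmd.lin (η Ω) z, LinearMap.congr_fun (congrArg Bmd.lin (Functor.Monoidal.η_ε Ω)) z⟩

lemma left_unitElt (a b : V → K) :
    (Ω.obj (𝟙_ C)).str.left a (unitElt Ω b) = unitElt Ω (a * b) :=
  (Bmd.lin_left (ε Ω) a b).symm

lemma right_unitElt (a b : V → K) :
    (Ω.obj (𝟙_ C)).str.right (.op a) (unitElt Ω b) = unitElt Ω (b * a) :=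
  (Bmd.lin_right (ε Ω) (.op a) b).symm

lemma ten_unitElt_left {X : C} (a : V → K) (x : (Ω.obj X).carrier) :
    Bmd.lin (Ω.map (λ_ X).hom) (ten Ω _ _ (unitElt Ω a) x) = (Ω.obj X).str.left a x :=
  (LinearMap.congr_fun (congrArg Bmd.lin (Functor.LaxMonoidal.left_unitality Ω X))
    (Bmd.tmk (𝟙_ (Bmd K (V → K))) (Ω.obj X) a x)).symm

lemma ten_unitElt_right {X : C} (a : V → K) (x : (Ω.obj X).carrier) :
    Bmd.lin (Ω.map (ρ_ X).hom) (ten Ω _ _ x (unitElt Ω a)) = (Ω.obj X).str.right (.op a) x :=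
  (LinearMap.congr_fun (congrArg Bmd.lin (Functor.LaxMonoidal.right_unitality Ω X))
    (Bmd.tmk (Ω.obj X) (𝟙_ (Bmd K (V → K))) x a)).symm

/-- The left unit constraint, transposed to functionals: a functional on the unit object acts
through `R`. It yields the left `E`-action on matrix coefficients. -/
lemma dualTen_unitDual_left {X : C} (a : V → K) (φ : Module.Dual K (Ω.obj X).carrier) :
    dualTen Ω _ _ (unitDual Ω a) φ =
      (φ ∘ₗ (Ω.obj X).str.left a) ∘ₗ Bmd.lin (Ω.map (λ_ X).hom) := by
  refine ten_ext fun z x => ?_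
  obtain ⟨c, rfl⟩ := unitElt_surjective Ω z
  simp only [dualTen_ten, right_unitElt, unitDual_unitElt, LinearMap.comp_apply, ten_unitElt_left,
    mul_single_one, Pi.smul_apply]
  -- Expanding `a * c` in the idempotents of `R` makes both sides sums over `V`; the pairing of `a`
  -- with each idempotent leaves one term.
  rw [← Module.End.mul_apply, ← map_mul, left_eq_sum, map_sum]
  refine Finset.sum_congr rfl fun n _ => ?_
  rw [Finset.sum_eq_single n]
  · simp
  · intro l _ h
    simp [h]
  · simp

lemma dualTen_unitDual_right {X : C} (a : V → K) (φ : Module.Dual K (Ω.obj X).carrier) :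
    dualTen Ω _ _ φ (unitDual Ω a) =
      (φ ∘ₗ (Ω.obj X).str.right (.op a)) ∘ₗ Bmd.lin (Ω.map (ρ_ X).hom) := by
  refine ten_ext fun x z => ?_
  obtain ⟨c, rfl⟩ := unitElt_surjective Ω z
  simp only [dualTen_ten, left_unitElt, unitDual_unitElt, LinearMap.comp_apply, ten_unitElt_right,
    mul_comm (Pi.single _ _) c, mul_single_one, Pi.smul_apply]
  rw [← Module.End.mul_apply, ← map_mul, ← MulOpposite.op_mul, right_eq_sum, map_sum]
  refine Finset.sum_congr rfl fun n _ => ?_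
  rw [Finset.sum_eq_single n]
  · simp [mul_comm]
  · intro l _ h
    simp [h]
  · simp

lemma dualTen_comp_left {X X' Y : C} (f : X ⟶ X') (φ : Module.Dual K (Ω.obj X').carrier)
    (ψ : Module.Dual K (Ω.obj Y).carrier) :
    dualTen Ω X' Y φ ψ ∘ₗ Bmd.lin (Ω.map (f ▷ Y)) =
      dualTen Ω X Y (φ ∘ₗ Bmd.lin (Ω.map f)) ψ := by
  refine ten_ext fun x y => ?_
  simp only [LinearMap.comp_apply, ← ten_map_left, dualTen_ten, Bmd.lin_right]

lemma dualTen_comp_right {X Y Y' : C} (f : Y ⟶ Y') (φ : Module.Dual K (Ω.obj X).carrier)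
    (ψ : Module.Dual K (Ω.obj Y').carrier) :
    dualTen Ω X Y' φ ψ ∘ₗ Bmd.lin (Ω.map (X ◁ f)) =
      dualTen Ω X Y φ (ψ ∘ₗ Bmd.lin (Ω.map f)) := by
  refine ten_ext fun x y => ?_
  simp only [LinearMap.comp_apply, ← ten_map_right, dualTen_ten, Bmd.lin_left]

/-- Triple products span, by `ten_ext` used twice, and on them both sides are the same double sum
over the two middle idempotents. -/
lemma dualTen_assoc {X Y Z : C} (φ : Module.Dual K (Ω.obj X).carrier)
    (ψ : Module.Dual K (Ω.obj Y).carrier) (χ : Module.Dual K (Ω.obj Z).carrier) :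
    dualTen Ω _ _ φ (dualTen Ω _ _ ψ χ) ∘ₗ Bmd.lin (Ω.map (α_ X Y Z).hom) =
      dualTen Ω _ _ (dualTen Ω _ _ φ ψ) χ := by
  refine ten_ext fun w z => ?_
  suffices h : (dualTen Ω _ _ φ (dualTen Ω _ _ ψ χ) ∘ₗ Bmd.lin (Ω.map (α_ X Y Z).hom)) ∘ₗ
      (ten Ω _ _).flip z = dualTen Ω _ _ (dualTen Ω _ _ φ ψ) χ ∘ₗ (ten Ω _ _).flip z from
    LinearMap.congr_fun h w
  refine ten_ext fun x y => ?_
  simp only [LinearMap.comp_apply, LinearMap.flip_apply, ten_assoc, dualTen_ten, ten_left,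
    ten_right, Finset.mul_sum, Finset.sum_mul, mul_assoc, BimoduleStr.comm]
  exact Finset.sum_comm

/-- Products of basis vectors span `Ω(X ⊗ Y)` but need not be a basis, since the tensor product is
taken over `R`. Paired with the functionals `dualTen` of the dual bases they still resolve the
identity, which is all that `Module.Basis.sum_eq_of_rank_one` requires. -/
lemma sum_ten_dualTen {X Y : C} (z : (Ω.obj (X ⊗ Y)).carrier) :
    ∑ p : _ × _, dualTen Ω X Y ((Module.finBasis K (Ω.obj X).carrier).coord p.1)
      ((Module.finBasis K (Ω.obj Y).carrier).coord p.2) z •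
        ten Ω X Y (Module.finBasis K (Ω.obj X).carrier p.1)
          (Module.finBasis K (Ω.obj Y).carrier p.2) = z := by
  suffices h : ∑ p : _ × _, (dualTen Ω X Y ((Module.finBasis K (Ω.obj X).carrier).coord p.1)
      ((Module.finBasis K (Ω.obj Y).carrier).coord p.2)).smulRight
        (ten Ω X Y (Module.finBasis K (Ω.obj X).carrier p.1)
          (Module.finBasis K (Ω.obj Y).carrier p.2)) = LinearMap.id by
    simpa [LinearMap.sum_apply] using LinearMap.congr_fun h z
  refine ten_ext fun x y => ?_
  simp only [LinearMap.sum_apply, LinearMap.smulRight_apply, dualTen_ten, LinearMap.id_apply,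
    Finset.sum_smul, Module.Basis.coord_apply]
  rw [Finset.sum_comm]
  have key : ∀ k : V, ∑ p : _ × _, (((Module.finBasis K (Ω.obj X).carrier).repr
      ((Ω.obj X).str.right (.op (Pi.single k 1)) x) p.1) *
      ((Module.finBasis K (Ω.obj Y).carrier).repr
        ((Ω.obj Y).str.left (Pi.single k 1) y) p.2)) •
        ten Ω X Y (Module.finBasis K (Ω.obj X).carrier p.1)
          (Module.finBasis K (Ω.obj Y).carrier p.2) =
      ten Ω X Y x ((Ω.obj Y).str.left (Pi.single k 1) y) := by
    intro k
    -- The idempotent is duplicated and one copy is moved to the left factor, so that both factors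
    -- match the formula in `dualTen_ten`.
    have h : ten Ω X Y x ((Ω.obj Y).str.left (Pi.single k 1) y) =
        ten Ω X Y ((Ω.obj X).str.right (.op (Pi.single k 1)) x)
          ((Ω.obj Y).str.left (Pi.single k 1) y) := by
      rw [ten_balanced, ← Module.End.mul_apply, ← map_mul, ← Pi.single_mul, one_mul]
    rw [Fintype.sum_prod_type, h]
    conv_rhs => rw [← (Module.finBasis K (Ω.obj X).carrier).sum_repr
      ((Ω.obj X).str.right (.op (Pi.single k 1)) x), map_sum, LinearMap.sum_apply]
    refine Finset.sum_congr rfl fun i _ => ?_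
    conv_rhs => rw [← (Module.finBasis K (Ω.obj Y).carrier).sum_repr
      ((Ω.obj Y).str.left (Pi.single k 1) y), map_sum]
    refine Finset.sum_congr rfl fun j _ => ?_
    rw [map_smul, map_smul, LinearMap.smul_apply, mul_comm, mul_smul]
  rw [Finset.sum_congr rfl fun k _ => key k, ← map_sum, ← LinearMap.sum_apply, ← map_sum,
    FaceAlgebra.sum_single, map_one, Module.End.one_apply]

end

end Tannaka

/-! ### The product and the face algebra structure on the coend -/

namespace Tannaka

section

variable {K V : Type v} [Field K] [Fintype V] [DecidableEq V]
  {C : Type u} [Category.{v} C] [Preadditive C] [Linear K C] [MonoidalCategory C] {L : V → C}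
  (Ω : C ⥤ Bmd K (V → K)) (hL : IsSplitFiniteSemisimple K L) [Ω.Additive] [Ω.Linear K]
  [Ω.Monoidal]

/-- The product of matrix coefficients. -/
def mulFam (X Y : C) : Module.Dual K (Ω.obj X).carrier ⊗[K] (Ω.obj X).carrier →ₗ[K]
    Module.Dual K (Ω.obj Y).carrier ⊗[K] (Ω.obj Y).carrier →ₗ[K] Coend Ω hL :=
  (TensorProduct.map₂ (dualTen Ω X Y) (ten Ω X Y)).compr₂ (kap Ω hL (X ⊗ Y))

lemma mulFam_tmul {X Y : C} (φ : Module.Dual K (Ω.obj X).carrier) (x : (Ω.obj X).carrier)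
    (ψ : Module.Dual K (Ω.obj Y).carrier) (y : (Ω.obj Y).carrier) :
    mulFam Ω hL X Y (φ ⊗ₜ x) (ψ ⊗ₜ y) =
      kap Ω hL (X ⊗ Y) (dualTen Ω X Y φ ψ ⊗ₜ ten Ω X Y x y) := rfl

/-- Naturality of the tensorator in its second variable, used for vectors and in transposed form for
functionals. -/
lemma mulFam_dinatural_right (X : C) : IsDinatural Ω fun Y => (mulFam Ω hL X Y).flip := by
  intro Y Y' f ψ y
  refine TensorProduct.ext' fun φ x => ?_
  simp only [LinearMap.flip_apply, mulFam_tmul, ten_map_right]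
  rw [kap_dinatural, dualTen_comp_right]

/-- Left multiplication by matrix coefficients of `X`. -/
def mulLeft (X : C) : Module.Dual K (Ω.obj X).carrier ⊗[K] (Ω.obj X).carrier →ₗ[K]
    Coend Ω hL →ₗ[K] Coend Ω hL :=
  (desc Ω hL fun Y => (mulFam Ω hL X Y).flip).flip

lemma mulLeft_kap {X Y : C} (s : Module.Dual K (Ω.obj X).carrier ⊗[K] (Ω.obj X).carrier)
    (t : Module.Dual K (Ω.obj Y).carrier ⊗[K] (Ω.obj Y).carrier) :
    mulLeft Ω hL X s (kap Ω hL Y t) = mulFam Ω hL X Y s t :=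
  LinearMap.congr_fun (desc_kap Ω hL (mulFam_dinatural_right Ω hL X) Y t) s

lemma mulLeft_dinatural : IsDinatural Ω (mulLeft Ω hL) := by
  intro X X' f φ x
  refine hom_ext fun Y ψ y => ?_
  rw [mulLeft_kap, mulLeft_kap, mulFam_tmul, mulFam_tmul, ten_map_left, kap_dinatural,
    dualTen_comp_left]

instance : Mul (Coend Ω hL) := ⟨fun a b => desc Ω hL (mulLeft Ω hL) a b⟩

lemma mul_def (a b : Coend Ω hL) : a * b = desc Ω hL (mulLeft Ω hL) a b := rfl

/-- The product is obtained from the universal property twice, once in each variable; this formula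
is the form in which it is used. -/
lemma kap_mul_kap {X Y : C} (φ : Module.Dual K (Ω.obj X).carrier) (x : (Ω.obj X).carrier)
    (ψ : Module.Dual K (Ω.obj Y).carrier) (y : (Ω.obj Y).carrier) :
    kap Ω hL X (φ ⊗ₜ x) * kap Ω hL Y (ψ ⊗ₜ y) =
      kap Ω hL (X ⊗ Y) (dualTen Ω X Y φ ψ ⊗ₜ ten Ω X Y x y) := by
  rw [mul_def, desc_kap _ _ (mulLeft_dinatural Ω hL), mulLeft_kap, mulFam_tmul]

/-- The map `E → C(Ω)`, as a linear map. -/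
def faceLin : (V → K) ⊗[K] (V → K) →ₗ[K] Coend Ω hL :=
  kap Ω hL (𝟙_ C) ∘ₗ TensorProduct.map (unitDual Ω) (unitElt Ω)

lemma faceLin_tmul (a b : V → K) :
    faceLin Ω hL (a ⊗ₜ b) = kap Ω hL (𝟙_ C) (unitDual Ω a ⊗ₜ unitElt Ω b) := rfl

/-- The image of `E` consists of matrix coefficients of the unit object. Dinaturality along the left
unit constraint turns multiplication by them into the `E`-action on the functional and the vector.
-/
lemma faceLin_mul_kap {X : C} (a b : V → K) (φ : Module.Dual K (Ω.obj X).carrier)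
    (x : (Ω.obj X).carrier) : faceLin Ω hL (a ⊗ₜ b) * kap Ω hL X (φ ⊗ₜ x) =
      kap Ω hL X ((φ ∘ₗ (Ω.obj X).str.left a) ⊗ₜ (Ω.obj X).str.left b x) := by
  rw [faceLin_tmul, kap_mul_kap, dualTen_unitDual_left, ← kap_dinatural, ten_unitElt_left]

lemma kap_mul_faceLin {X : C} (a b : V → K) (φ : Module.Dual K (Ω.obj X).carrier)
    (x : (Ω.obj X).carrier) : kap Ω hL X (φ ⊗ₜ x) * faceLin Ω hL (a ⊗ₜ b) =
      kap Ω hL X ((φ ∘ₗ (Ω.obj X).str.right (.op a)) ⊗ₜ (Ω.obj X).str.right (.op b) x) := by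
  rw [faceLin_tmul, kap_mul_kap, dualTen_unitDual_right, ← kap_dinatural, ten_unitElt_right]

instance : One (Coend Ω hL) := ⟨faceLin Ω hL (1 ⊗ₜ 1)⟩

instance : Ring (Coend Ω hL) where
  __ := (inferInstance : AddCommGroup (Coend Ω hL))
  mul_assoc a b c := by
    let m := desc Ω hL (mulLeft Ω hL)
    -- Associativity is stated as an equality of trilinear maps, so that it can be tested on three
    -- matrix coefficients in turn.
    suffices h : m.compr₂ m = (LinearMap.llcomp K _ _ _).flip m ∘ₗ
        (LinearMap.llcomp K (Coend Ω hL) (Coend Ω hL) (Coend Ω hL)) ∘ₗ m from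
      LinearMap.congr_fun (LinearMap.congr_fun (LinearMap.congr_fun h a) b) c
    refine hom_ext fun X φ x => hom_ext fun Y ψ y => hom_ext fun Z χ z => ?_
    change kap Ω hL X (φ ⊗ₜ x) * kap Ω hL Y (ψ ⊗ₜ y) * kap Ω hL Z (χ ⊗ₜ z) =
      kap Ω hL X (φ ⊗ₜ x) * (kap Ω hL Y (ψ ⊗ₜ y) * kap Ω hL Z (χ ⊗ₜ z))
    -- The two bracketings are coefficients of different objects, and dinaturality along the
    -- associator identifies them.
    rw [kap_mul_kap, kap_mul_kap, kap_mul_kap, kap_mul_kap, ← dualTen_assoc, ← kap_dinatural,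
      ten_assoc]
  one_mul a := by
    suffices h : desc Ω hL (mulLeft Ω hL) 1 = LinearMap.id from LinearMap.congr_fun h a
    refine hom_ext fun X φ x => ?_
    change faceLin Ω hL (1 ⊗ₜ 1) * _ = _
    rw [faceLin_mul_kap, map_one]
    rfl
  mul_one a := by
    suffices h : (desc Ω hL (mulLeft Ω hL)).flip 1 = LinearMap.id from LinearMap.congr_fun h a
    refine hom_ext fun X φ x => ?_
    change _ * faceLin Ω hL (1 ⊗ₜ 1) = _
    rw [kap_mul_faceLin, MulOpposite.op_one, map_one]
    rfl
  left_distrib a b c := by simp only [mul_def, map_add]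
  right_distrib a b c := by simp only [mul_def, map_add, LinearMap.add_apply]
  zero_mul a := by simp only [mul_def, map_zero, LinearMap.zero_apply]
  mul_zero a := by simp only [mul_def, map_zero]

instance : Algebra K (Coend Ω hL) := Algebra.ofModule
  (fun r x y => by simp only [mul_def, map_smul, LinearMap.smul_apply])
  (fun r x y => by simp only [mul_def, map_smul])

lemma faceLin_mul (s t : (V → K) ⊗[K] (V → K)) :
    faceLin Ω hL (s * t) = faceLin Ω hL s * faceLin Ω hL t := by
  induction s using TensorProduct.induction_on with
  | zero => simp
  | add a b ha hb => simp only [add_mul, map_add, ha, hb]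
  | tmul a b =>
    induction t using TensorProduct.induction_on with
    | zero => simp
    | add a b ha hb => simp only [mul_add, map_add, ha, hb]
    | tmul c d =>
      rw [faceLin_tmul _ _ c d, faceLin_mul_kap, Algebra.TensorProduct.tmul_mul_tmul,
        faceLin_tmul, left_unitElt]
      congr 2
      refine LinearMap.ext fun z => ?_
      obtain ⟨e, rfl⟩ := unitElt_surjective Ω z
      simp [left_unitElt, unitDual_unitElt, mul_left_comm, mul_assoc]

/-- The map `E → C(Ω)`. -/
def face : (V → K) ⊗[K] (V → K) →ₐ[K] Coend Ω hL :=
  AlgHom.ofLinearMap (faceLin Ω hL) rfl (faceLin_mul Ω hL)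

lemma sum_unitDual_smul_unitElt (z : (Ω.obj (𝟙_ C)).carrier) :
    ∑ n : V, unitDual Ω (Pi.single n 1) z • unitElt Ω (Pi.single n 1) = z := by
  obtain ⟨c, rfl⟩ := unitElt_surjective Ω z
  conv_rhs => rw [eq_sum_smul_single c]
  rw [map_sum]
  refine Finset.sum_congr rfl fun n _ => ?_
  rw [map_smul, unitDual_unitElt, Finset.sum_eq_single n]
  · simp
  · intro m _ h
    simp [h]
  · simp

lemma sum_coord_smul (X : C) (z : (Ω.obj X).carrier) :
    ∑ i, (Module.finBasis K (Ω.obj X).carrier).coord i z •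
      Module.finBasis K (Ω.obj X).carrier i = z :=
  (Module.finBasis K (Ω.obj X).carrier).sum_repr z

instance : FaceAlgebra K V (Coend Ω hL) where
  faceMap := face Ω hL
  comul_faceMap l m := by
    change Coalgebra.comul (R := K) (kap Ω hL _ (_ ⊗ₜ _)) = ∑ n, kap Ω hL _ (_ ⊗ₜ _) ⊗ₜ[K]
      kap Ω hL _ (_ ⊗ₜ _)
    rw [comul_kap]
    -- The chosen basis of `Ω(𝟙_ C)` is replaced by the dual bases `unitElt`, `unitDual`.
    exact Module.Basis.sum_eq_of_rank_one ((TensorProduct.mk K _ _).compl₁₂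
      (TensorProduct.curry (kap Ω hL (𝟙_ C)) (unitDual Ω (Pi.single l 1)))
      ((TensorProduct.curry (kap Ω hL (𝟙_ C))).flip (unitElt Ω (Pi.single m 1))))
      _ _ _ _ fun z => (sum_coord_smul Ω _ z).trans (sum_unitDual_smul_unitElt Ω z).symm
  counit_faceMap l m := by
    refine (counit_kap Ω hL _ _ _).trans ?_
    rw [unitDual_unitElt]
    simp [Pi.single_apply, eq_comm]
  comul_mul a b := by
    let D := Coalgebra.comul (R := K) (A := Coend Ω hL)
    suffices h : (LinearMap.mul K (Coend Ω hL)).compr₂ D =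
        (LinearMap.mul K (Coend Ω hL ⊗[K] Coend Ω hL)).compl₁₂ D D from
      LinearMap.congr_fun (LinearMap.congr_fun h a) b
    refine hom_ext fun X φ x => hom_ext fun Y ψ y => ?_
    change D (kap Ω hL X (φ ⊗ₜ x) * kap Ω hL Y (ψ ⊗ₜ y)) =
      D (kap Ω hL X (φ ⊗ₜ x)) * D (kap Ω hL Y (ψ ⊗ₜ y))
    rw [kap_mul_kap]
    simp only [D, comul_kap]
    rw [Finset.sum_mul_sum, ← Fintype.sum_prod_type']
    simp only [Algebra.TensorProduct.tmul_mul_tmul, kap_mul_kap]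
    -- Multiplicativity of `Δ`: a basis of `Ω(X ⊗ Y)` and the products of basis vectors of `Ω(X)`
    -- and `Ω(Y)` give two resolutions of the same identity.
    exact Module.Basis.sum_eq_of_rank_one ((TensorProduct.mk K _ _).compl₁₂
      (TensorProduct.curry (kap Ω hL (X ⊗ Y)) (dualTen Ω X Y φ ψ))
      ((TensorProduct.curry (kap Ω hL (X ⊗ Y))).flip (ten Ω X Y x y)))
      _ _ _ _ fun z => (sum_coord_smul Ω _ z).trans (sum_ten_dualTen Ω z).symm
  counit_mul a b := by
    let e := Coalgebra.counit (R := K) (A := Coend Ω hL)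
    suffices h : (LinearMap.mul K (Coend Ω hL)).compr₂ e =
        ∑ n : V, (LinearMap.mul K K).compl₁₂
          (e ∘ₗ LinearMap.mulRight K (face Ω hL (1 ⊗ₜ Pi.single n 1)))
          (e ∘ₗ LinearMap.mulLeft K (face Ω hL (Pi.single n 1 ⊗ₜ 1))) by
      simpa [LinearMap.sum_apply] using LinearMap.congr_fun (LinearMap.congr_fun h a) b
    refine hom_ext fun X φ x => hom_ext fun Y ψ y => ?_
    simp only [LinearMap.sum_apply]
    change e (kap Ω hL X (φ ⊗ₜ x) * kap Ω hL Y (ψ ⊗ₜ y)) =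
      ∑ n : V, e (kap Ω hL X (φ ⊗ₜ x) * faceLin Ω hL (1 ⊗ₜ Pi.single n 1)) *
        e (faceLin Ω hL (Pi.single n 1 ⊗ₜ 1) * kap Ω hL Y (ψ ⊗ₜ y))
    -- Evaluating the counits leaves exactly the formula of `dualTen_ten`; the sum over `V` in the
    -- axiom is the one that made `dualTensor` balanced.
    simp only [kap_mul_kap, kap_mul_faceLin, faceLin_mul_kap, e, counit_kap, dualTen_ten]
    simp

lemma kap_mem_homs (X : C) : kap Ω hL X ∈ homs (outerTensor (Ω.obj X).str.dual (Ω.obj X).str)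
    (FaceAlgebra.bimodule K V (Coend Ω hL)) := by
  constructor
  · intro e t
    change _ = FaceAlgebra.faceMap (K := K) (V := V) e * kap Ω hL X t
    induction t using TensorProduct.induction_on with
    | zero => simp
    | add a b ha hb => simp only [map_add, ha, hb, mul_add]
    | tmul φ x =>
      induction e using TensorProduct.induction_on with
      | zero => simp
      | add a b ha hb => simp only [map_add, LinearMap.add_apply, ha, hb, add_mul]
      | tmul a b => exact (faceLin_mul_kap Ω hL a b φ x).symm
  · intro e t
    induction e using MulOpposite.rec' with
    | _ e =>
    change _ = kap Ω hL X t * FaceAlgebra.faceMap (K := K) (V := V) e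
    induction t using TensorProduct.induction_on with
    | zero => simp
    | add a b ha hb => simp only [map_add, ha, hb, add_mul]
    | tmul φ x =>
      induction e using TensorProduct.induction_on with
      | zero => simp
      | add a b ha hb =>
        simp only [MulOpposite.op_add, map_add, LinearMap.add_apply, ha, hb, mul_add]
      | tmul a b => exact (kap_mul_faceLin Ω hL a b φ x).symm

/-- The linear universal property is `desc_kap` with `hom_ext`. That the induced map respects the
`E`-actions is tested on matrix coefficients, where it follows from the assumption on the family. -/
lemma isFaceCoend : IsFaceCoend Ω (FaceAlgebra.bimodule K V (Coend Ω hL)) (kap Ω hL) where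
  bimodule := kap_mem_homs Ω hL
  dinatural := kap_dinatural Ω hL
  universal M _ _ t ι hι hd := by
    refine ⟨desc Ω hL ι, ⟨⟨fun a z => ?_, fun a z => ?_⟩, fun X => LinearMap.ext fun s =>
      desc_kap Ω hL hd X s⟩, fun h hh => hom_ext fun X φ x => ?_⟩
    · suffices h : desc Ω hL ι ∘ₗ (FaceAlgebra.bimodule K V (Coend Ω hL)).left a =
          t.left a ∘ₗ desc Ω hL ι from LinearMap.congr_fun h z
      refine hom_ext fun X φ x => ?_
      rw [LinearMap.comp_apply, LinearMap.comp_apply, ← (kap_mem_homs Ω hL X).1,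
        desc_kap Ω hL hd, desc_kap Ω hL hd, (hι X).1]
    · suffices h : desc Ω hL ι ∘ₗ (FaceAlgebra.bimodule K V (Coend Ω hL)).right a =
          t.right a ∘ₗ desc Ω hL ι from LinearMap.congr_fun h z
      refine hom_ext fun X φ x => ?_
      rw [LinearMap.comp_apply, LinearMap.comp_apply, ← (kap_mem_homs Ω hL X).2,
        desc_kap Ω hL hd, desc_kap Ω hL hd, (hι X).2]
    · rw [desc_kap Ω hL hd, ← hh.2 X]
      rfl

/-- Again two resolutions of the identity of `Ω(X ⊗ Y)` are compared. -/
lemma tannakaCoact_ten {X Y : C} (x : (Ω.obj X).carrier) (y : (Ω.obj Y).carrier) :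
    tannakaCoact (kap Ω hL) (X ⊗ Y) (ten Ω X Y x y) =
      TensorProduct.map₂ (ten Ω X Y) (LinearMap.mul K (Coend Ω hL))
        (tannakaCoact (kap Ω hL) X x) (tannakaCoact (kap Ω hL) Y y) := by
  simp only [tannakaCoact_apply, map_sum, LinearMap.sum_apply, TensorProduct.map₂_apply_tmul,
    TensorProduct.map_tmul,
    LinearMap.mul_apply', kap_mul_kap]
  rw [Finset.sum_comm, ← Fintype.sum_prod_type']
  exact Module.Basis.sum_eq_of_rank_one
    ((TensorProduct.mk K (Ω.obj (X ⊗ Y)).carrier (Coend Ω hL)).compl₁₂ LinearMap.id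
      ((TensorProduct.curry (kap Ω hL (X ⊗ Y))).flip (ten Ω X Y x y)))
    (Module.finBasis K (Ω.obj (X ⊗ Y)).carrier) _
    (fun p : _ × _ => ten Ω X Y (Module.finBasis K (Ω.obj X).carrier p.1)
          (Module.finBasis K (Ω.obj Y).carrier p.2)) _
    fun z => (sum_coord_smul Ω _ z).trans (sum_ten_dualTen Ω z).symm

lemma tannakaCoact_unitElt (a : V → K) :
    tannakaCoact (kap Ω hL) (𝟙_ C) (unitElt Ω a) =
      ∑ l : V, unitElt Ω (Pi.single l 1) ⊗ₜ[K]
        FaceAlgebra.faceMap (K := K) (V := V) (Pi.single l 1 ⊗ₜ a) := by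
  rw [tannakaCoact_apply]
  exact Module.Basis.sum_eq_of_rank_one
    ((TensorProduct.mk K (Ω.obj (𝟙_ C)).carrier (Coend Ω hL)).compl₁₂ LinearMap.id
      ((TensorProduct.curry (kap Ω hL (𝟙_ C))).flip (unitElt Ω a)))
    (Module.finBasis K (Ω.obj (𝟙_ C)).carrier) _
    (fun l : V => unitElt Ω (Pi.single l 1)) _
    fun z => (sum_coord_smul Ω _ z).trans (sum_unitDual_smul_unitElt Ω z).symm

lemma isTannakaFaceAlgebra : IsTannakaFaceAlgebra Ω (kap Ω hL) where
  isFaceCoend := isFaceCoend Ω hL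
  comul := comul_kap Ω hL
  counit := counit_kap Ω hL
  mul _ _ x y := tannakaCoact_ten Ω hL x y
  unit m := tannakaCoact_unitElt Ω hL (Pi.single m 1)

end

end Tannaka

/-! ### The monoidal lift to comodules -/

/-- A separate version of `Tensor.ext₃` is used because the inner bimodule structure here comes from
the coaction on the tensor product. It agrees with `BimoduleStr.tensor` by the lemma
`bimodule_tensor`, but not in form. -/
lemma ComoduleStr.tensor_ext₃ {K V H M N P Q : Type*} [Field K] [Fintype V] [DecidableEq V]
    [Ring H] [Algebra K H] [Coalgebra K H] [FaceAlgebra K V H]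
    [AddCommGroup M] [Module K M] [AddCommGroup N] [Module K N] [AddCommGroup P] [Module K P]
    [AddCommGroup Q] [Module K Q] {s : ComoduleStr K H M} {t : ComoduleStr K H N}
    {r : ComoduleStr K H P}
    {F G : Tensor ((ComoduleStr.tensor V s t).bimodule V) (r.bimodule V) →ₗ[K] Q}
    (h : ∀ m n p, F (tmul _ _ (tmul (s.bimodule V) (t.bimodule V) m n) p) =
      G (tmul _ _ (tmul (s.bimodule V) (t.bimodule V) m n) p)) : F = G := by
  refine Tensor.ext fun x p => ?_
  induction x using Tensor.induction with
  | zero => simp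
  | tm m n => exact h m n p
  | add x y hx hy => simp only [map_add, LinearMap.add_apply, hx, hy]

namespace Tannaka

section

variable {K V : Type v} [Field K] [Fintype V] [DecidableEq V]
  {C : Type u} [Category.{v} C] [Preadditive C] [Linear K C] [MonoidalCategory C] {L : V → C}
  (Ω : C ⥤ Bmd K (V → K)) (hL : IsSplitFiniteSemisimple K L) [Ω.Additive] [Ω.Linear K]
  [Ω.Monoidal]

/-- The coaction of `C(Ω)` on `Ω(X)`. -/
def coactStr (X : C) : ComoduleStr K (Coend Ω hL) (Ω.obj X).carrier where
  coact := tannakaCoact (kap Ω hL) X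
  coassoc := kap_coassoc Ω hL X
  counit := kap_counit Ω hL X

lemma act_coactStr (X : C) (χ : Coend Ω hL →ₗ[K] K) (x : (Ω.obj X).carrier) :
    (coactStr Ω hL X).act χ x = ∑ i, χ (kap Ω hL X
      ((Module.finBasis K (Ω.obj X).carrier).coord i ⊗ₜ x)) •
        Module.finBasis K (Ω.obj X).carrier i := by
  change ComoduleStr.contract _ χ (tannakaCoact (kap Ω hL) X x) = _
  simp only [tannakaCoact_apply, map_sum, ComoduleStr.contract_tmul]

/-- Since `ε(a κ(φ ⊗ x) b) = φ(a x b)`, the bimodule structure recovered from the coaction is the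
original one. Hence the comodule functor lifts `Ω`. -/
lemma act_eps_coactStr (X : C) (a b : V → K) (x : (Ω.obj X).carrier) :
    (coactStr Ω hL X).act (ComoduleStr.eps K (Coend Ω hL) a b) x =
      (Ω.obj X).str.left a ((Ω.obj X).str.right (.op b) x) := by
  rw [act_coactStr]
  refine Eq.trans (Finset.sum_congr rfl fun i _ => ?_) (sum_coord_smul Ω X _)
  rw [ComoduleStr.eps_apply]
  congr 1
  change Coalgebra.counit (R := K) (faceLin Ω hL (1 ⊗ₜ a) * (kap Ω hL X (_ ⊗ₜ x) *
    faceLin Ω hL (1 ⊗ₜ b))) = _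
  rw [kap_mul_faceLin, faceLin_mul_kap, counit_kap]
  simp

lemma bimodule_left (X : C) (a : V → K) (x : (Ω.obj X).carrier) :
    ((coactStr Ω hL X).bimodule V).left a x = (Ω.obj X).str.left a x := by
  rw [ComoduleStr.bimodule_left, act_eps_coactStr]
  simp

lemma bimodule_right (X : C) (a : (V → K)ᵐᵒᵖ) (x : (Ω.obj X).carrier) :
    ((coactStr Ω hL X).bimodule V).right a x = (Ω.obj X).str.right a x := by
  rw [ComoduleStr.bimodule_right, act_eps_coactStr]
  simp

/-- The lift of `Ω` to comodules of `C(Ω)`. -/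
def toCom : C ⥤ Com K V (Coend Ω hL) where
  obj X := ⟨(Ω.obj X).carrier, coactStr Ω hL X⟩
  map f := Com.ofLin (Bmd.lin (Ω.map f)) (tannakaCoact_map Ω hL f)
  map_id X := Com.hom_ext (congrArg Bmd.lin (Ω.map_id X))
  map_comp f g := Com.hom_ext (congrArg Bmd.lin (Ω.map_comp f g))

instance : (toCom Ω hL).Additive where
  map_add {_ _ f g} := Com.hom_ext (congrArg Bmd.lin (Ω.map_add (f := f) (g := g)))

instance : (toCom Ω hL).Linear K where
  map_smul f r := Com.hom_ext (congrArg Bmd.lin (Ω.map_smul (f := f) (r := r)))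

/-- The identity of `Ω(X)`, as an isomorphism of bimodules. -/
def compareObj (X : C) : (Com.forget K V (Coend Ω hL)).obj ((toCom Ω hL).obj X) ≅ Ω.obj X :=
  Bmd.isoOfLin (M := (Com.forget K V (Coend Ω hL)).obj ((toCom Ω hL).obj X)) (N := Ω.obj X)
    (LinearMap.id (M := (Ω.obj X).carrier)) (LinearMap.id (M := (Ω.obj X).carrier)) rfl rfl
    (bimodule_left Ω hL X) (bimodule_right Ω hL X)

/-- The lift of `Ω` to comodules is a lift of `Ω`. -/
def compare : toCom Ω hL ⋙ Com.forget K V (Coend Ω hL) ≅ Ω :=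
  NatIso.ofComponents (compareObj Ω hL) fun _ => Bmd.hom_ext rfl

/-- The tensorator of `Ω`, between the bimodules underlying comodules. -/
def tensorComparison (X Y : C) :
    (Com.forget K V (Coend Ω hL)).obj
      (Com.tensorObj ((toCom Ω hL).obj X) ((toCom Ω hL).obj Y)) ≅
      (Com.forget K V (Coend Ω hL)).obj ((toCom Ω hL).obj (X ⊗ Y)) :=
  (Com.tensorIso _ _).symm ≪≫ (compareObj Ω hL X ⊗ᵢ compareObj Ω hL Y) ≪≫
    Functor.Monoidal.μIso Ω X Y ≪≫ (compareObj Ω hL (X ⊗ Y)).symm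

/-- The unit of `Ω`, between the bimodules underlying comodules. -/
def unitComparison :
    (Com.forget K V (Coend Ω hL)).obj (Com.tensorUnit K V (Coend Ω hL)) ≅
      (Com.forget K V (Coend Ω hL)).obj ((toCom Ω hL).obj (𝟙_ C)) :=
  (Com.unitIso K V (Coend Ω hL)).symm ≪≫ Functor.Monoidal.εIso Ω ≪≫
    (compareObj Ω hL (𝟙_ C)).symm

/-- The map `F` is described only by its values on pure tensors, so that the statement applies to
the composite `tensorComparison` as it stands. -/
lemma coact_of_ten (X Y : C)
    (F : Tensor ((coactStr Ω hL X).bimodule V) ((coactStr Ω hL Y).bimodule V) →ₗ[K]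
      (Ω.obj (X ⊗ Y)).carrier)
    (hF : ∀ x y, F (tmul _ _ x y) = ten Ω X Y x y)
    (t : Tensor ((coactStr Ω hL X).bimodule V) ((coactStr Ω hL Y).bimodule V)) :
    tannakaCoact (kap Ω hL) (X ⊗ Y) (F t) = F.rTensor (Coend Ω hL)
        ((ComoduleStr.tensor V (coactStr Ω hL X) (coactStr Ω hL Y)).coact t) := by
  induction t using Tensor.induction with
  | zero => simp only [map_zero]
  | add s t hs ht => simp only [map_add, hs, ht]
  | tm x y =>
    rw [hF, tannakaCoact_ten]
    change _ = LinearMap.rTensor _ _ (ComoduleStr.mulCoact V (coactStr Ω hL X) (coactStr Ω hL Y)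
      (tannakaCoact (kap Ω hL) X x) (tannakaCoact (kap Ω hL) Y y))
    generalize tannakaCoact (kap Ω hL) X x = s
    generalize tannakaCoact (kap Ω hL) Y y = t
    induction s using TensorProduct.induction_on with
    | zero => simp
    | add a b ha hb => simp only [map_add, LinearMap.add_apply, ha, hb]
    | tmul m h =>
      induction t using TensorProduct.induction_on with
      | zero => simp
      | add a b ha hb => simp only [map_add, ha, hb]
      | tmul n k => simp [hF]

lemma coact_of_unitElt (F : (V → K) →ₗ[K] (Ω.obj (𝟙_ C)).carrier)
    (hF : ∀ a, F a = unitElt Ω a) (a : V → K) :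
    tannakaCoact (kap Ω hL) (𝟙_ C) (F a) =
      F.rTensor (Coend Ω hL) (ComoduleStr.unitCoact K V (Coend Ω hL) a) := by
  rw [hF, tannakaCoact_unitElt, ComoduleStr.unitCoact_apply, map_sum]
  simp only [LinearMap.rTensor_tmul, hF]

/-- The monoidal structure on the lift of `Ω` to comodules. -/
def toComCoreMonoidal : (toCom Ω hL).CoreMonoidal where
  εIso := Com.isoOfBmd (M := Com.tensorUnit K V (Coend Ω hL)) (unitComparison Ω hL)
    (coact_of_unitElt Ω hL _ fun _ => rfl)
  μIso X Y := Com.isoOfBmd (M := Com.tensorObj ((toCom Ω hL).obj X) ((toCom Ω hL).obj Y))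
    (tensorComparison Ω hL X Y) (coact_of_ten Ω hL X Y _ fun _ _ => rfl)
  -- Morphisms of comodules are determined by their linear maps, so each coherence law is the
  -- corresponding law for `Ω` on pure tensors.
  μIso_hom_natural_left f Y := Com.hom_ext <| Tensor.ext fun x y => ten_map_left Ω f Y x y
  μIso_hom_natural_right X f := Com.hom_ext <| Tensor.ext fun x y => ten_map_right Ω X f x y
  associativity X Y Z := Com.hom_ext <| ComoduleStr.tensor_ext₃ (s := coactStr Ω hL X)
    (t := coactStr Ω hL Y) (r := coactStr Ω hL Z) fun x y z => ten_assoc Ω x y z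
  left_unitality X := Com.hom_ext <| Tensor.ext fun (a : V → K) x =>
    (bimodule_left Ω hL X a x).trans (ten_unitElt_left Ω a x).symm
  right_unitality X := Com.hom_ext <| Tensor.ext fun x (a : V → K) =>
    (bimodule_right Ω hL X (.op a) x).trans (ten_unitElt_right Ω a x).symm

instance : (toCom Ω hL).Monoidal := (toComCoreMonoidal Ω hL).toMonoidal

lemma compare_isMonoidal : NatTrans.IsMonoidal (compare Ω hL).hom where
  unit := Bmd.hom_ext rfl
  tensor X Y := Bmd.hom_ext <| Tensor.ext fun x y => by
    rw [Functor.LaxMonoidal.comp_μ]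
    -- The comparison isomorphisms are identities on the underlying spaces, so both composites send
    -- the class of `x ⊗ y` to this product.
    refine Eq.trans (b := ten Ω X Y x y) ?_ ?_
    · exact rfl
    · exact rfl

lemma tannakaCoact_compare (X : C) (m : ((toCom Ω hL).obj X).carrier) :
    tannakaCoact (kap Ω hL) X (Bmd.lin ((compare Ω hL).hom.app X) m) =
      (Bmd.lin ((compare Ω hL).hom.app X)).rTensor (Coend Ω hL)
        (((toCom Ω hL).obj X).str.coact m) :=
  (LinearMap.congr_fun (LinearMap.rTensor_id (Coend Ω hL) (Ω.obj X).carrier)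
    (tannakaCoact (kap Ω hL) X m)).symm

end

end Tannaka

/-! ### Comodules as modules over a product of matrix algebras -/

/-- The data present `M` as a biproduct of the objects `F.obj (X p)`, and an additive functor
carries `⨁ X` to another one. The explicit comparison avoids assuming that `D` has biproducts. -/
lemma CategoryTheory.Functor.nonempty_iso_biproduct {C D J : Type*} [Category C] [Category D]
    [Preadditive C] [Preadditive D] [HasFiniteBiproducts C] (F : C ⥤ D) [F.Additive]
    [Fintype J] (X : J → C) (M : D) (a : ∀ p, F.obj (X p) ⟶ M)
    (b : ∀ p, M ⟶ F.obj (X p)) (h₁ : ∑ p, b p ≫ a p = 𝟙 M) (h₂ : ∀ p, a p ≫ b p = 𝟙 _)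
    (h₃ : ∀ p q, p ≠ q → a p ≫ b q = 0) : Nonempty (F.obj (⨁ X) ≅ M) := by
  classical
  have total : ∑ p, biproduct.π X p ≫ biproduct.ι X p = 𝟙 (⨁ X) :=
    IsBilimit.total (biproduct.isBilimit X)
  -- The two systems of inclusions and projections have the same matrix of composites; this is what
  -- cancels in both verifications below.
  have key : ∀ p q, a p ≫ b q = F.map (biproduct.ι X p ≫ biproduct.π X q) := by
    intro p q
    rcases eq_or_ne p q with rfl | h
    · rw [h₂, biproduct.ι_π_self, F.map_id]
    · rw [h₃ p q h, biproduct.ι_π_ne X h, F.map_zero]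
  refine ⟨⟨∑ p, F.map (biproduct.π X p) ≫ a p, ∑ q, b q ≫ F.map (biproduct.ι X q), ?_, ?_⟩⟩
  · rw [Preadditive.sum_comp]
    have h : ∀ p, (F.map (biproduct.π X p) ≫ a p) ≫ ∑ q, b q ≫ F.map (biproduct.ι X q) =
        F.map (biproduct.π X p ≫ biproduct.ι X p) := by
      intro p
      rw [Preadditive.comp_sum]
      simp only [Category.assoc, reassoc_of% (key p)]
      simp only [← F.map_comp, ← F.map_sum, ← Preadditive.comp_sum, Category.assoc,
        total, Category.comp_id]
    simp only [h, ← F.map_sum, total, F.map_id]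
  · rw [Preadditive.sum_comp]
    have h : ∀ q, (b q ≫ F.map (biproduct.ι X q)) ≫ ∑ p, F.map (biproduct.π X p) ≫ a p =
        b q ≫ a q := by
      intro q
      rw [Preadditive.comp_sum]
      have h4 : ∀ p, (b q ≫ F.map (biproduct.ι X q)) ≫ F.map (biproduct.π X p) ≫ a p =
          (b q ≫ a q) ≫ b p ≫ a p := by
        intro p
        have h5 := congrArg (fun g => b q ≫ g ≫ a p) (key q p)
        simpa only [Category.assoc, F.map_comp] using h5.symm
      simp only [h4, ← Preadditive.comp_sum, h₁, Category.comp_id]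
    simp only [h, h₁]

/-- By coassociativity, functionals on `H` act through the convolution product `h ↦ φ(h₁) ψ(h₂)`, so
a right comodule is a left module over the dual algebra. -/
lemma ComoduleStr.act_act {K H M : Type*} [Field K] [AddCommGroup H] [Module K H] [Coalgebra K H]
    [AddCommGroup M] [Module K M] (s : ComoduleStr K H M) (φ ψ : H →ₗ[K] K) (m : M) :
    s.act φ (s.act ψ m) =
      s.act (φ ∘ₗ ComoduleStr.contract H ψ ∘ₗ Coalgebra.comul (R := K)) m := by
  have h := LinearMap.congr_fun s.coassoc m
  simp only [LinearMap.comp_apply, LinearEquiv.coe_coe] at h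
  simp only [ComoduleStr.act, LinearMap.comp_apply]
  rw [ComoduleStr.coact_contract, h]
  generalize s.coact m = x
  induction x using TensorProduct.induction_on with
  | zero => simp
  | tmul m h => simp
  | add a b ha hb => simp only [map_add, ha, hb]

/-- The action of functionals on an element of a comodule, as a linear map. -/
def ComoduleStr.actHom {K H M : Type*} [Field K] [AddCommGroup H] [Module K H] [Coalgebra K H]
    [AddCommGroup M] [Module K M] (s : ComoduleStr K H M) (m : M) : (H →ₗ[K] K) →ₗ[K] M :=
  (TensorProduct.rid K M).toLinearMap ∘ₗ LinearMap.applyₗ (s.coact m) ∘ₗ LinearMap.lTensorHom M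

lemma ComoduleStr.act_eq_actHom {K H M : Type*} [Field K] [AddCommGroup H] [Module K H]
    [Coalgebra K H] [AddCommGroup M] [Module K M] (s : ComoduleStr K H M) (φ : H →ₗ[K] K)
    (m : M) : s.act φ m = s.actHom m φ := rfl

namespace Tannaka

section

variable {K V : Type v} [Field K] [Fintype V] [DecidableEq V]
  {C : Type u} [Category.{v} C] [Preadditive C] [Linear K C] {L : V → C}
  (Ω : C ⥤ Bmd K (V → K)) (hL : IsSplitFiniteSemisimple K L)

variable {Ω hL} in
lemma hom_ext_single {P : Type*} [AddCommGroup P] [Module K P] {F G : Coend Ω hL →ₗ[K] P}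
    (h : ∀ l φ x, F (single Ω hL l (φ ⊗ₜ x)) = G (single Ω hL l (φ ⊗ₜ x))) : F = G := by
  refine LinearMap.ext fun z => ?_
  rw [← sum_single_proj Ω hL z, map_sum, map_sum]
  refine Finset.sum_congr rfl fun l _ => ?_
  generalize proj Ω hL l z = t
  induction t using TensorProduct.induction_on with
  | zero => simp
  | add a b ha hb => simp only [map_add, ha, hb]
  | tmul φ x => exact h _ _ _

/-- The functional on the coend given by a rank one operator on `Ω(L l)`. -/
def rankOne (l : V) : (Ω.obj (L l)).carrier →ₗ[K] Module.Dual K (Ω.obj (L l)).carrier →ₗ[K]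
    Module.Dual K (Coend Ω hL) :=
  LinearMap.mk₂ K (fun w ξ => LinearMap.mul' K K ∘ₗ
      TensorProduct.map (Module.Dual.eval K _ w) ξ ∘ₗ proj Ω hL l)
    (fun w w' ξ => by simp [TensorProduct.map_add_left, LinearMap.add_comp, LinearMap.comp_add])
    (fun c w ξ => by simp [TensorProduct.map_smul_left, LinearMap.smul_comp, LinearMap.comp_smul])
    (fun w ξ ξ' => by simp [TensorProduct.map_add_right, LinearMap.add_comp, LinearMap.comp_add])
    (fun c w ξ => by simp [TensorProduct.map_smul_right, LinearMap.smul_comp, LinearMap.comp_smul])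

lemma rankOne_single_same (l : V) (w : (Ω.obj (L l)).carrier)
    (ξ φ : Module.Dual K (Ω.obj (L l)).carrier) (x : (Ω.obj (L l)).carrier) :
    rankOne Ω hL l w ξ (single Ω hL l (φ ⊗ₜ x)) = φ w * ξ x := by
  change LinearMap.mul' K K (TensorProduct.map _ _ (proj Ω hL l (single Ω hL l (φ ⊗ₜ x)))) = _
  rw [proj_single_same]
  simp

lemma rankOne_single_of_ne {l m : V} (h : l ≠ m) (w : (Ω.obj (L l)).carrier)
    (ξ : Module.Dual K (Ω.obj (L l)).carrier) (t) :
    rankOne Ω hL l w ξ (single Ω hL m t) = 0 := by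
  change LinearMap.mul' K K (TensorProduct.map _ _ (proj Ω hL l (single Ω hL m t))) = _
  rw [proj_single_of_ne _ _ h, map_zero, map_zero]

/-- The functionals of the matrix units are dual to the matrix coefficients of the simple objects.
-/
lemma sum_rankOne_smul_single (h : Coend Ω hL) :
    ∑ l, ∑ i, ∑ j, rankOne Ω hL l (Module.finBasis K (Ω.obj (L l)).carrier i)
      ((Module.finBasis K (Ω.obj (L l)).carrier).coord j) h •
        single Ω hL l ((Module.finBasis K (Ω.obj (L l)).carrier).coord i ⊗ₜ
          Module.finBasis K (Ω.obj (L l)).carrier j) = h := by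
  suffices e : ∑ l, ∑ i, ∑ j, (rankOne Ω hL l (Module.finBasis K (Ω.obj (L l)).carrier i)
      ((Module.finBasis K (Ω.obj (L l)).carrier).coord j)).smulRight
        (single Ω hL l ((Module.finBasis K (Ω.obj (L l)).carrier).coord i ⊗ₜ
          Module.finBasis K (Ω.obj (L l)).carrier j)) = LinearMap.id by
    simpa [LinearMap.sum_apply] using LinearMap.congr_fun e h
  refine hom_ext_single fun l φ x => ?_
  simp only [LinearMap.sum_apply, LinearMap.smulRight_apply, LinearMap.id_apply]
  rw [Finset.sum_eq_single l]
  · simp only [rankOne_single_same]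
    conv_rhs => rw [← (Module.finBasis K (Ω.obj (L l)).carrier).sum_dual_apply_smul_coord φ,
      TensorProduct.sum_tmul, map_sum]
    refine Finset.sum_congr rfl fun i _ => ?_
    conv_rhs => rw [← (Module.finBasis K (Ω.obj (L l)).carrier).sum_repr x,
      TensorProduct.tmul_sum, map_sum]
    refine Finset.sum_congr rfl fun j _ => ?_
    rw [TensorProduct.tmul_smul, ← TensorProduct.smul_tmul', map_smul, map_smul, mul_comm,
      mul_smul, Module.Basis.coord_apply]
  · intro m _ h
    simp [rankOne_single_of_ne Ω hL h]
  · simp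

/-- Consequently a coaction can be recovered from the action of the rank one functionals. -/
lemma tensor_ext_rankOne {N : Type*} [AddCommGroup N] [Module K N] {y z : N ⊗[K] Coend Ω hL}
    (h : ∀ l w ξ, ComoduleStr.contract N (rankOne Ω hL l w ξ) y =
      ComoduleStr.contract N (rankOne Ω hL l w ξ) z) : y = z := by
  have key : ∀ y : N ⊗[K] Coend Ω hL, ∑ l, ∑ i, ∑ j,
      ComoduleStr.contract N (rankOne Ω hL l (Module.finBasis K (Ω.obj (L l)).carrier i)
        ((Module.finBasis K (Ω.obj (L l)).carrier).coord j)) y ⊗ₜ[K]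
        single Ω hL l ((Module.finBasis K (Ω.obj (L l)).carrier).coord i ⊗ₜ
          Module.finBasis K (Ω.obj (L l)).carrier j) = y := by
    intro y
    induction y using TensorProduct.induction_on with
    | zero => simp
    | add a b ha hb =>
      simp only [map_add, TensorProduct.add_tmul, Finset.sum_add_distrib, ha, hb]
    | tmul n h =>
      conv_rhs => rw [← sum_rankOne_smul_single Ω hL h]
      simp only [ComoduleStr.contract_tmul, TensorProduct.smul_tmul, TensorProduct.tmul_sum]
  rw [← key y, ← key z]
  simp only [h]

variable [Ω.Additive] [Ω.Linear K]

lemma comul_single (l : V) (φ : Module.Dual K (Ω.obj (L l)).carrier)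
    (x : (Ω.obj (L l)).carrier) :
    Coalgebra.comul (R := K) (single Ω hL l (φ ⊗ₜ x)) =
      ∑ i, single Ω hL l (φ ⊗ₜ Module.finBasis K (Ω.obj (L l)).carrier i) ⊗ₜ[K]
        single Ω hL l ((Module.finBasis K (Ω.obj (L l)).carrier).coord i ⊗ₜ x) := by
  simp only [← kap_L]
  exact comul_kap Ω hL (L l) φ x

/-- Convolution of rank one functionals is composition of the operators `x ↦ ξ(x) w` and `x ↦ ξ'(x)
w'`. -/
lemma rankOne_conv_same (l : V) (w w' : (Ω.obj (L l)).carrier)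
    (ξ ξ' : Module.Dual K (Ω.obj (L l)).carrier) :
    rankOne Ω hL l w ξ ∘ₗ ComoduleStr.contract (Coend Ω hL) (rankOne Ω hL l w' ξ') ∘ₗ
      Coalgebra.comul (R := K) = ξ w' • rankOne Ω hL l w ξ' := by
  refine hom_ext_single fun m φ x => ?_
  simp only [LinearMap.comp_apply, comul_single, map_sum, ComoduleStr.contract_tmul, map_smul,
    LinearMap.smul_apply]
  rcases eq_or_ne l m with rfl | h
  · simp only [rankOne_single_same, smul_eq_mul]
    have h := congrArg ξ ((Module.finBasis K (Ω.obj (L l)).carrier).sum_repr w')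
    simp only [map_sum, map_smul, smul_eq_mul] at h
    rw [← h, Finset.sum_mul]
    refine Finset.sum_congr rfl fun i _ => ?_
    rw [Module.Basis.coord_apply]
    ring
  · simp [rankOne_single_of_ne Ω hL h]

/-- Distinct simple objects span distinct subcoalgebras, so their matrix algebras annihilate each
other. -/
lemma rankOne_conv_of_ne {l m : V} (h : l ≠ m) (w : (Ω.obj (L l)).carrier)
    (ξ : Module.Dual K (Ω.obj (L l)).carrier) (w' : (Ω.obj (L m)).carrier)
    (ξ' : Module.Dual K (Ω.obj (L m)).carrier) :
    rankOne Ω hL l w ξ ∘ₗ ComoduleStr.contract (Coend Ω hL) (rankOne Ω hL m w' ξ') ∘ₗ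
      Coalgebra.comul (R := K) = 0 := by
  refine hom_ext_single fun n φ x => ?_
  simp only [LinearMap.comp_apply, comul_single, map_sum, ComoduleStr.contract_tmul, map_smul,
    LinearMap.zero_apply]
  refine Finset.sum_eq_zero fun i _ => ?_
  rcases eq_or_ne l n with rfl | h'
  · rw [rankOne_single_of_ne Ω hL h.symm, zero_smul]
  · rw [rankOne_single_of_ne Ω hL h', smul_zero]

/-- The counit is the unit of the dual algebra, that is, the sum of all diagonal matrix units. -/
lemma counit_eq_sum_rankOne : Coalgebra.counit (R := K) (A := Coend Ω hL) =
    ∑ l, ∑ i, rankOne Ω hL l (Module.finBasis K (Ω.obj (L l)).carrier i)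
      ((Module.finBasis K (Ω.obj (L l)).carrier).coord i) := by
  refine hom_ext_single fun l φ x => ?_
  simp only [LinearMap.sum_apply]
  rw [Finset.sum_eq_single l]
  · rw [← kap_L, counit_kap, kap_L]
    simp only [rankOne_single_same]
    conv_lhs => rw [← (Module.finBasis K (Ω.obj (L l)).carrier).sum_repr x, map_sum]
    refine Finset.sum_congr rfl fun i _ => ?_
    rw [map_smul, smul_eq_mul, mul_comm, Module.Basis.coord_apply]
  · intro m _ h
    simp [rankOne_single_of_ne Ω hL h]
  · simp

section

variable {M N : Type*} [AddCommGroup M] [Module K M] [AddCommGroup N] [Module K N]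
  (s : ComoduleStr K (Coend Ω hL) M) (t : ComoduleStr K (Coend Ω hL) N)

lemma act_rankOne_same (l : V) (w w' : (Ω.obj (L l)).carrier)
    (ξ ξ' : Module.Dual K (Ω.obj (L l)).carrier) (m : M) :
    s.act (rankOne Ω hL l w ξ) (s.act (rankOne Ω hL l w' ξ') m) =
      ξ w' • s.act (rankOne Ω hL l w ξ') m := by
  rw [ComoduleStr.act_act, rankOne_conv_same, ComoduleStr.act_eq_actHom, map_smul,
    ComoduleStr.act_eq_actHom]

lemma act_rankOne_of_ne {l k : V} (h : l ≠ k) (w : (Ω.obj (L l)).carrier)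
    (ξ : Module.Dual K (Ω.obj (L l)).carrier) (w' : (Ω.obj (L k)).carrier)
    (ξ' : Module.Dual K (Ω.obj (L k)).carrier) (m : M) :
    s.act (rankOne Ω hL l w ξ) (s.act (rankOne Ω hL k w' ξ') m) = 0 := by
  rw [ComoduleStr.act_act, rankOne_conv_of_ne Ω hL h, ComoduleStr.act_eq_actHom, map_zero]

lemma sum_act_rankOne (m : M) :
    ∑ l, ∑ i, s.act (rankOne Ω hL l (Module.finBasis K (Ω.obj (L l)).carrier i)
      ((Module.finBasis K (Ω.obj (L l)).carrier).coord i)) m = m := by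
  simp only [ComoduleStr.act_eq_actHom, ← map_sum]
  rw [← counit_eq_sum_rankOne, ← ComoduleStr.act_eq_actHom, ComoduleStr.act_counit, LinearMap.id_apply]

variable {s t} in
-- Linearity over the rank one functionals already makes a map a comodule map. The maps to and from
-- simple comodules are checked in this way.
lemma mem_homs_of_rankOne {T : M →ₗ[K] N}
    (h : ∀ l w ξ m, T (s.act (rankOne Ω hL l w ξ) m) = t.act (rankOne Ω hL l w ξ) (T m)) (m : M) :
    t.coact (T m) = T.rTensor (Coend Ω hL) (s.coact m) := by
  refine tensor_ext_rankOne Ω hL fun l w ξ => (h l w ξ m).symm.trans ?_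
  simp only [ComoduleStr.act, LinearMap.comp_apply]
  generalize s.coact m = x
  induction x using TensorProduct.induction_on with
  | zero => simp
  | tmul m h => simp
  | add a b ha hb => simp only [map_add, ha, hb]

/-- The map `w ↦ (w ⊗ ξ) n` from `Ω(L l)` to a comodule. -/
def fromSimple (l : V) (ξ : Module.Dual K (Ω.obj (L l)).carrier) (n : M) :
    (Ω.obj (L l)).carrier →ₗ[K] M :=
  s.actHom n ∘ₗ (rankOne Ω hL l).flip ξ

/-- The map `m ↦ ∑ i, ζ((w ⊗ wⁱ) m) wᵢ` from a comodule to `Ω(L l)`. -/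
def toSimple (l : V) (w : (Ω.obj (L l)).carrier) (ζ : Module.Dual K M) :
    M →ₗ[K] (Ω.obj (L l)).carrier :=
  ∑ i, (ζ ∘ₗ s.act (rankOne Ω hL l w
    ((Module.finBasis K (Ω.obj (L l)).carrier).coord i))).smulRight
      (Module.finBasis K (Ω.obj (L l)).carrier i)

lemma fromSimple_apply (l : V) (ξ : Module.Dual K (Ω.obj (L l)).carrier) (n : M)
    (w : (Ω.obj (L l)).carrier) :
    fromSimple Ω hL s l ξ n w = s.act (rankOne Ω hL l w ξ) n := rfl

lemma toSimple_apply (l : V) (w : (Ω.obj (L l)).carrier) (ζ : Module.Dual K M) (m : M) :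
    toSimple Ω hL s l w ζ m = ∑ i, ζ (s.act (rankOne Ω hL l w
      ((Module.finBasis K (Ω.obj (L l)).carrier).coord i)) m) •
        Module.finBasis K (Ω.obj (L l)).carrier i := by
  simp [toSimple, LinearMap.sum_apply]

/-- The basis used to build `toSimple` disappears: its value is characterized by pairing with all
functionals. -/
lemma dual_toSimple (l : V) (w : (Ω.obj (L l)).carrier) (ζ : Module.Dual K M) (m : M)
    (ξ : Module.Dual K (Ω.obj (L l)).carrier) :
    ξ (toSimple Ω hL s l w ζ m) = ζ (s.act (rankOne Ω hL l w ξ) m) := by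
  rw [toSimple_apply, map_sum]
  conv_rhs => rw [← (Module.finBasis K (Ω.obj (L l)).carrier).sum_dual_apply_smul_coord ξ,
    map_sum, ComoduleStr.act_eq_actHom, map_sum, map_sum]
  refine Finset.sum_congr rfl fun i _ => ?_
  rw [map_smul, map_smul, map_smul, map_smul, ← ComoduleStr.act_eq_actHom, smul_eq_mul,
    smul_eq_mul, mul_comm]

end

end

end Tannaka

/-! ### Fullness and essential surjectivity -/

namespace Tannaka

section

variable {K V : Type v} [Field K] [Fintype V] [DecidableEq V]
  {C : Type u} [Category.{v} C] [Preadditive C] [Linear K C] [MonoidalCategory C] {L : V → C}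
  (Ω : C ⥤ Bmd K (V → K)) (hL : IsSplitFiniteSemisimple K L) [Ω.Additive] [Ω.Linear K]
  [Ω.Monoidal]

lemma act_rankOne_coactStr_same (l : V) (w : (Ω.obj (L l)).carrier)
    (ξ : Module.Dual K (Ω.obj (L l)).carrier) (x : (Ω.obj (L l)).carrier) :
    (coactStr Ω hL (L l)).act (rankOne Ω hL l w ξ) x = ξ x • w := by
  rw [act_coactStr]
  simp only [kap_L, rankOne_single_same, Module.Basis.coord_apply, mul_comm _ (ξ x), mul_smul,
    ← Finset.smul_sum]
  rw [Module.Basis.sum_repr]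

lemma act_rankOne_coactStr_of_ne {l m : V} (h : l ≠ m) (w : (Ω.obj (L l)).carrier)
    (ξ : Module.Dual K (Ω.obj (L l)).carrier) (x : (Ω.obj (L m)).carrier) :
    (coactStr Ω hL (L m)).act (rankOne Ω hL l w ξ) x = 0 := by
  rw [act_coactStr]
  simp only [kap_L, rankOne_single_of_ne Ω hL h, zero_smul, Finset.sum_const_zero]

/-- Were `Ω(L l)` zero, faithfulness would give `𝟙 (L l) = 0`, contradicting the injectivity of `K →
End (L l)`. The pair found here makes `w ⊗ ξ` a rank one idempotent. -/
lemma exists_dual_eq_one [Ω.Faithful] (hL : IsSplitFiniteSemisimple K L) (l : V) :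
    ∃ (w : (Ω.obj (L l)).carrier) (ξ : Module.Dual K (Ω.obj (L l)).carrier), ξ w = 1 := by
  by_cases h : ∀ w : (Ω.obj (L l)).carrier, w = 0
  · have h0 : (0 : L l ⟶ L l) = 𝟙 (L l) := Ω.map_injective <| Bmd.hom_ext <|
      LinearMap.ext fun w => by rw [h w, map_zero, map_zero]
    have h1 : (0 : K) = 1 := (hL.end_bijective l).1 (by simpa using h0)
    exact absurd h1 zero_ne_one
  · push Not at h
    obtain ⟨w, hw⟩ := h
    obtain ⟨ξ, hξ⟩ := not_forall.mp fun h => hw ((Module.forall_dual_apply_eq_zero_iff K w).mp h)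
    exact ⟨w, (ξ w)⁻¹ • ξ, inv_mul_cancel₀ hξ⟩

instance [Ω.Faithful] : (toCom Ω hL).Faithful where
  map_injective h := Ω.map_injective (Bmd.hom_ext (congrArg Com.lin h))

/-- Schur's lemma for matrix algebras. As `w = (w ⊗ ξ₀) w₀`, one has `T w = (w ⊗ ξ₀) (T w₀)`. This
is `ξ₀(T w₀) w` when the targets agree, and zero otherwise because the functional of `l` kills `Ω(L
m)`. -/
lemma exists_map_of_act_rankOne [Ω.Faithful] {l m : V}
    (T : (Ω.obj (L l)).carrier →ₗ[K] (Ω.obj (L m)).carrier)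
    (hT : ∀ k w ξ x, T ((coactStr Ω hL (L l)).act (rankOne Ω hL k w ξ) x) =
      (coactStr Ω hL (L m)).act (rankOne Ω hL k w ξ) (T x)) :
    ∃ g : L l ⟶ L m, Bmd.lin (Ω.map g) = T := by
  obtain ⟨w₀, ξ₀, h₀⟩ := exists_dual_eq_one Ω hL l
  rcases eq_or_ne l m with rfl | h
  · refine ⟨ξ₀ (T w₀) • 𝟙 (L l), ?_⟩
    rw [Functor.map_smul, CategoryTheory.Functor.map_id]
    refine LinearMap.ext fun w => ?_
    have h2 := hT l w ξ₀ w₀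
    rw [act_rankOne_coactStr_same, act_rankOne_coactStr_same, h₀, one_smul] at h2
    exact h2.symm
  · refine ⟨0, ?_⟩
    rw [Functor.map_zero]
    refine LinearMap.ext fun w => ?_
    have h2 := hT l w ξ₀ w₀
    rw [act_rankOne_coactStr_same, act_rankOne_coactStr_of_ne Ω hL h, h₀, one_smul] at h2
    exact h2.symm

lemma exists_map_toCom_simple [Ω.Faithful] {l m : V}
    (S : (toCom Ω hL).obj (L l) ⟶ (toCom Ω hL).obj (L m)) :
    ∃ g : L l ⟶ L m, (toCom Ω hL).map g = S := by
  obtain ⟨g, hg⟩ := exists_map_of_act_rankOne Ω hL (Com.lin S) fun k w ξ x =>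
    ComoduleStr.act_hom _ _ (Com.lin S) S.2 (rankOne Ω hL k w ξ) x
  exact ⟨g, Com.hom_ext hg⟩

-- Resolutions of `X` and `Y` cut `T` into a matrix of comodule maps between simple objects, each of
-- which lifts.
instance [Ω.Faithful] : (toCom Ω hL).Full where
  map_surjective {X Y} T := by
    let r := hL.resolution X
    let t := hL.resolution Y
    choose g hg using fun i j => exists_map_toCom_simple Ω hL
      ((toCom Ω hL).map (r.ι i) ≫ T ≫ (toCom Ω hL).map (t.π j))
    refine ⟨∑ i, ∑ j, r.π i ≫ g i j ≫ t.ι j, ?_⟩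
    simp only [Functor.map_sum, Functor.map_comp, hg]
    have h1 : ∑ i, (toCom Ω hL).map (r.π i) ≫ (toCom Ω hL).map (r.ι i) = 𝟙 _ := by
      simp only [← Functor.map_comp, ← Functor.map_sum, r.total, CategoryTheory.Functor.map_id]
    have h2 : ∑ j, (toCom Ω hL).map (t.π j) ≫ (toCom Ω hL).map (t.ι j) = 𝟙 _ := by
      simp only [← Functor.map_comp, ← Functor.map_sum, t.total, CategoryTheory.Functor.map_id]
    simp only [Category.assoc, ← Preadditive.comp_sum, h2, Category.comp_id]
    simp only [← Category.assoc, ← Preadditive.sum_comp, h1, Category.id_comp]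

/-- The comodule map `fromSimple`. -/
def ofSimple (M : Com K V (Coend Ω hL)) (l : V) (ξ : Module.Dual K (Ω.obj (L l)).carrier)
    (n : M.carrier) : (toCom Ω hL).obj (L l) ⟶ M :=
  Com.ofLin (M := (toCom Ω hL).obj (L l)) (fromSimple Ω hL M.str l ξ n) <|
    mem_homs_of_rankOne Ω hL (s := coactStr Ω hL (L l)) (t := M.str) fun k w η x => by
      rcases eq_or_ne k l with rfl | h
      · rw [act_rankOne_coactStr_same, map_smul, fromSimple_apply, fromSimple_apply,
          act_rankOne_same]
      · rw [act_rankOne_coactStr_of_ne Ω hL h, map_zero, fromSimple_apply,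
          act_rankOne_of_ne Ω hL _ h]

/-- The comodule map `toSimple`. -/
def ontoSimple (M : Com K V (Coend Ω hL)) (l : V) (w : (Ω.obj (L l)).carrier)
    (ζ : Module.Dual K M.carrier) : M ⟶ (toCom Ω hL).obj (L l) :=
  Com.ofLin (N := (toCom Ω hL).obj (L l)) (toSimple Ω hL M.str l w ζ) <|
    mem_homs_of_rankOne Ω hL (s := M.str) (t := coactStr Ω hL (L l)) fun k v η x => by
      rcases eq_or_ne k l with rfl | h
      · rw [act_rankOne_coactStr_same, dual_toSimple, toSimple_apply]
        simp only [act_rankOne_same, map_smul, smul_eq_mul, mul_comm _ (ζ _), mul_smul,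
          ← Finset.smul_sum, Module.Basis.coord_apply, Module.Basis.sum_repr]
      · rw [act_rankOne_coactStr_of_ne Ω hL h, toSimple_apply]
        simp only [act_rankOne_of_ne Ω hL _ h.symm, map_zero, zero_smul, Finset.sum_const_zero]

instance [Ω.Faithful] [HasFiniteBiproducts C] : (toCom Ω hL).EssSurj where
  mem_essImage M := by
    choose w ξ hξ using exists_dual_eq_one Ω hL
    -- Each `P l` is the action of the rank one idempotent `w l ⊗ ξ l`; its range is the
    -- multiplicity space of `Ω(L l)` in `M`, with basis `B l`.
    let P : V → M.carrier →ₗ[K] M.carrier := fun l => M.str.act (rankOne Ω hL l (w l) (ξ l))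
    have hP : ∀ l v η x, M.str.act (rankOne Ω hL l v (ξ l)) (M.str.act (rankOne Ω hL l (w l) η) x)
        = M.str.act (rankOne Ω hL l v η) x := fun l v η x => by
      rw [act_rankOne_same, hξ, one_smul]
    let B l := Module.finBasis K (LinearMap.range (P l))
    have hB : ∀ l j, P l (B l j : M.carrier) = B l j := fun l j => by
      obtain ⟨y, hy⟩ := (B l j).2
      rw [← hy]
      exact hP l (w l) (ξ l) y
    -- Coordinates along `B l`, extended to all of `M` by first applying `P l`.
    let ζ : ∀ l, Fin (Module.finrank K (LinearMap.range (P l))) → Module.Dual K M.carrier :=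
      fun l j => (B l).coord j ∘ₗ (P l).rangeRestrict
    have hζ : ∀ l y, ∑ j, ζ l j y • (B l j : M.carrier) = P l y := fun l y => by
      have h := congrArg Subtype.val ((B l).sum_repr ((P l).rangeRestrict y))
      rwa [AddSubmonoidClass.coe_finsetSum] at h
    have hζB : ∀ l i j, ζ l i (B l j) = if j = i then 1 else 0 := fun l i j => by
      have h : (P l).rangeRestrict (B l j) = B l j := Subtype.ext (hB l j)
      change (B l).coord i ((P l).rangeRestrict (B l j)) = _
      rw [h, Module.Basis.coord_apply, Module.Basis.repr_self, Finsupp.single_apply]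
    have hsame : ∀ l i j (x : (Ω.obj (L l)).carrier),
        toSimple Ω hL M.str l (w l) (ζ l i) (fromSimple Ω hL M.str l (ξ l) (B l j) x) =
          (if j = i then (1 : K) else 0) • x := fun l i j x => by
      have h : M.str.act (rankOne Ω hL l (w l) (ξ l)) (B l j) = B l j := hB l j
      rw [fromSimple_apply, toSimple_apply]
      simp only [act_rankOne_same, h, map_smul, hζB, smul_eq_mul, mul_comm _ (ite _ _ _),
        mul_smul, ← Finset.smul_sum, Module.Basis.coord_apply, Module.Basis.sum_repr]
    have hne : ∀ l k i j (x : (Ω.obj (L l)).carrier), l ≠ k →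
        toSimple Ω hL M.str k (w k) (ζ k i) (fromSimple Ω hL M.str l (ξ l) (B l j) x) = 0 :=
      fun l k i j x h => by
        rw [fromSimple_apply, toSimple_apply]
        simp only [act_rankOne_of_ne Ω hL _ h.symm, map_zero, zero_smul, Finset.sum_const_zero]
    -- Completeness comes from the factorization `wᵢ ⊗ wⁱ = (wᵢ ⊗ ξ) (w ⊗ ξ) (w ⊗ wⁱ)`, whose middle
    -- factor `P l` is expanded in `B l`. Summing over `i` and `l` gives the counit, hence `m`.
    have htotal : ∀ m, ∑ p : Σ l, Fin (Module.finrank K (LinearMap.range (P l))),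
        fromSimple Ω hL M.str p.1 (ξ p.1) (B p.1 p.2)
          (toSimple Ω hL M.str p.1 (w p.1) (ζ p.1 p.2) m) = m := fun m => by
      conv_rhs => rw [← sum_act_rankOne Ω hL M.str m]
      rw [Fintype.sum_sigma]
      refine Finset.sum_congr rfl fun l _ => ?_
      simp only [toSimple_apply, map_sum, map_smul, fromSimple_apply]
      rw [Finset.sum_comm]
      refine Finset.sum_congr rfl fun i _ => ?_
      simp only [← map_smul (M.str.act _)]
      rw [← map_sum, hζ, hP, hP]
    -- The comodule is the sum of one copy of `Ω(L l)` for each vector of `B l`, so its preimage is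
    -- the corresponding biproduct in `C`.
    obtain ⟨e⟩ := Functor.nonempty_iso_biproduct (toCom Ω hL)
      (fun p : Σ l, Fin (Module.finrank K (LinearMap.range (P l))) => L p.1) M
      (fun p => ofSimple Ω hL M p.1 (ξ p.1) (B p.1 p.2))
      (fun p => ontoSimple Ω hL M p.1 (w p.1) (ζ p.1 p.2))
      (Com.hom_ext ((map_sum (Submodule.subtype _) _ _).trans (LinearMap.ext fun m =>
        (LinearMap.sum_apply _ _ _).trans (htotal m))))
      (fun p => Com.hom_ext (LinearMap.ext fun x => (hsame p.1 p.2 p.2 x).trans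
        ((congrArg (· • _) (if_pos rfl)).trans (one_smul K _))))
      (by
        rintro ⟨l, i⟩ ⟨k, j⟩ hpq
        refine Com.hom_ext (LinearMap.ext fun x => ?_)
        rcases eq_or_ne l k with rfl | h
        · exact (hsame l j i x).trans ((congrArg (· • _)
            (if_neg fun h => hpq (by rw [h]))).trans (zero_smul K _))
        · exact hne l k j i x h)
    exact ⟨_, ⟨e⟩⟩

instance [Ω.Faithful] [HasFiniteBiproducts C] : (toCom Ω hL).IsEquivalence where

end

end Tannaka

end

/-! ### The theorem -/

theorem mainTheorem2 {K V : Type v} [Field K] [Fintype V] [DecidableEq V] [Nonempty V]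
    {C : Type u} [Category.{v} C] [Abelian C] [Linear K C] [MonoidalCategory C]
    [MonoidalPreadditive C] [MonoidalLinear K C]
    (L : V → C) (hL : IsSplitFiniteSemisimple K L) :
    (Omega0 L hL).Faithful ∧ (Omega0 L hL).Additive ∧ (Omega0 L hL).Linear K ∧
    PreservesFiniteLimits (Omega0 L hL) ∧ PreservesFiniteColimits (Omega0 L hL) ∧
    ∃ _ : (Omega0 L hL).Monoidal,
      (∀ (X Y : C) (f : ∀ l n : V, L n ⟶ L l ⊗ X) (g : ∀ n m : V, L m ⟶ L n ⊗ Y),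
        Bmd.lin (Functor.LaxMonoidal.μ (Omega0 L hL) X Y)
          (Bmd.tmk _ _ (omega0Elt L hL f) (omega0Elt L hL g)) =
        omega0Elt L hL fun l m => ∑ n : V, g n m ≫ (f l n ▷ Y) ≫ (α_ (L l) X Y).hom) ∧
      (∀ l : V, Bmd.lin (Functor.LaxMonoidal.ε (Omega0 L hL)) (Pi.single l 1 : V → K) =
        omega0Elt L hL (Pi.single l (Pi.single l (ρ_ (L l)).inv))) ∧
      ∃ (H : Type v) (_ : Ring H) (_ : Algebra K H) (_ : Coalgebra K H) (_ : FaceAlgebra K V H)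
        (κ : ∀ X : C, Module.Dual K ((Omega0 L hL).obj X).carrier ⊗[K]
          ((Omega0 L hL).obj X).carrier →ₗ[K] H),
        IsTannakaFaceAlgebra (Omega0 L hL) κ ∧
        ∃ (F : C ⥤ Com K V H) (_ : F.Monoidal) (e : F ⋙ Com.forget K V H ≅ Omega0 L hL),
          NatTrans.IsMonoidal e.hom ∧
          (∀ (X : C) (m : (F.obj X).carrier),
            tannakaCoact κ X (Bmd.lin (e.hom.app X) m) =
              (Bmd.lin (e.hom.app X)).rTensor H ((F.obj X).str.coact m)) ∧
          F.Additive ∧ F.Linear K ∧ F.IsEquivalence := by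
  have := Omega0.faithful hL
  have : HasFiniteBiproducts C := Abelian.hasFiniteBiproducts
  let _ := (Omega0.coreMonoidal hL).toMonoidal
  refine ⟨inferInstance, inferInstance, inferInstance, hL.preservesFiniteLimits _,
    hL.preservesFiniteColimits _, inferInstance, fun _ _ _ _ => rfl, fun l => ?_,
    Tannaka.Coend (Omega0 L hL) hL, inferInstance, inferInstance, inferInstance, inferInstance,
    Tannaka.kap (Omega0 L hL) hL, Tannaka.isTannakaFaceAlgebra (Omega0 L hL) hL,
    Tannaka.toCom (Omega0 L hL) hL, inferInstance, Tannaka.compare (Omega0 L hL) hL,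
    Tannaka.compare_isMonoidal _ hL, Tannaka.tannakaCoact_compare _ hL, inferInstance,
    inferInstance, inferInstance⟩
  -- The unit `ε` is `Omega0.one` by construction; only its value on an idempotent of `R` has to be
  -- computed.
  refine Eq.trans (b := Omega0.one K L (Pi.single l 1)) rfl (funext fun k => ?_)
  rw [Omega0.one_apply]
  rcases eq_or_ne k l with rfl | h
  · simp
  · simp [h]
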